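/- **Setting.** Let $d\ge 2$ and $\omega=(\alpha,1)\in\mathbb R^d$ with $\omega\cdot k\ne0$ for all $k\in\mathbb Z^d\setminus\{0\}$. Vectors carry the norm $\|u\|=\sum_i|u_i|$. *Function spaces.* For $r\in\mathbb R$ let $\mathcal A_r$, $\mathcal A'_r$ be the spaces of Fourier series $f(x)=\sum_{k\in\mathbb Z^d}f_k e^{2\pi i k\cdot x}$, $f_k\in\mathbb C^d$, with finite norm $$\|f\|_r=\sum_k\|f_k\|e^{r\|k\|},\qquad \|f\|'_r=\sum_k(1+2\pi\|k\|)\|f_k\|e^{r\|k\|}$$ respectively (for $r>0$ they are analytic on $D_r=\{x\in\mathbb C^d:\|\operatorname{Im}x\|<r/2\pi\}$). Put $\mathbb E f=f_0$, and call $f$ real-analytic if moreover $f(\mathbb R^d)\subset\mathbb R^d$. For such $X$, $\operatorname{Rot}X=\omega$ means that the flow $\Phi^t$ of $X$ on $\mathbb R^d$ satisfies $(\Phi^t(x)-x)/t\to\omega$ as $t\to+\infty$ for every $x\in\mathbb R^d$. *Continued fractions.* Let $M_\omega=\begin{pmatrix}I&\alpha\\0&1\end{pmatrix}$, $E^t=\operatorname{diag}(e^{-t},\dots,e^{-t},e^{(d-1)t})$,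 let $\mathcal F\ni M_\omega$ be a fundamental domain of $SL(d,\mathbb Z)\backslash SL(d,\mathbb R)$ (exactly one point in each orbit), and let $P(t)\in SL(d,\mathbb Z)$ be the unique matrix with $P(t)M_\omega E^t\in\mathcal F$. Let $0=t_0<t_1<\dots\to+\infty$ with $P(t_n)\neq P(t_{n-1})$ for $n\ge1$. Put $P_n=P(t_n)$, $T_n=P_nP_{n-1}^{-1}$, $\lambda_n=1/(P_n\omega)_d$, $\eta_n=\lambda_n/\lambda_{n-1}$ and $\omega_n=\lambda_nP_n\omega$. *Resonances.* Let $\sigma_n$, $n\ge0$, satisfy $0<\sigma_n<\|\omega_n\|$. Let $I_n^+=\{k\in\mathbb Z^d:|k\cdot\omega_n|\le\sigma_n\|k\|\}$, $I_n^-=\mathbb Z^d\setminus I_n^+$, let $\mathbb I_n^{\pm}$ be the projections onto the Fourier modes in $I_n^\pm$, and $$A_n=\sup_{k\in I_n^+\setminus\{0\}}\frac{\|{}^{t}T_{n+1}^{-1}k\|}{\|k\|}.$$ Fix $\delta,\nu>0$ and put $\varepsilon_n=\frac{\sigma_n}{42}\min\{\frac{\nu}{4\pi},\frac{\sigma_n}{72\|\omega_n\|}\}$.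 Let $\mathcal L_n(X)=\eta_nT_n\,X\circ T_n^{-1}$. *Strip widths.* Let $\rho\in\mathbb R$. Put $\mathcal B_0=0$, $\rho_0=\rho$ and, recursively for $n\ge1$, $$\phi_n=\max\Big\{1,\,2(d+1)\|\widetilde{\mathcal L}_n\|\frac{\varepsilon_{n-1}}{\varepsilon_n}\Big\},\qquad \mathcal B_n=\sum_{i=0}^{n-1}A_0\cdots A_i\log\big(e^{\delta+\nu/A_i}\phi_{i+1}\big),\qquad \rho_n=\frac{\rho-\mathcal B_n}{A_0\cdots A_{n-1}},$$ where $\|\widetilde{\mathcal L}_n\|$ is the operator norm of $\mathcal L_n$ from $(\mathbb I^+_{n-1}-\mathbb E)\mathcal A_{\rho_{n-1}-\nu}$ to $\mathcal A'_{r'}$ with $r'=(\rho_{n-1}-\nu)/A_{n-1}-\delta$. Put $\mathcal B(\omega,\sigma)=\lim_n\mathcal B_n$ if this limit exists. *Renormalization.* Let $\mathcal V_n$ be the open ball in $\mathcal A'_{\rho_n}$ with centre $\omega_n$ and radius $\varepsilon_n$. Suppose $\rho_n>\nu$. A *uniformization* at step $n$ assigns to each $X\in\mathcal V_n$ a map $\mathfrak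 U_n(X)\in\mathrm{id}+\mathcal A'_{\rho_n-\nu}$, real on $\mathbb R^d$ if $X$ is real-analytic, such that $\mathcal U_n(X)=\mathfrak U_n(X)^*X=(D\mathfrak U_n(X))^{-1}X\circ\mathfrak U_n(X)$ (an identity on $D_{\rho_n-\nu}$) belongs to $\mathcal A_{\rho_n-\nu}$ and $$\mathbb I_n^-\mathcal U_n(X)=0,\quad \|\mathfrak U_n(X)-\mathrm{id}\|'_{\rho_n-\nu}\le\tfrac{42}{\sigma_n}\|\mathbb I_n^-X\|_{\rho_n-\nu},\quad \|\mathcal U_n(X)-\omega_n\|_{\rho_n-\nu}\le2\|X-\omega_n\|'_{\rho_n}.$$ Given uniformizations for all $n$, let $X_0=X$ and $X_{n}=\mathcal R_n(X)=\mathcal I_n\mathcal L_n\mathcal U_{n-1}(X_{n-1})$, where $\mathcal I_n$ is restriction to $D_{\rho_n}$. $X\in\mathcal A'_\rho$ is *infinitely renormalizable* if it is in the domain of every $\mathcal R_n$, i.e. for all $n\ge1$: $X_{n-1}\in\mathcal V_{n-1}$, $\rho_n>0$ and $X_n\in\mathcal A'_{\rho_n}$. **Theorem.** Suppose that $\mathcal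 B(\omega,\sigma)$ exists and $\rho>\mathcal B(\omega,\sigma)$. Then $\rho_n>\nu$ and a uniformization exists at every step $n\ge0$. Moreover, for every choice of uniformizations, if $X\in\mathcal A'_\rho$ is real-analytic with $$\operatorname{Rot}X=\omega,\qquad \|X-\mathbb EX\|'_\rho<\frac{\varepsilon_0}{d+1},$$ then $X$ is infinitely renormalizable and $\|X_n-\omega_n\|'_{\rho_n}<\varepsilon_n$ for all $n\ge0$. -/

import Mathlib

open Filter Topology
open scoped Matrix MatrixGroups

noncomputable section

namespace TorusRenorm

/-! ### Vector fields on the torus and their Fourier norms -/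

/-- The `ℓ¹`-norm `∑ |x i|` of a vector with integer, real or complex entries. -/
def l1 {d : ℕ} {K : Type*} [Norm K] (x : Fin d → K) : ℝ := ∑ i, ‖x i‖

/-- The pairing `k · v` of an integer vector with a real vector. -/
def pair {d : ℕ} (k : Fin d → ℤ) (v : Fin d → ℝ) : ℝ := ∑ i, (k i : ℝ) * v i

/-- The complex strip `D_r = {x ∈ ℂᵈ : ‖Im x‖ < r / 2π}`. -/
def strip (d : ℕ) (r : ℝ) : Set (Fin d → ℂ) :=
  {x | l1 (fun i => (x i).im) < r / (2 * Real.pi)}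

/-- A periodic vector field in Fourier form, given by its family of coefficients
`f_k ∈ ℂᵈ`, `k ∈ ℤᵈ`. The function itself is `eval f`. -/
abbrev VF (d : ℕ) := (Fin d → ℤ) → (Fin d → ℂ)

/-- The function `x ↦ ∑_k f_k exp (2 π i k · x)`. -/
def eval {d : ℕ} (f : VF d) (x : Fin d → ℂ) : Fin d → ℂ :=
  ∑' k, Complex.exp (2 * Real.pi * Complex.I * ∑ i, (k i : ℂ) * x i) • f k

/-- The space `𝒜_r`: the fields for which `‖f‖_r` is finite. They are analytic on `strip d r`. -/
def spA (d : ℕ) (r : ℝ) : Set (VF d) :=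
  {f | Summable fun k => l1 (f k) * Real.exp (r * l1 k)}

/-- The norm `‖f‖_r` of `𝒜_r`. -/
def nA {d : ℕ} (r : ℝ) (f : VF d) : ℝ := ∑' k, l1 (f k) * Real.exp (r * l1 k)

/-- The space `𝒜'_r`: the fields for which `‖f‖'_r` is finite. -/
def spA' (d : ℕ) (r : ℝ) : Set (VF d) :=
  {f | Summable fun k => (1 + 2 * Real.pi * l1 k) * l1 (f k) * Real.exp (r * l1 k)}

/-- The norm `‖f‖'_r` of `𝒜'_r`. -/
def nA' {d : ℕ} (r : ℝ) (f : VF d) : ℝ :=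
  ∑' k, (1 + 2 * Real.pi * l1 k) * l1 (f k) * Real.exp (r * l1 k)

/-- The constant vector field with real value `v`. -/
def constVF {d : ℕ} (v : Fin d → ℝ) : VF d := Pi.single 0 (fun i => (v i : ℂ))

/-- The non-constant part `(𝕀 - 𝔼) f`. -/
def nonConst {d : ℕ} (f : VF d) : VF d := Function.update f 0 0

/-- The field takes real values at real points. -/
def IsRealVF {d : ℕ} (f : VF d) : Prop :=
  ∀ (x : Fin d → ℝ) (i : Fin d), (eval f (fun j => (x j : ℂ)) i).im = 0

/-- The restriction to `ℝᵈ` of (the real part of) a vector field. -/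
def onReal {d : ℕ} (f : VF d) (x : Fin d → ℝ) : Fin d → ℝ :=
  fun i => (eval f (fun j => (x j : ℂ)) i).re

/-- `Rot V = w`: the flow `Φ` on `ℝᵈ` generated by `V` (the lift of the torus flow) satisfies
`(Φᵗ x - x) / t → w` as `t → ∞`, for every initial point `x`. -/
def HasRot {d : ℕ} (V : (Fin d → ℝ) → (Fin d → ℝ)) (w : Fin d → ℝ) : Prop :=
  ∃ Φ : Flow ℝ (Fin d → ℝ),
    (∀ x t, HasDerivAt (fun s => Φ s x) (V (Φ t x)) t) ∧
    ∀ x, Tendsto (fun t : ℝ => t⁻¹ • (Φ t x - x)) atTop (𝓝 w)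

/-! ### Elimination of the far from resonance modes -/

/-- The far from resonance modes `I⁻_s` with respect to `v`. -/
def far {d : ℕ} (v : Fin d → ℝ) (s : ℝ) : Set (Fin d → ℤ) := {k | s * l1 k < |pair k v|}

/-- The resonant modes `I⁺_s` with respect to `v`. -/
def res {d : ℕ} (v : Fin d → ℝ) (s : ℝ) : Set (Fin d → ℤ) := {k | |pair k v| ≤ s * l1 k}

/-- The projection `𝕀⁻_s f` onto the far from resonance modes. -/
def projFar {d : ℕ} (v : Fin d → ℝ) (s : ℝ) (f : VF d) : VF d := (far v s).indicator f

/-- The radius `ε = (s / 42) min {ν / 4π, s / (72 ‖v‖)}`. -/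
def eps {d : ℕ} (v : Fin d → ℝ) (s ν : ℝ) : ℝ :=
  s / 42 * min (ν / (4 * Real.pi)) (s / (72 * l1 v))

/-- The open ball of `𝒜'_r` of radius `e` about the constant field `v`. -/
def ball' {d : ℕ} (r : ℝ) (v : Fin d → ℝ) (e : ℝ) : Set (VF d) :=
  {X | X ∈ spA' d r ∧ nA' r (X - constVF v) < e}

/-- `Y = U^* X = (DU)⁻¹ X ∘ U` on the strip `D_r`, where `U = id + u`. -/
def IsPullback {d : ℕ} (r : ℝ) (u X Y : VF d) : Prop :=
  ∀ x ∈ strip d r, eval Y x =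
    (fderiv ℂ (fun y : Fin d → ℂ => y + eval u y) x).inverse (eval X (x + eval u x))

/-- `X ↦ U_X = id + disp X` is a uniformization (full elimination of the modes in `I⁻_s`)
on the open ball of radius `ε` in `𝒜'_{r+ν}` about `v`, with values in `id + 𝒜'_r`,
and `X ↦ elim X` is the induced map `X ↦ U_X^* X` into `𝕀⁺ 𝒜_r`. -/
structure IsUniformization {d : ℕ} (v : Fin d → ℝ) (s r ν : ℝ) (disp elim : VF d → VF d) :
    Prop where
  disp_mem : ∀ X ∈ ball' (r + ν) v (eps v s ν), disp X ∈ spA' d r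
  elim_mem : ∀ X ∈ ball' (r + ν) v (eps v s ν), elim X ∈ spA d r
  pullback : ∀ X ∈ ball' (r + ν) v (eps v s ν), IsPullback r (disp X) X (elim X)
  eliminates : ∀ X ∈ ball' (r + ν) v (eps v s ν), projFar v s (elim X) = 0
  disp_le : ∀ X ∈ ball' (r + ν) v (eps v s ν),
    nA' r (disp X) ≤ 42 / s * nA r (projFar v s X)
  elim_le : ∀ X ∈ ball' (r + ν) v (eps v s ν),
    nA r (elim X - constVF v) ≤ 2 * nA' (r + ν) (X - constVF v)
  real : ∀ X ∈ ball' (r + ν) v (eps v s ν), IsRealVF X → IsRealVF (disp X)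

/-! ### Linear rescaling -/

/-- The rescaled field `η T X ∘ T⁻¹`, on Fourier coefficients: since
`k · T⁻¹ x = (ᵗT⁻¹ k) · x`, the mode `k = ᵗT j` of `X` becomes the mode `j`. -/
def rescale {d : ℕ} (η : ℝ) (T : SL(d, ℤ)) (X : VF d) : VF d :=
  fun j => (η : ℂ) • ((T : Matrix (Fin d) (Fin d) ℤ).map (Int.cast : ℤ → ℂ) *ᵥ
    X ((T : Matrix (Fin d) (Fin d) ℤ)ᵀ *ᵥ j))

/-- `rescale η T X` is indeed the field `η T X ∘ T⁻¹`. -/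
theorem eval_rescale {d : ℕ} (η : ℝ) (T : SL(d, ℤ)) (X : VF d) (x : Fin d → ℂ)
    (hx : Summable fun k : Fin d → ℤ =>
      Complex.exp (2 * Real.pi * Complex.I * ∑ i, (k i : ℂ) * x i) • X k) :
    eval (rescale η T X) ((T : Matrix (Fin d) (Fin d) ℤ).map (Int.cast : ℤ → ℂ) *ᵥ x) =
      (η : ℂ) • ((T : Matrix (Fin d) (Fin d) ℤ).map (Int.cast : ℤ → ℂ) *ᵥ eval X x) := by
  let M : Matrix (Fin d) (Fin d) ℂ := (T : Matrix (Fin d) (Fin d) ℤ).map (Int.cast : ℤ → ℂ)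
  let L : (Fin d → ℂ) →L[ℂ] (Fin d → ℂ) :=
    LinearMap.toContinuousLinearMap ((η : ℂ) • Matrix.toLin' M)
  have hL : ∀ y, L y = (η : ℂ) • (M *ᵥ y) := fun y => by simp [L]
  let e : (Fin d → ℤ) ≃ (Fin d → ℤ) :=
    { toFun := fun j => (T : Matrix (Fin d) (Fin d) ℤ)ᵀ *ᵥ j
      invFun := fun j => ((T⁻¹ : SL(d, ℤ)) : Matrix (Fin d) (Fin d) ℤ)ᵀ *ᵥ j
      left_inv := fun j => by
        simp only [Matrix.mulVec_mulVec, ← Matrix.transpose_mul,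
          ← Matrix.SpecialLinearGroup.coe_mul]
        simp
      right_inv := fun j => by
        simp only [Matrix.mulVec_mulVec, ← Matrix.transpose_mul,
          ← Matrix.SpecialLinearGroup.coe_mul]
        simp }
  have h1 := L.map_tsum hx
  rw [hL] at h1
  unfold eval
  refine Eq.trans ?_ h1.symm
  rw [← e.tsum_eq (fun z : Fin d → ℤ =>
    L (Complex.exp (2 * Real.pi * Complex.I * ∑ i, (z i : ℂ) * x i) • X z))]
  refine tsum_congr fun j => ?_
  have h2 : ∑ i, (j i : ℂ) * (M *ᵥ x) i = ∑ i, ((e j) i : ℂ) * x i := by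
    change _ = ∑ i, ((((T : Matrix (Fin d) (Fin d) ℤ)ᵀ *ᵥ j) i : ℤ) : ℂ) * x i
    simp only [Matrix.mulVec, dotProduct, Finset.mul_sum, Matrix.transpose_apply, Int.cast_sum,
      Int.cast_mul, Finset.sum_mul, M, Matrix.map_apply]
    rw [Finset.sum_comm]
    exact Finset.sum_congr rfl fun i _ => Finset.sum_congr rfl fun k _ => by ring
  rw [map_smul, hL, ← h2]
  rfl

/-- The subspace `(𝕀⁺_s - 𝔼) 𝒜_r`: only non-zero resonant modes. -/
def resNonConst {d : ℕ} (v : Fin d → ℝ) (s r : ℝ) : Set (VF d) :=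
  {f | f ∈ spA d r ∧ projFar v s f = 0 ∧ f 0 = 0}

/-- The operator norm of `X ↦ η T X ∘ T⁻¹` from `(𝕀⁺_s - 𝔼) 𝒜_r` into `𝒜'_{r'}`. -/
def opNorm {d : ℕ} (v : Fin d → ℝ) (s r r' : ℝ) (η : ℝ) (T : SL(d, ℤ)) : ℝ :=
  sSup {y | ∃ f ∈ resNonConst v s r, nA r f ≤ 1 ∧ y = nA' r' (rescale η T f)}

/-! ### Multidimensional continued fractions -/

/-- The vector `ω = (α, 1)` in dimension `d = m + 1`. -/
def omegaVec {m : ℕ} (α : Fin m → ℝ) : Fin (m + 1) → ℝ := Fin.snoc α 1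

/-- The matrix with identity block, last column `(α, 1)` and last row `(0, 1)`. -/
def matOmega {m : ℕ} (α : Fin m → ℝ) : SL(m + 1, ℝ) :=
  ⟨Matrix.of fun i j => if j = Fin.last m then omegaVec α i else if i = j then 1 else 0, by
    rw [Matrix.det_of_isUpperTriangular]
    · rw [Fin.prod_univ_castSucc]
      simp [omegaVec, (Fin.castSucc_lt_last _).ne]
    · intro i j hij
      simp only [id] at hij
      have h1 : j ≠ Fin.last m := (lt_of_lt_of_le hij (Fin.le_last i)).ne
      simp [h1, hij.ne']⟩

/-- `Eᵗ = diag (e⁻ᵗ, …, e⁻ᵗ, e^{(d-1)t})` with `d = m + 1`. -/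
def matE (m : ℕ) (t : ℝ) : SL(m + 1, ℝ) :=
  ⟨Matrix.diagonal fun i => if i = Fin.last m then Real.exp (m * t) else Real.exp (-t), by
    rw [Matrix.det_diagonal, Fin.prod_univ_castSucc]
    simp only [(Fin.castSucc_lt_last _).ne, if_false, if_true, Finset.prod_const,
      Finset.card_univ, Fintype.card_fin]
    rw [← Real.exp_nat_mul, ← Real.exp_add]
    simp⟩

/-- The inclusion of `SL(d, ℤ)` in `SL(d, ℝ)`. -/
abbrev toSLR {d : ℕ} (g : SL(d, ℤ)) : SL(d, ℝ) :=
  Matrix.SpecialLinearGroup.map (Int.castRingHom ℝ) g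

/-- A (strict) fundamental domain of `SL(d, ℤ) \ SL(d, ℝ)`: it contains exactly one point
of each orbit. -/
def IsFundDomain {d : ℕ} (F : Set SL(d, ℝ)) : Prop :=
  ∀ g : SL(d, ℝ), ∃! p : SL(d, ℤ), toSLR p * g ∈ F

/-- For a fundamental domain `F`, the unique `P(t) ∈ SL(d, ℤ)` with `P(t) M_ω Eᵗ ∈ F`. -/
def returnMat {m : ℕ} {F : Set SL(m + 1, ℝ)} (hF : IsFundDomain F) (α : Fin m → ℝ) (t : ℝ) :
    SL(m + 1, ℤ) :=
  (hF (matOmega α * matE m t)).choose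

/-- A fundamental domain containing `M_ω` together with a sequence of stopping times. -/
structure ContFrac {m : ℕ} (α : Fin m → ℝ) where
  dom : Set SL(m + 1, ℝ)
  isFund : IsFundDomain dom
  base_mem : matOmega α ∈ dom
  time : ℕ → ℝ
  time_zero : time 0 = 0
  time_strictMono : StrictMono time
  time_tendsto : Tendsto time atTop atTop
  ret_ne : ∀ n, returnMat isFund α (time (n + 1)) ≠ returnMat isFund α (time n)

namespace ContFrac

variable {m : ℕ} {α : Fin m → ℝ}

/-- The rational approximates `P_n = P(t_n)`. -/
def P (c : ContFrac α) (n : ℕ) : SL(m + 1, ℤ) := returnMat c.isFund α (c.time n)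

/-- The transfer matrices: `T_0 = I`, `T_n = P_n P_{n-1}⁻¹`. -/
def T (c : ContFrac α) : ℕ → SL(m + 1, ℤ)
  | 0 => 1
  | n + 1 => c.P (n + 1) * (c.P n)⁻¹

/-- The vector `P_n ω`. -/
def Pom (c : ContFrac α) (n : ℕ) : Fin (m + 1) → ℝ :=
  (toSLR (c.P n) : Matrix (Fin (m + 1)) (Fin (m + 1)) ℝ) *ᵥ omegaVec α

/-- `γ_n`, the last component of `e^{(d-1) t_n} P_n ω`. -/
def gam (c : ContFrac α) (n : ℕ) : ℝ := Real.exp (m * c.time n) * c.Pom n (Fin.last m)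

/-- `λ_n = e^{(d-1) t_n} / γ_n`. -/
def lam (c : ContFrac α) (n : ℕ) : ℝ := Real.exp (m * c.time n) / c.gam n

/-- `η_n = λ_n / λ_{n-1}`, indexed by `n + 1`: `eta n` stands for `η_{n+1}`. -/
def eta (c : ContFrac α) (n : ℕ) : ℝ := c.lam (n + 1) / c.lam n

/-- `ω_n = λ_n P_n ω`. -/
def om (c : ContFrac α) (n : ℕ) : Fin (m + 1) → ℝ := c.lam n • c.Pom n

/-- `A_n = sup ‖ᵗT_{n+1}⁻¹ k‖ / ‖k‖` over the non-zero `k` in the resonance cone `I_n⁺`. -/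
def A (c : ContFrac α) (σ : ℕ → ℝ) (n : ℕ) : ℝ :=
  sSup {y | ∃ k ∈ res (c.om n) (σ n), k ≠ 0 ∧
    y = l1 ((((c.T (n + 1))⁻¹ : SL(m + 1, ℤ)) : Matrix (Fin (m + 1)) (Fin (m + 1)) ℤ)ᵀ *ᵥ k)
      / l1 k}

/-- `ε_n`, the radius of the domain of the `n`-th uniformization. -/
def epsN (c : ContFrac α) (σ : ℕ → ℝ) (ν : ℝ) (n : ℕ) : ℝ := eps (c.om n) (σ n) ν

/-- `φ_{n+1}` when the `n`-th strip has width `r = ρ_n`: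
`max {1, 2 (d + 1) ‖L̃_{n+1}‖ ε_n / ε_{n+1}}`. The uniformization lowers the width from `ρ_n` to
`ρ_n - ν`, and `L̃_{n+1}` is the rescaling from `(𝕀⁺_n - 𝔼) 𝒜_{ρ_n - ν}` into
`𝒜'_{(ρ_n - ν) / A_n - δ}`. -/
def phi (c : ContFrac α) (σ : ℕ → ℝ) (δ ν : ℝ) (n : ℕ) (r : ℝ) : ℝ :=
  max 1 (2 * (((m + 1 : ℕ) : ℝ) + 1) *
    opNorm (c.om n) (σ n) (r - ν) ((r - ν) / c.A σ n - δ) (c.eta n) (c.T (n + 1)) *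
    (c.epsN σ ν n / c.epsN σ ν (n + 1)))

/-- `ℬ_n = ∑_{i<n} A_0 ⋯ A_i log (e^{δ + ν / A_i} φ_{i+1})`, where `φ_{i+1}` is taken at the
strip width `ρ_i = (ρ - ℬ_i) / (A_0 ⋯ A_{i-1})`. -/
def Bsum (c : ContFrac α) (σ : ℕ → ℝ) (δ ν ρ : ℝ) : ℕ → ℝ
  | 0 => 0
  | n + 1 => c.Bsum σ δ ν ρ n + (∏ i ∈ Finset.range (n + 1), c.A σ i) *
      Real.log (Real.exp (δ + ν / c.A σ n) *
        c.phi σ δ ν n ((ρ - c.Bsum σ δ ν ρ n) / ∏ i ∈ Finset.range n, c.A σ i))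

/-- The strip widths `ρ_n = (ρ - ℬ_n) / (A_0 ⋯ A_{n-1})`; in particular `ρ_0 = ρ`. -/
def width (c : ContFrac α) (σ : ℕ → ℝ) (δ ν ρ : ℝ) (n : ℕ) : ℝ :=
  (ρ - c.Bsum σ δ ν ρ n) / ∏ i ∈ Finset.range n, c.A σ i

/-- A choice, for every `n`, of a uniformization with respect to `ω_n` and `σ_n`, defined on a
ball of `𝒜'_{ρ_n}` and with values in `𝒜_{ρ_n - ν}`. -/
def IsScheme (c : ContFrac α) (σ : ℕ → ℝ) (δ ν ρ : ℝ)
    (disp elim : ℕ → VF (m + 1) → VF (m + 1)) : Prop :=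
  ∀ n, 0 < c.width σ δ ν ρ n - ν ∧
    IsUniformization (c.om n) (σ n) (c.width σ δ ν ρ n - ν) ν (disp n) (elim n)

/-- `X_n = ℛ_n(X)`, with `ℛ_{n+1} = ℐ_{n+1} ∘ ℒ_{n+1} ∘ 𝒰_n ∘ ℛ_n`. The cut-off `ℐ_{n+1}`
restricts a function to `D_{ρ_{n+1}}`, and so does not change its Fourier coefficients. -/
def renorm (c : ContFrac α) (elim : ℕ → VF (m + 1) → VF (m + 1)) (X : VF (m + 1)) :
    ℕ → VF (m + 1)
  | 0 => X
  | n + 1 => rescale (c.eta n) (c.T (n + 1)) (elim n (c.renorm elim X n))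

/-- `X` is in the domain of `ℛ_n`: at each earlier step `X_k` lies in the domain of `𝒰_k`, the
next strip has positive width, and the next field belongs to the space on that strip. -/
def InDomain (c : ContFrac α) (σ : ℕ → ℝ) (δ ν ρ : ℝ)
    (elim : ℕ → VF (m + 1) → VF (m + 1)) (X : VF (m + 1)) : ℕ → Prop
  | 0 => X ∈ spA' (m + 1) ρ
  | n + 1 => c.InDomain σ δ ν ρ elim X n ∧
      c.renorm elim X n ∈ ball' (c.width σ δ ν ρ n) (c.om n) (c.epsN σ ν n) ∧
      0 < c.width σ δ ν ρ (n + 1) ∧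
      c.renorm elim X (n + 1) ∈ spA' (m + 1) (c.width σ δ ν ρ (n + 1))

/-- `X` is infinitely renormalizable: it is in the domain of `ℛ_n` for all `n`. -/
def InfinitelyRenormalizable (c : ContFrac α) (σ : ℕ → ℝ) (δ ν ρ : ℝ)
    (elim : ℕ → VF (m + 1) → VF (m + 1)) (X : VF (m + 1)) : Prop :=
  ∀ n, c.InDomain σ δ ν ρ elim X n

end ContFrac

end TorusRenorm

end

/-!
The proof has two halves: the uniformizations exist, and one step of the renormalization maps real
fields with rotation vector `ω_n` in the ball `𝒱_n` to such fields in `𝒱_{n+1}`.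

*Existence of uniformizations* (`exists_elimination`). Write `X = v + f`. If `U = id + u` and
`Y = v + 𝕀⁺ h` with `u = ∂_v⁻¹ 𝕀⁻ h`, then `DU · Y = X ∘ U` says exactly that

  `h = f ∘ (id + u) - Du · 𝕀⁺ h`.

On the far from resonance modes the divisor satisfies `|k · v| > s ‖k‖`, so that both `∂_v⁻¹ 𝕀⁻` and
`∂_j ∂_v⁻¹ 𝕀⁻` are bounded Fourier multipliers. No strip width is lost in the unknown `h`; the
loss `ν` is only needed for `f ∘ (id + u)`, where `f` is given. Hence the right-hand side is a
contraction of the ball of radius `2 ‖f‖'` in `𝒜_r` (`norm_elimMap_sub_le`), and the bounds on `u`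
and `Y` can be read off from the equation. For a real field the fixed point is real since it is
unique. The composition `f ∘ (id + u)` is a series of exponentials in the Banach algebra `Wiener` of
weighted absolutely convergent Fourier series.

*The renormalization step* (`renormalization_step`). The uniformization at most doubles the distance
to `ω_n`, the rescaling acts on the remaining non-constant modes with norm at most `‖L̃_{n+1}‖`, and
giving up `log φ_{n+1}` of the strip width divides the norm of the non-constant part by `φ_{n+1}`
(`nA'_cutoff`). By the choice of `φ_{n+1}` the non-constant part ends up below `ε_{n+1} / (d + 1)`.
The constant mode is controlled by the rotation vector: a mean velocity is an average of the field,
so it differs from `𝔼 X` by at most the norm of the non-constant part (`nA'_sub_constVF_le`). The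
factor `η_{n+1}` may be negative, in which case the rescaling reverses time; for this reason the
rotation vector is replaced by the weaker property `HasApproxRot`, which is invariant under time
reversal and under conjugation with `id + u`.

The hypothesis that `ℬ_n` converges to a limit below `ρ` enters only through `lt_width`: each
increment of `ℬ_n` contains the width `ν` consumed by one uniformization, so `ρ_n > ν`.
-/

noncomputable section

namespace TorusRenorm

open scoped NNReal ENNReal

/-! ### Characters, `ℓ¹`-norms and uniqueness of Fourier coefficients -/

section L1

variable {d : ℕ} {K : Type*}

theorem l1_nonneg [SeminormedAddCommGroup K] (x : Fin d → K) : 0 ≤ l1 x :=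
  Finset.sum_nonneg fun _ _ => norm_nonneg _

@[simp] theorem l1_zero [SeminormedAddCommGroup K] : l1 (0 : Fin d → K) = 0 := by simp [l1]

@[simp] theorem l1_neg [SeminormedAddCommGroup K] (x : Fin d → K) : l1 (-x) = l1 x := by simp [l1]

theorem l1_add_le [SeminormedAddCommGroup K] (x y : Fin d → K) : l1 (x + y) ≤ l1 x + l1 y := by
  unfold l1
  rw [← Finset.sum_add_distrib]
  exact Finset.sum_le_sum fun i _ => norm_add_le _ _

theorem norm_apply_le_l1 [SeminormedAddCommGroup K] (x : Fin d → K) (i : Fin d) : ‖x i‖ ≤ l1 x :=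
  Finset.single_le_sum (f := fun i => ‖x i‖) (fun _ _ => norm_nonneg _) (Finset.mem_univ i)

theorem norm_le_l1 [SeminormedAddCommGroup K] (x : Fin d → K) : ‖x‖ ≤ l1 x :=
  (pi_norm_le_iff_of_nonneg (l1_nonneg x)).2 (norm_apply_le_l1 x)

theorem l1_smul [NormedField K] (a : K) (x : Fin d → K) : l1 (a • x) = ‖a‖ * l1 x := by
  simp [l1, Finset.mul_sum]

theorem l1_pos [NormedAddCommGroup K] {x : Fin d → K} (hx : x ≠ 0) : 0 < l1 x := by
  obtain ⟨i, hi⟩ := Function.ne_iff.1 hx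
  exact lt_of_lt_of_le (norm_pos_iff.2 hi) (norm_apply_le_l1 x i)

theorem one_le_l1 {k : Fin d → ℤ} (hk : k ≠ 0) : 1 ≤ l1 k := by
  obtain ⟨i, hi⟩ := Function.ne_iff.1 hk
  refine le_trans ?_ (norm_apply_le_l1 k i)
  rw [Int.norm_eq_abs]
  exact_mod_cast Int.one_le_abs hi

/-- Hölder's inequality between the `ℓ¹`- and the sup-norm. -/
theorem norm_sum_mul_le_l1 (k : Fin d → ℤ) (x : Fin d → ℂ) :
    ‖∑ i, (k i : ℂ) * x i‖ ≤ l1 k * ‖x‖ := by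
  unfold l1
  rw [Finset.sum_mul]
  refine norm_sum_le_of_le _ fun i _ => ?_
  rw [norm_mul, Complex.norm_intCast, Int.norm_eq_abs]
  gcongr
  exact norm_le_pi_norm x i

theorem abs_sum_mul_le_l1 (k : Fin d → ℤ) (x : Fin d → ℝ) :
    |∑ i, (k i : ℝ) * x i| ≤ l1 k * l1 x := by
  refine le_trans (Finset.abs_sum_le_sum_abs _ _) ?_
  conv_rhs => rw [l1, Finset.sum_mul]
  refine Finset.sum_le_sum fun i _ => ?_
  rw [abs_mul, Int.norm_eq_abs]
  gcongr
  exact norm_apply_le_l1 x i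

end L1

variable {d : ℕ}

/-- The character `x ↦ exp (2 π i k · x)` of `ℂᵈ`. -/
def chr (k : Fin d → ℤ) (x : Fin d → ℂ) : ℂ :=
  Complex.exp (2 * Real.pi * Complex.I * ∑ i, (k i : ℂ) * x i)

/-- The inclusion of `ℝᵈ` in `ℂᵈ`. -/
def realPt (x : Fin d → ℝ) : Fin d → ℂ := fun j => (x j : ℂ)

theorem chr_zero_left (x : Fin d → ℂ) : chr 0 x = 1 := by simp [chr]

theorem chr_add_left (k l : Fin d → ℤ) (x : Fin d → ℂ) : chr (k + l) x = chr k x * chr l x := by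
  rw [chr, chr, chr, ← Complex.exp_add]
  simp [add_mul, Finset.sum_add_distrib, mul_add]

theorem chr_add_right (k : Fin d → ℤ) (x y : Fin d → ℂ) : chr k (x + y) = chr k x * chr k y := by
  rw [chr, chr, chr, ← Complex.exp_add]
  simp [mul_add, Finset.sum_add_distrib]

theorem conj_chr (k : Fin d → ℤ) (x : Fin d → ℂ) :
    (starRingEnd ℂ) (chr k x) = chr (-k) (fun i => (starRingEnd ℂ) (x i)) := by
  rw [chr, chr, ← Complex.exp_conj]
  simp [Complex.conj_ofNat]

theorem norm_chr (k : Fin d → ℤ) (x : Fin d → ℂ) :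
    ‖chr k x‖ = Real.exp (-(2 * Real.pi * ∑ i, (k i : ℝ) * (x i).im)) := by
  rw [chr, Complex.norm_exp]
  congr 1
  have : (∑ i, (k i : ℂ) * x i).im = ∑ i, (k i : ℝ) * (x i).im := by simp
  simp [this]

theorem norm_chr_le (k : Fin d → ℤ) (x : Fin d → ℂ) :
    ‖chr k x‖ ≤ Real.exp (2 * Real.pi * l1 (fun i => (x i).im) * l1 k) := by
  rw [norm_chr]
  apply Real.exp_le_exp.2
  have h := (abs_le.1 (abs_sum_mul_le_l1 k fun i => (x i).im)).1
  have := mul_le_mul_of_nonneg_left h Real.two_pi_pos.le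
  linarith

@[simp] theorem norm_chr_realPt (k : Fin d → ℤ) (x : Fin d → ℝ) : ‖chr k (realPt x)‖ = 1 := by
  simp [norm_chr, realPt]

theorem norm_chr_le_of_mem_strip {r : ℝ} {x : Fin d → ℂ} (hx : x ∈ strip d r) (k : Fin d → ℤ) :
    ‖chr k x‖ ≤ Real.exp (r * l1 k) := by
  refine (norm_chr_le k x).trans (Real.exp_le_exp.2 ?_)
  have h : l1 (fun i => (x i).im) < r / (2 * Real.pi) := hx
  rw [lt_div_iff₀ Real.two_pi_pos] at h
  exact mul_le_mul_of_nonneg_right (by linarith) (l1_nonneg k)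

theorem realPt_mem_strip {r : ℝ} (hr : 0 < r) (x : Fin d → ℝ) : realPt x ∈ strip d r := by
  have : l1 (fun i => (realPt x i).im) = 0 := by simp [l1, realPt]
  change l1 (fun i => (realPt x i).im) < _
  rw [this]
  have := Real.pi_pos
  positivity

theorem summable_chr_smul {r : ℝ} {f : VF d} (hf : f ∈ spA d r) {x : Fin d → ℂ}
    (hx : ∀ k, ‖chr k x‖ ≤ Real.exp (r * l1 k)) : Summable fun k => chr k x • f k := by
  refine Summable.of_norm_bounded hf fun k => ?_
  rw [norm_smul, mul_comm]
  exact mul_le_mul (norm_le_l1 _) (hx k) (norm_nonneg _) (l1_nonneg _)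

theorem eval_apply {f : VF d} {x : Fin d → ℂ} (h : Summable fun k => chr k x • f k) (i : Fin d) :
    eval f x i = ∑' k, chr k x * f k i := by
  change (∑' k, chr k x • f k) i = _
  rw [tsum_apply h]
  rfl

theorem spA'_subset_spA (r : ℝ) : spA' d r ⊆ spA d r := by
  intro f hf
  refine Summable.of_nonneg_of_le (fun k => by have := l1_nonneg (f k); positivity) (fun k => ?_) hf
  have h1 := l1_nonneg (f k)
  have h2 := l1_nonneg k
  have h3 := Real.pi_pos
  rw [mul_assoc]
  exact le_mul_of_one_le_left (by positivity) (by nlinarith)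

theorem nA_nonneg (r : ℝ) (f : VF d) : 0 ≤ nA r f :=
  tsum_nonneg fun _ => mul_nonneg (l1_nonneg _) (Real.exp_pos _).le

theorem nA'_nonneg (r : ℝ) (f : VF d) : 0 ≤ nA' r f :=
  tsum_nonneg fun k => by
    have h1 := l1_nonneg (f k)
    have h2 := l1_nonneg k
    have h3 := Real.pi_pos
    positivity

theorem nA_le_nA' {r : ℝ} {f : VF d} (hf : f ∈ spA' d r) : nA r f ≤ nA' r f := by
  refine (spA'_subset_spA r hf).tsum_le_tsum (fun k => ?_) hf
  have h1 := l1_nonneg (f k)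
  have h2 := l1_nonneg k
  have h3 := Real.pi_pos
  rw [mul_assoc]
  exact le_mul_of_one_le_left (by positivity) (by nlinarith)

theorem spA_mono {r s : ℝ} (h : r ≤ s) : spA d s ⊆ spA d r := fun _ hf =>
  Summable.of_nonneg_of_le (fun _ => mul_nonneg (l1_nonneg _) (Real.exp_pos _).le)
    (fun k => mul_le_mul_of_nonneg_left
      (Real.exp_le_exp.2 (mul_le_mul_of_nonneg_right h (l1_nonneg k))) (l1_nonneg _)) hf

theorem nA_mono {r s : ℝ} (h : r ≤ s) {f : VF d} (hf : f ∈ spA d s) : nA r f ≤ nA s f :=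
  (spA_mono h hf).tsum_le_tsum
    (fun k => mul_le_mul_of_nonneg_left
      (Real.exp_le_exp.2 (mul_le_mul_of_nonneg_right h (l1_nonneg k))) (l1_nonneg _)) hf

theorem spA_add {r : ℝ} {f g : VF d} (hf : f ∈ spA d r) (hg : g ∈ spA d r) : f + g ∈ spA d r := by
  refine Summable.of_nonneg_of_le (fun _ => mul_nonneg (l1_nonneg _) (Real.exp_pos _).le)
    (fun k => ?_) (hf.add hg)
  rw [← add_mul]
  exact mul_le_mul_of_nonneg_right (l1_add_le _ _) (Real.exp_pos _).le

theorem spA'_add {r : ℝ} {f g : VF d} (hf : f ∈ spA' d r) (hg : g ∈ spA' d r) :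
    f + g ∈ spA' d r := by
  refine Summable.of_nonneg_of_le (fun k => ?_) (fun k => ?_) (hf.add hg)
  · have h1 := l1_nonneg ((f + g) k)
    have h2 := l1_nonneg k
    have h3 := Real.pi_pos
    positivity
  · have h2 := l1_nonneg k
    have h3 := Real.pi_pos
    rw [← add_mul, ← mul_add]
    gcongr
    exact l1_add_le _ _

theorem spA_neg {r : ℝ} {f : VF d} (hf : f ∈ spA d r) : -f ∈ spA d r := by
  simpa [spA] using hf

theorem spA'_neg {r : ℝ} {f : VF d} (hf : f ∈ spA' d r) : -f ∈ spA' d r := by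
  simpa [spA'] using hf

theorem summable_of_eq_zero_of_ne {M : Type*} [AddCommMonoid M] [TopologicalSpace M]
    {ι : Type*} {f : ι → M} (a : ι) (h : ∀ k, k ≠ a → f k = 0) : Summable f :=
  summable_of_ne_finset_zero (s := {a}) fun k hk => h k (by simpa using hk)

theorem constVF_mem_spA' (r : ℝ) (v : Fin d → ℝ) : constVF v ∈ spA' d r :=
  summable_of_eq_zero_of_ne 0 fun k hk => by simp [constVF, Pi.single_eq_of_ne hk]

theorem constVF_mem_spA (r : ℝ) (v : Fin d → ℝ) : constVF v ∈ spA d r :=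
  spA'_subset_spA r (constVF_mem_spA' r v)

section Uniqueness

-- The Fourier basis of the torus is orthonormal for the normalised Haar measure.
local instance : MeasureTheory.MeasureSpace UnitAddCircle := ⟨AddCircle.haarAddCircle⟩

local instance :
    MeasureTheory.IsProbabilityMeasure
      (MeasureTheory.volume : MeasureTheory.Measure UnitAddCircle) :=
  inferInstanceAs (MeasureTheory.IsProbabilityMeasure AddCircle.haarAddCircle)

/-- The Fourier coefficients of an absolutely convergent series are determined by its values at
real points. -/
theorem coeff_eq_zero_of_tsum_chr_eq_zero {a : (Fin d → ℤ) → ℂ} (ha : Summable fun k => ‖a k‖)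
    (h : ∀ x : Fin d → ℝ, ∑' k, chr k (realPt x) * a k = 0) : a = 0 := by
  have hs : Summable fun k => a k • UnitAddTorus.mFourier k := by
    refine Summable.of_norm_bounded ha fun k => ?_
    rw [norm_smul, UnitAddTorus.mFourier_norm, mul_one]
  have h0 : ∑' k, a k • UnitAddTorus.mFourier k = 0 := by
    ext y
    obtain ⟨x, rfl⟩ : ∃ x : Fin d → ℝ, y = fun i => (x i : UnitAddCircle) := by
      choose x hx using fun i => QuotientAddGroup.mk_surjective (y i)
      exact ⟨x, funext fun i => (hx i).symm⟩
    rw [← ContinuousMap.tsum_apply hs]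
    refine Eq.trans (tsum_congr fun k => ?_) (h x)
    simp only [ContinuousMap.smul_apply, smul_eq_mul, UnitAddTorus.mFourier, ContinuousMap.coe_mk,
      fourier_coe_apply, chr, realPt]
    rw [← Complex.exp_sum, mul_comm, Finset.mul_sum]
    congr 3
    ext i
    push_cast
    ring
  have h1 := congrArg (ContinuousMap.toLp (E := ℂ) 2 MeasureTheory.volume ℂ) h0
  rw [ContinuousLinearMap.map_tsum _ hs, map_zero] at h1
  funext n
  have h2 := congrArg (innerSL ℂ (UnitAddTorus.mFourierLp (d := Fin d) 2 n)) h1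
  rw [ContinuousLinearMap.map_tsum _ ((ContinuousMap.toLp (E := ℂ) 2 _ ℂ).summable hs), map_zero,
    tsum_eq_single n] at h2
  · have h3 := orthonormal_iff_ite.1 (UnitAddTorus.orthonormal_mFourier (d := Fin d)) n n
    simp only [map_smul, innerSL_apply_apply, smul_eq_mul] at h2
    rw [UnitAddTorus.mFourierLp] at h3 h2
    rw [h3] at h2
    simpa using h2
  · intro k hk
    have h3 := orthonormal_iff_ite.1 (UnitAddTorus.orthonormal_mFourier (d := Fin d)) n k
    rw [if_neg hk.symm] at h3
    simp only [map_smul, innerSL_apply_apply, smul_eq_mul]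
    rw [UnitAddTorus.mFourierLp] at h3 ⊢
    rw [UnitAddTorus.mFourierLp] at h3
    rw [h3, mul_zero]

end Uniqueness

/-! ### The weighted Wiener algebra -/

/-- The sequences `a : ℤᵈ → ℂ` with `∑ |a_k| e^{r‖k‖} < ∞`. -/
def wienerSubmodule (d : ℕ) (r : ℝ≥0) : Submodule ℂ ((Fin d → ℤ) → ℂ) where
  carrier := {a | Summable fun k => ‖a k‖ * Real.exp (r * l1 k)}
  zero_mem' := by simp [summable_zero]
  add_mem' := fun {a b} ha hb => by
    refine Summable.of_nonneg_of_le (fun k => by positivity) (fun k => ?_) (Summable.add ha hb)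
    rw [← add_mul]
    exact mul_le_mul_of_nonneg_right (norm_add_le _ _) (Real.exp_pos _).le
  smul_mem' := fun c a ha => by
    refine (Summable.mul_left ‖c‖ ha).congr fun k => ?_
    simp [mul_assoc]

/-- The weighted Wiener algebra: the scalar Fourier series with `∑ |a_k| e^{r‖k‖} < ∞`. Its elements
are families of coefficients, and its product is the convolution. -/
def Wiener (d : ℕ) (r : ℝ≥0) : Type := wienerSubmodule d r

namespace Wiener

variable {d : ℕ} {r : ℝ≥0}

instance : AddCommGroup (Wiener d r) := inferInstanceAs (AddCommGroup (wienerSubmodule d r))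

instance : Module ℂ (Wiener d r) := inferInstanceAs (Module ℂ (wienerSubmodule d r))

/-- The `k`-th Fourier coefficient. -/
def coeff (a : Wiener d r) (k : Fin d → ℤ) : ℂ := a.1 k

/-- The element with prescribed coefficients. -/
def mk (a : (Fin d → ℤ) → ℂ) (h : Summable fun k => ‖a k‖ * Real.exp (r * l1 k)) : Wiener d r :=
  ⟨a, h⟩

@[simp] theorem coeff_mk (a : (Fin d → ℤ) → ℂ) (h) (k : Fin d → ℤ) :
    coeff (mk (r := r) a h) k = a k := rfl

@[ext] theorem ext {a b : Wiener d r} (h : ∀ k, a.coeff k = b.coeff k) : a = b :=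
  Subtype.ext (funext h)

@[simp] theorem coeff_zero (k : Fin d → ℤ) : (0 : Wiener d r).coeff k = 0 := rfl
@[simp] theorem coeff_add (a b : Wiener d r) (k : Fin d → ℤ) :
    (a + b).coeff k = a.coeff k + b.coeff k := rfl
@[simp] theorem coeff_neg (a : Wiener d r) (k : Fin d → ℤ) : (-a).coeff k = -a.coeff k := rfl
@[simp] theorem coeff_smul (c : ℂ) (a : Wiener d r) (k : Fin d → ℤ) :
    (c • a).coeff k = c * a.coeff k := rfl

theorem summable (a : Wiener d r) : Summable fun k => ‖a.coeff k‖ * Real.exp (r * l1 k) := a.2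

/-- Multiplication of the coefficients by the weights, into the unweighted space `ℓ¹`. -/
def toL1 : Wiener d r →ₗ[ℂ] lp (fun _ : Fin d → ℤ => ℂ) 1 where
  toFun a := ⟨fun k => a.coeff k * Real.exp (r * l1 k), by
    refine memℓp_gen ?_
    simpa [-Complex.ofReal_exp] using a.summable⟩
  map_add' a b := by ext k; exact add_mul _ _ _
  map_smul' c a := by ext k; exact mul_assoc _ _ _

theorem toL1_apply (a : Wiener d r) (k : Fin d → ℤ) :
    toL1 a k = a.coeff k * Real.exp (r * l1 k) := rfl

theorem toL1_injective : Function.Injective (toL1 (d := d) (r := r)) := by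
  intro a b h
  ext k
  have h1 : toL1 a k = toL1 b k := by rw [h]
  simpa [toL1_apply, (Real.exp_pos _).ne'] using h1

theorem toL1_surjective : Function.Surjective (toL1 (d := d) (r := r)) := by
  intro c
  have hc := (memℓp_gen_iff (by simp)).1 (lp.memℓp c)
  refine ⟨mk (fun k => c k * Real.exp (-(r * l1 k))) ?_, ?_⟩
  · refine hc.congr fun k => ?_
    simp only [ENNReal.toReal_one, Real.rpow_one, norm_mul, Complex.norm_real, Real.norm_eq_abs,
      Real.abs_exp]
    rw [mul_assoc, ← Real.exp_add]
    simp
  · ext k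
    rw [toL1_apply, coeff_mk, mul_assoc, ← Complex.ofReal_mul, ← Real.exp_add]
    simp

instance : NormedAddCommGroup (Wiener d r) :=
  NormedAddCommGroup.induced (Wiener d r) (lp (fun _ : Fin d → ℤ => ℂ) 1) toL1 toL1_injective

instance : NormedSpace ℂ (Wiener d r) :=
  NormedSpace.induced ℂ (Wiener d r) (lp (fun _ : Fin d → ℤ => ℂ) 1) toL1

theorem norm_def (a : Wiener d r) : ‖a‖ = ∑' k, ‖a.coeff k‖ * Real.exp (r * l1 k) := by
  change ‖toL1 a‖ = _
  rw [lp.norm_eq_tsum_rpow (by simp)]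
  simp [toL1_apply, -Complex.ofReal_exp]

instance : CompleteSpace (Wiener d r) := by
  have hi : Isometry (toL1 (d := d) (r := r)) :=
    AddMonoidHomClass.isometry_of_norm toL1 fun _ => rfl
  exact ((IsometryEquiv.mk' toL1 (Function.surjInv toL1_surjective)
    (Function.surjInv_eq toL1_surjective) hi).completeSpace)

theorem norm_coeff_mul_le (a : Wiener d r) (k : Fin d → ℤ) :
    ‖a.coeff k‖ * Real.exp (r * l1 k) ≤ ‖a‖ := by
  rw [norm_def]
  exact a.summable.le_tsum k fun _ _ => by positivity

/-- The `k`-th coefficient as a continuous linear functional. -/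
def coeffL (k : Fin d → ℤ) : Wiener d r →L[ℂ] ℂ :=
  LinearMap.mkContinuous
    { toFun := fun a => a.coeff k
      map_add' := fun _ _ => rfl
      map_smul' := fun _ _ => rfl } 1 fun a => by
      refine le_trans ?_ ((norm_coeff_mul_le a k).trans (one_mul _).ge)
      refine le_mul_of_one_le_right (norm_nonneg _) (Real.one_le_exp ?_)
      have := l1_nonneg k
      positivity

@[simp] theorem coeffL_apply (k : Fin d → ℤ) (a : Wiener d r) : coeffL k a = a.coeff k := rfl

/-! ### Evaluation -/

/-- The points at which all series of the algebra converge. -/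
def Adm (r : ℝ≥0) (x : Fin d → ℂ) : Prop := ∀ k, ‖chr k x‖ ≤ Real.exp (r * l1 k)

theorem adm_realPt (x : Fin d → ℝ) : Adm r (realPt x) := fun k => by
  rw [norm_chr_realPt]
  have := l1_nonneg k
  exact Real.one_le_exp (by positivity)

theorem summable_norm_chr_mul (a : Wiener d r) {x : Fin d → ℂ} (hx : Adm r x) :
    Summable fun k => ‖chr k x * a.coeff k‖ :=
  Summable.of_nonneg_of_le (fun _ => norm_nonneg _) (fun k => by
    rw [norm_mul, mul_comm]
    exact mul_le_mul_of_nonneg_left (hx k) (norm_nonneg _)) a.summable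

/-- The value of the Fourier series at `x`. -/
def ev (x : Fin d → ℂ) (a : Wiener d r) : ℂ := ∑' k, chr k x * a.coeff k

theorem norm_ev_le {x : Fin d → ℂ} (hx : Adm r x) (a : Wiener d r) : ‖ev x a‖ ≤ ‖a‖ := by
  rw [norm_def]
  refine tsum_of_norm_bounded a.summable.hasSum fun k => ?_
  rw [norm_mul, mul_comm]
  exact mul_le_mul_of_nonneg_left (hx k) (norm_nonneg _)

theorem ev_add {x : Fin d → ℂ} (hx : Adm r x) (a b : Wiener d r) :
    ev x (a + b) = ev x a + ev x b := by
  rw [ev, ev, ev, ← ((summable_norm_chr_mul a hx).of_norm).tsum_add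
    ((summable_norm_chr_mul b hx).of_norm)]
  simp [mul_add]

theorem ev_smul (x : Fin d → ℂ) (c : ℂ) (a : Wiener d r) : ev x (c • a) = c * ev x a := by
  rw [ev, ev, ← tsum_mul_left]
  exact tsum_congr fun k => by rw [coeff_smul]; ring

theorem ev_injective {a b : Wiener d r} (h : ∀ x : Fin d → ℝ, ev (realPt x) a = ev (realPt x) b) :
    a = b := by
  have hs : Summable fun k => ‖(a - b).coeff k‖ :=
    ((summable_norm_chr_mul (a - b) (adm_realPt 0))).congr fun k => by simp
  have := coeff_eq_zero_of_tsum_chr_eq_zero hs fun x => by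
    change ev (realPt x) (a - b) = 0
    have h1 := ev_add (adm_realPt x) (a - b) b
    rw [sub_add_cancel, h x] at h1
    exact left_eq_add.1 (by rw [add_comm]; exact h1)
  ext k
  exact sub_eq_zero.1 (congrFun this k)

/-! ### Convolution -/

theorem summable_prod (a b : Wiener d r) : Summable fun p : (Fin d → ℤ) × (Fin d → ℤ) =>
    (‖a.coeff p.1‖ * Real.exp (r * l1 p.1)) * (‖b.coeff p.2‖ * Real.exp (r * l1 p.2)) :=
  a.summable.mul_of_nonneg b.summable (fun _ => by positivity) (fun _ => by positivity)

/-- The change of variables `(k, j) ↦ (j, k - j)`. -/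
def convEquiv (d : ℕ) :
    ((Fin d → ℤ) × (Fin d → ℤ)) ≃ ((Fin d → ℤ) × (Fin d → ℤ)) where
  toFun p := (p.2, p.1 - p.2)
  invFun p := (p.1 + p.2, p.1)
  left_inv p := by simp
  right_inv p := by simp

theorem summable_conv (a b : Wiener d r) : Summable fun p : (Fin d → ℤ) × (Fin d → ℤ) =>
    (‖a.coeff p.2‖ * Real.exp (r * l1 p.2)) *
      (‖b.coeff (p.1 - p.2)‖ * Real.exp (r * l1 (p.1 - p.2))) :=
  (convEquiv d).summable_iff.2 (summable_prod a b)

theorem tsum_conv (a b : Wiener d r) : ∑' p : (Fin d → ℤ) × (Fin d → ℤ),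
    (‖a.coeff p.2‖ * Real.exp (r * l1 p.2)) *
      (‖b.coeff (p.1 - p.2)‖ * Real.exp (r * l1 (p.1 - p.2))) = ‖a‖ * ‖b‖ := by
  rw [norm_def, norm_def, a.summable.tsum_mul_tsum b.summable (summable_prod a b)]
  exact (convEquiv d).tsum_eq (fun p : (Fin d → ℤ) × (Fin d → ℤ) =>
    (‖a.coeff p.1‖ * Real.exp (r * l1 p.1)) * (‖b.coeff p.2‖ * Real.exp (r * l1 p.2)))

theorem weight_le (k j : Fin d → ℤ) :
    Real.exp (r * l1 k) ≤ Real.exp (r * l1 j) * Real.exp (r * l1 (k - j)) := by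
  rw [← Real.exp_add, ← mul_add]
  have := l1_add_le j (k - j)
  rw [add_sub_cancel] at this
  gcongr

theorem conv_le (a b : Wiener d r) (k j : Fin d → ℤ) :
    ‖a.coeff j * b.coeff (k - j)‖ * Real.exp (r * l1 k) ≤
    (‖a.coeff j‖ * Real.exp (r * l1 j)) * (‖b.coeff (k - j)‖ * Real.exp (r * l1 (k - j))) := by
  rw [norm_mul]
  calc _ ≤ ‖a.coeff j‖ * ‖b.coeff (k - j)‖ *
        (Real.exp (r * l1 j) * Real.exp (r * l1 (k - j))) := by
        gcongr
        exact weight_le k j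
    _ = _ := by ring

theorem summable_conv_fiber (a b : Wiener d r) (k : Fin d → ℤ) :
    Summable fun j => ‖a.coeff j * b.coeff (k - j)‖ := by
  have h := Summable.of_nonneg_of_le (fun j => by positivity) (conv_le a b k)
    ((summable_conv a b).prod_factor k)
  exact (summable_mul_right_iff (Real.exp_pos _).ne').1 h

theorem norm_tsum_conv_le (a b : Wiener d r) (k : Fin d → ℤ) :
    ‖∑' j, a.coeff j * b.coeff (k - j)‖ * Real.exp (r * l1 k) ≤
    ∑' j, (‖a.coeff j‖ * Real.exp (r * l1 j)) *
      (‖b.coeff (k - j)‖ * Real.exp (r * l1 (k - j))) := by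
  have hs := summable_conv_fiber a b k
  refine (mul_le_mul_of_nonneg_right (norm_tsum_le_tsum_norm hs) (Real.exp_pos _).le).trans ?_
  rw [← tsum_mul_right]
  exact (hs.mul_right _).tsum_le_tsum (conv_le a b k) ((summable_conv a b).prod_factor k)

instance : Mul (Wiener d r) where
  mul a b := mk (fun k => ∑' j, a.coeff j * b.coeff (k - j))
    (Summable.of_nonneg_of_le (fun _ => by positivity) (norm_tsum_conv_le a b)
      (summable_conv a b).prod)

theorem coeff_mul (a b : Wiener d r) (k : Fin d → ℤ) :
    (a * b).coeff k = ∑' j, a.coeff j * b.coeff (k - j) := rfl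

theorem norm_mul_le' (a b : Wiener d r) : ‖a * b‖ ≤ ‖a‖ * ‖b‖ := by
  rw [← tsum_conv, (summable_conv a b).tsum_prod, norm_def]
  exact (a * b).summable.tsum_le_tsum (norm_tsum_conv_le a b) (summable_conv a b).prod

theorem ev_mul {x : Fin d → ℂ} (hx : Adm r x) (a b : Wiener d r) :
    ev x (a * b) = ev x a * ev x b := by
  have ha := summable_norm_chr_mul a hx
  have hb := summable_norm_chr_mul b hx
  let F : (Fin d → ℤ) × (Fin d → ℤ) → ℂ := fun p =>
    (chr p.1 x * a.coeff p.1) * (chr p.2 x * b.coeff p.2)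
  have hp : Summable F := summable_mul_of_summable_norm (f := fun k => chr k x * a.coeff k)
    (g := fun k => chr k x * b.coeff k) ha hb
  have hq : Summable fun p : (Fin d → ℤ) × (Fin d → ℤ) => F (p.2, p.1 - p.2) :=
    (convEquiv d).summable_iff.2 hp
  have h1 : ev x a * ev x b = ∑' p, F p := tsum_mul_tsum_of_summable_norm
    (f := fun k => chr k x * a.coeff k) (g := fun k => chr k x * b.coeff k) ha hb
  have h2 : ∑' p : (Fin d → ℤ) × (Fin d → ℤ), F (p.2, p.1 - p.2) = ∑' p, F p :=
    (convEquiv d).tsum_eq F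
  rw [h1, ← h2, hq.tsum_prod]
  refine tsum_congr fun k => ?_
  rw [coeff_mul, ← tsum_mul_left]
  refine tsum_congr fun j => ?_
  have h3 : chr k x = chr j x * chr (k - j) x := by rw [← chr_add_left, add_sub_cancel]
  rw [h3]
  exact mul_mul_mul_comm _ _ _ _

/-- The monomial `exp (2 π i k · x)`. -/
def mon (k : Fin d → ℤ) : Wiener d r := mk (Pi.single k 1) <|
  summable_of_eq_zero_of_ne k fun j hj => by simp [Pi.single_eq_of_ne hj]

theorem ev_mon (x : Fin d → ℂ) (k : Fin d → ℤ) : ev x (mon (r := r) k) = chr k x := by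
  rw [ev, tsum_eq_single k fun j hj => by simp [mon, Pi.single_eq_of_ne hj]]
  simp [mon]

theorem norm_mon (k : Fin d → ℤ) : ‖mon (r := r) k‖ = Real.exp (r * l1 k) := by
  rw [norm_def, tsum_eq_single k fun j hj => by simp [mon, Pi.single_eq_of_ne hj]]
  simp [mon]

instance : One (Wiener d r) := ⟨mon 0⟩

theorem ev_one (x : Fin d → ℂ) : ev x (1 : Wiener d r) = 1 := by
  change ev x (mon 0) = 1
  rw [ev_mon, chr_zero_left]

theorem ev_zero (x : Fin d → ℂ) : ev x (0 : Wiener d r) = 0 := by simp [ev]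

instance : CommRing (Wiener d r) :=
  { (inferInstance : AddCommGroup (Wiener d r)) with
    mul_assoc := fun a b c => ev_injective fun x => by simp only [ev_mul (adm_realPt x), mul_assoc]
    one_mul := fun a => ev_injective fun x => by rw [ev_mul (adm_realPt x), ev_one, one_mul]
    mul_one := fun a => ev_injective fun x => by rw [ev_mul (adm_realPt x), ev_one, mul_one]
    zero_mul := fun a => ev_injective fun x => by rw [ev_mul (adm_realPt x), ev_zero, zero_mul]
    mul_zero := fun a => ev_injective fun x => by rw [ev_mul (adm_realPt x), ev_zero, mul_zero]
    left_distrib := fun a b c => ev_injective fun x => by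
      simp only [ev_mul (adm_realPt x), ev_add (adm_realPt x), mul_add]
    right_distrib := fun a b c => ev_injective fun x => by
      simp only [ev_mul (adm_realPt x), ev_add (adm_realPt x), add_mul]
    mul_comm := fun a b => ev_injective fun x => by simp only [ev_mul (adm_realPt x), mul_comm] }

instance : NormedCommRing (Wiener d r) :=
  { (inferInstance : NormedAddCommGroup (Wiener d r)), (inferInstance : CommRing (Wiener d r)) with
    norm_mul_le := norm_mul_le' }

instance : Algebra ℂ (Wiener d r) :=
  Algebra.ofModule
    (fun c a b => ev_injective fun x => by
      simp only [ev_mul (adm_realPt x), ev_smul, mul_assoc])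
    (fun c a b => ev_injective fun x => by
      simp only [ev_mul (adm_realPt x), ev_smul, mul_left_comm])

instance : NormedAlgebra ℂ (Wiener d r) where
  norm_smul_le c a := norm_smul_le c a

instance : NormOneClass (Wiener d r) where
  norm_one := by
    change ‖mon 0‖ = 1
    simp [norm_mon]

/-- Evaluation at an admissible point, as a ring homomorphism. -/
def evHom {x : Fin d → ℂ} (hx : Adm r x) : Wiener d r →+* ℂ where
  toFun := ev x
  map_one' := ev_one x
  map_mul' := ev_mul hx
  map_zero' := ev_zero x
  map_add' := ev_add hx

/-- Evaluation at an admissible point, as a continuous linear functional. -/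
def evL {x : Fin d → ℂ} (hx : Adm r x) : Wiener d r →L[ℂ] ℂ :=
  LinearMap.mkContinuous { toFun := ev x, map_add' := ev_add hx, map_smul' := ev_smul x } 1
    fun a => by rw [one_mul]; exact norm_ev_le hx a

@[simp] theorem evL_apply {x : Fin d → ℂ} (hx : Adm r x) (a : Wiener d r) : evL hx a = ev x a := rfl

theorem ev_exp {x : Fin d → ℂ} (hx : Adm r x) (a : Wiener d r) :
    ev x (NormedSpace.exp a) = Complex.exp (ev x a) := by
  let _ : NormedAlgebra ℚ (Wiener d r) := NormedAlgebra.restrictScalars ℚ ℂ (Wiener d r)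
  rw [Complex.exp_eq_exp_ℂ]
  exact NormedSpace.map_exp (evHom hx) (evL hx).continuous a

/-! ### The exponential -/

theorem summable_exp (a : Wiener d r) : Summable fun n : ℕ => ‖a‖ ^ n / n.factorial :=
  Real.summable_pow_div_factorial ‖a‖

theorem norm_exp_term_le (a : Wiener d r) (n : ℕ) :
    ‖((n.factorial : ℂ)⁻¹) • a ^ n‖ ≤ ‖a‖ ^ n / n.factorial := by
  rw [norm_smul, norm_inv, Complex.norm_natCast, inv_mul_eq_div]
  gcongr
  exact norm_pow_le a n

theorem norm_exp_sub_one_le (a : Wiener d r) :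
    ‖NormedSpace.exp a - 1‖ ≤ ‖a‖ * Real.exp ‖a‖ := by
  have hs : Summable fun n : ℕ => ((n.factorial : ℂ)⁻¹) • a ^ n :=
    Summable.of_norm_bounded (summable_exp a) (norm_exp_term_le a)
  have h1 : NormedSpace.exp a - 1 = ∑' n : ℕ, (((n + 1).factorial : ℂ)⁻¹) • a ^ (n + 1) := by
    rw [NormedSpace.exp_eq_tsum ℂ]
    change (∑' n : ℕ, ((n.factorial : ℂ)⁻¹) • a ^ n) - 1 = _
    rw [hs.tsum_eq_zero_add]
    simp
  have h2 : HasSum (fun n : ℕ => ‖a‖ * (‖a‖ ^ n / n.factorial)) (‖a‖ * Real.exp ‖a‖) := by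
    rw [Real.exp_eq_exp_ℝ]
    exact (NormedSpace.expSeries_div_hasSum_exp ‖a‖).mul_left _
  rw [h1]
  refine tsum_of_norm_bounded h2 fun n => (norm_exp_term_le a (n + 1)).trans ?_
  rw [pow_succ', mul_div_assoc]
  gcongr
  exact n.le_succ

theorem norm_exp_le (a : Wiener d r) : ‖NormedSpace.exp a‖ ≤ Real.exp ‖a‖ := by
  rw [NormedSpace.exp_eq_tsum ℂ]
  refine tsum_of_norm_bounded ?_ (norm_exp_term_le a)
  rw [Real.exp_eq_exp_ℝ]
  exact NormedSpace.expSeries_div_hasSum_exp ‖a‖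

theorem norm_exp_sub_exp_le (a b : Wiener d r) :
    ‖NormedSpace.exp a - NormedSpace.exp b‖ ≤ ‖a - b‖ * Real.exp (‖b‖ + ‖a - b‖) := by
  have h : NormedSpace.exp a = NormedSpace.exp b * NormedSpace.exp (a - b) := by
    let _ : NormedAlgebra ℚ (Wiener d r) := NormedAlgebra.restrictScalars ℚ ℂ (Wiener d r)
    rw [← NormedSpace.exp_add, add_sub_cancel]
  have h2 : NormedSpace.exp a - NormedSpace.exp b =
      NormedSpace.exp b * (NormedSpace.exp (a - b) - 1) := by rw [h]; ring
  rw [h2]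
  calc _ ≤ ‖NormedSpace.exp b‖ * ‖NormedSpace.exp (a - b) - 1‖ := norm_mul_le _ _
    _ ≤ Real.exp ‖b‖ * (‖a - b‖ * Real.exp ‖a - b‖) := by
        gcongr
        · exact norm_exp_le b
        · exact norm_exp_sub_one_le _
    _ = _ := by rw [Real.exp_add]; ring

end Wiener

/-! ### Derivatives of vector fields and real changes of variables -/

section Jacobian

variable {d : ℕ}

/-- The functional `h ↦ 2 π i k · h`. -/
def dpair (k : Fin d → ℤ) : (Fin d → ℂ) →L[ℂ] ℂ :=
  (2 * Real.pi * Complex.I : ℂ) • ∑ i, (k i : ℂ) • ContinuousLinearMap.proj i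

theorem dpair_apply (k : Fin d → ℤ) (h : Fin d → ℂ) :
    dpair k h = 2 * Real.pi * Complex.I * ∑ i, (k i : ℂ) * h i := by
  simp [dpair]

theorem norm_dpair_le (k : Fin d → ℤ) : ‖dpair k‖ ≤ 2 * Real.pi * l1 k := by
  refine ContinuousLinearMap.opNorm_le_bound _ (mul_nonneg Real.two_pi_pos.le (l1_nonneg k))
    fun h => ?_
  rw [dpair_apply, norm_mul]
  have : ‖(2 * Real.pi * Complex.I : ℂ)‖ = 2 * Real.pi := by
    simp [abs_of_pos Real.pi_pos]
  rw [this, mul_assoc (2 * Real.pi) (l1 k)]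
  exact mul_le_mul_of_nonneg_left (norm_sum_mul_le_l1 k h) Real.two_pi_pos.le

/-- The derivative of the mode `exp (2 π i k · x) u_k`. -/
def jacTerm (u : VF d) (x : Fin d → ℂ) (k : Fin d → ℤ) : (Fin d → ℂ) →L[ℂ] (Fin d → ℂ) :=
  chr k x • (dpair k).smulRight (u k)

/-- The derivative of `eval u` at `x`, obtained by differentiation term by term. -/
def jac (u : VF d) (x : Fin d → ℂ) : (Fin d → ℂ) →L[ℂ] (Fin d → ℂ) := ∑' k, jacTerm u x k

theorem norm_jacTerm_le {r : ℝ} (u : VF d) {x : Fin d → ℂ} (hx : x ∈ strip d r) (k : Fin d → ℤ) :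
    ‖jacTerm u x k‖ ≤ (1 + 2 * Real.pi * l1 k) * l1 (u k) * Real.exp (r * l1 k) := by
  rw [jacTerm, norm_smul, ContinuousLinearMap.norm_smulRight_apply, mul_comm]
  have h1 := l1_nonneg k
  have h2 := Real.pi_pos
  have h3 := l1_nonneg (u k)
  gcongr
  · exact (norm_dpair_le k).trans (by linarith)
  · exact norm_le_l1 _
  · exact norm_chr_le_of_mem_strip hx k

theorem summable_jacTerm {r : ℝ} {u : VF d} (hu : u ∈ spA' d r) {x : Fin d → ℂ}
    (hx : x ∈ strip d r) : Summable (jacTerm u x) :=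
  Summable.of_norm_bounded hu (norm_jacTerm_le u hx)

theorem norm_jac_le {r : ℝ} {u : VF d} (hu : u ∈ spA' d r) {x : Fin d → ℂ}
    (hx : x ∈ strip d r) : ‖jac u x‖ ≤ nA' r u :=
  tsum_of_norm_bounded (Summable.hasSum hu) (norm_jacTerm_le u hx)

theorem jac_apply {r : ℝ} {u : VF d} (hu : u ∈ spA' d r) {x : Fin d → ℂ}
    (hx : x ∈ strip d r) (h : Fin d → ℂ) (i : Fin d) :
    jac u x h i = ∑' k, chr k x * (dpair k h * u k i) := by
  have hs := summable_jacTerm hu hx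
  let L : ((Fin d → ℂ) →L[ℂ] (Fin d → ℂ)) →L[ℂ] ℂ :=
    (ContinuousLinearMap.proj (R := ℂ) (φ := fun _ : Fin d => ℂ) i).comp
      (ContinuousLinearMap.apply ℂ (Fin d → ℂ) h)
  exact L.map_tsum hs

theorem isOpen_strip (r : ℝ) : IsOpen (strip d r) := by
  refine isOpen_lt ?_ continuous_const
  unfold l1
  fun_prop

theorem isPreconnected_strip (r : ℝ) : IsPreconnected (strip d r) := by
  apply Convex.isPreconnected
  intro x hx y hy a b ha hb hab
  change l1 _ < _
  have h1 : l1 (fun i => (x i).im) < r / (2 * Real.pi) := hx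
  have h2 : l1 (fun i => (y i).im) < r / (2 * Real.pi) := hy
  have h3 : (fun i => ((a • x + b • y) i).im) =
      a • (fun i => (x i).im) + b • fun i => (y i).im := by
    ext i; simp
  rw [h3]
  refine (l1_add_le _ _).trans_lt ?_
  rw [l1_smul, l1_smul, Real.norm_of_nonneg ha, Real.norm_of_nonneg hb]
  exact (convex_Iio (r / (2 * Real.pi))) h1 h2 ha hb hab

theorem hasFDerivAt_eval {r : ℝ} {u : VF d} (hu : u ∈ spA' d r) {x : Fin d → ℂ}
    (hx : x ∈ strip d r) : HasFDerivAt (eval u) (jac u x) x := by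
  refine hasFDerivAt_tsum_of_isPreconnected (𝕜 := ℂ) (f := fun k y => chr k y • u k)
    (f' := fun k y => jacTerm u y k) (u := fun k =>
      (1 + 2 * Real.pi * l1 k) * l1 (u k) * Real.exp (r * l1 k)) hu (isOpen_strip r)
    (isPreconnected_strip r) (fun k y _ => ?_) (fun k y hy => norm_jacTerm_le u hy k) hx
    (summable_chr_smul (spA'_subset_spA r hu) (norm_chr_le_of_mem_strip hx)) hx
  have h1 : HasFDerivAt (fun y => chr k y) (chr k y • dpair k) y := by
    have := (dpair k).hasFDerivAt (x := y)
    have h2 := this.cexp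
    have h3 : (fun y => Complex.exp (dpair k y)) = fun y => chr k y := by
      funext y; rw [dpair_apply]; rfl
    rw [h3] at h2
    have h4 : Complex.exp (dpair k y) = chr k y := congrFun h3 y
    rwa [h4] at h2
  have h5 := h1.smul_const (u k)
  convert h5 using 1
  ext h i
  simp [jacTerm, mul_assoc]

theorem fderiv_add_eval {r : ℝ} {u : VF d} (hu : u ∈ spA' d r) {x : Fin d → ℂ}
    (hx : x ∈ strip d r) : fderiv ℂ (fun y : Fin d → ℂ => y + eval u y) x =
      ContinuousLinearMap.id ℂ (Fin d → ℂ) + jac u x :=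
  ((hasFDerivAt_id x).add (hasFDerivAt_eval hu hx)).fderiv

/-- A perturbation of the identity of norm less than one is invertible (Neumann series). -/
theorem isInvertible_id_add {𝕜 E : Type*} [NontriviallyNormedField 𝕜] [NormedAddCommGroup E]
    [NormedSpace 𝕜 E] [CompleteSpace E] {L : E →L[𝕜] E} (hL : ‖L‖ < 1) :
    (ContinuousLinearMap.id 𝕜 E + L).IsInvertible := by
  refine ⟨ContinuousLinearEquiv.unitsEquiv 𝕜 E (Units.oneSub (-L) (by rwa [norm_neg])), ?_⟩
  ext x
  simp

/-- The pullback equation, without inverse. -/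
theorem isPullback_iff {r : ℝ} {u X Y : VF d} (hu : u ∈ spA' d r) (h1 : nA' r u < 1) :
    IsPullback r u X Y ↔ ∀ x ∈ strip d r, eval Y x + jac u x (eval Y x) =
      eval X (x + eval u x) := by
  refine forall₂_congr fun x hx => ?_
  rw [fderiv_add_eval hu hx, eq_comm,
    (isInvertible_id_add ((norm_jac_le hu hx).trans_lt h1)).inverse_apply_eq, eq_comm]
  rfl

/-! ### Real fields -/

/-- The inclusion `ℝᵈ → ℂᵈ` as a continuous linear map. -/
def realPtL (d : ℕ) : (Fin d → ℝ) →L[ℝ] (Fin d → ℂ) :=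
  ContinuousLinearMap.pi fun i => Complex.ofRealCLM.comp (ContinuousLinearMap.proj i)

/-- The real part `ℂᵈ → ℝᵈ` as a continuous linear map. -/
def rePtL (d : ℕ) : (Fin d → ℂ) →L[ℝ] (Fin d → ℝ) :=
  ContinuousLinearMap.pi fun i => Complex.reCLM.comp (ContinuousLinearMap.proj i)

@[simp] theorem rePtL_apply (x : Fin d → ℂ) (i : Fin d) : rePtL d x i = (x i).re := rfl

theorem rePtL_realPt (x : Fin d → ℝ) : rePtL d (realPt x) = x := by ext i; simp [realPt]

theorem norm_realPt_le (x : Fin d → ℝ) : ‖realPt x‖ ≤ ‖x‖ :=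
  (pi_norm_le_iff_of_nonneg (norm_nonneg _)).2 fun i => by
    rw [realPt, Complex.norm_real]; exact norm_le_pi_norm x i

theorem norm_rePtL_le (x : Fin d → ℂ) : ‖rePtL d x‖ ≤ ‖x‖ :=
  (pi_norm_le_iff_of_nonneg (norm_nonneg _)).2 fun i =>
    (Complex.abs_re_le_norm (x i)).trans (norm_le_pi_norm x i)

theorem IsRealVF.realPt_onReal {f : VF d} (hf : IsRealVF f) (x : Fin d → ℝ) :
    realPt (onReal f x) = eval f (realPt x) := by
  ext i
  apply Complex.ext
  · simp [realPt, onReal]; rfl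
  · simp only [realPt, Complex.ofReal_im]
    exact (hf x i).symm

/-- The derivative at `x` of the real field `onReal u`. -/
def realJac (u : VF d) (x : Fin d → ℝ) : (Fin d → ℝ) →L[ℝ] (Fin d → ℝ) :=
  (rePtL d).comp (((jac u (realPt x)).restrictScalars ℝ).comp (realPtL d))

theorem hasFDerivAt_eval_realPt {r : ℝ} (hr : 0 < r) {u : VF d} (hu : u ∈ spA' d r)
    (x : Fin d → ℝ) : HasFDerivAt (fun y => eval u (realPt y))
      (((jac u (realPt x)).restrictScalars ℝ).comp (realPtL d)) x :=
  ((hasFDerivAt_eval hu (realPt_mem_strip hr x)).restrictScalars ℝ).comp x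
    (realPtL d).hasFDerivAt

theorem hasFDerivAt_onReal {r : ℝ} (hr : 0 < r) {u : VF d} (hu : u ∈ spA' d r)
    (x : Fin d → ℝ) : HasFDerivAt (onReal u) (realJac u x) x :=
  (rePtL d).hasFDerivAt.comp x (hasFDerivAt_eval_realPt hr hu x)

theorem norm_realJac_le {r : ℝ} (hr : 0 < r) {u : VF d} (hu : u ∈ spA' d r)
    (x : Fin d → ℝ) : ‖realJac u x‖ ≤ nA' r u := by
  refine ContinuousLinearMap.opNorm_le_bound _ (nA'_nonneg r u) fun h => ?_
  refine (norm_rePtL_le _).trans ?_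
  refine ((jac u (realPt x)).le_opNorm (realPt h)).trans ?_
  exact mul_le_mul (norm_jac_le hu (realPt_mem_strip hr x)) (norm_realPt_le h) (norm_nonneg _)
    (nA'_nonneg r u)

/-- The derivative of a real field maps real vectors to real vectors. -/
theorem realPt_realJac {r : ℝ} (hr : 0 < r) {u : VF d} (hu : u ∈ spA' d r) (hre : IsRealVF u)
    (x h : Fin d → ℝ) : realPt (realJac u x h) = jac u (realPt x) (realPt h) := by
  have h1 := (realPtL d).hasFDerivAt.comp x (hasFDerivAt_onReal hr hu x)
  have h2 := hasFDerivAt_eval_realPt hr hu x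
  have h3 : (⇑(realPtL d) ∘ onReal u) = fun y => eval u (realPt y) :=
    funext fun y => hre.realPt_onReal y
  rw [h3] at h1
  exact DFunLike.congr_fun (h1.unique h2) h

/-- The change of variables `x ↦ x + u x` of `ℝᵈ`. -/
def realShift (u : VF d) (x : Fin d → ℝ) : Fin d → ℝ := x + onReal u x

theorem approximatesLinearOn_realShift {r : ℝ} (hr : 0 < r) {u : VF d} (hu : u ∈ spA' d r) :
    ApproximatesLinearOn (realShift u)
      ((ContinuousLinearEquiv.refl ℝ (Fin d → ℝ) : (Fin d → ℝ) ≃L[ℝ] (Fin d → ℝ)) :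
        (Fin d → ℝ) →L[ℝ] (Fin d → ℝ)) Set.univ (nA' r u).toNNReal := by
  intro x _ y _
  have h := (convex_univ (𝕜 := ℝ) (E := Fin d → ℝ)).norm_image_sub_le_of_norm_hasFDerivWithin_le
    (f := onReal u) (f' := realJac u) (C := nA' r u)
    (fun z _ => (hasFDerivAt_onReal hr hu z).hasFDerivWithinAt)
    (fun z _ => norm_realJac_le hr hu z) (Set.mem_univ y) (Set.mem_univ x)
  have h2 : realShift u x - realShift u y - (x - y) = onReal u x - onReal u y := by
    simp only [realShift]; abel
  rw [Real.coe_toNNReal _ (nA'_nonneg r u)]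
  simpa [h2] using h

/-- `id + u` is a homeomorphism of `ℝᵈ`: it is a perturbation of the identity whose Lipschitz
constant is less than one. -/
theorem exists_homeomorph_realShift {r : ℝ} (hr : 0 < r) {u : VF d} (hu : u ∈ spA' d r)
    (h1 : nA' r u < 1) : ∃ e : (Fin d → ℝ) ≃ₜ (Fin d → ℝ), ⇑e = realShift u := by
  have h := approximatesLinearOn_realShift hr hu
  rcases subsingleton_or_nontrivial (Fin d → ℝ) with hs | hs
  · exact ⟨h.toHomeomorph _ (Or.inl hs), rfl⟩
  · refine ⟨h.toHomeomorph _ (Or.inr ?_), rfl⟩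
    rw [← NNReal.coe_lt_coe, Real.coe_toNNReal _ (nA'_nonneg r u)]
    simpa using h1

end Jacobian

/-! ### Fourier multipliers, conjugation and composition in the Wiener algebra -/

namespace Wiener

variable {d : ℕ} {r : ℝ≥0}

/-- The Fourier multiplier with bounded symbol `m`. -/
def mult (m : (Fin d → ℤ) → ℂ) {C : ℝ} (hm : ∀ k, ‖m k‖ ≤ C) : Wiener d r →ₗ[ℂ] Wiener d r where
  toFun a := mk (fun k => m k * a.coeff k) <|
    Summable.of_nonneg_of_le (fun k => by positivity)
      (fun k => by
        rw [norm_mul, mul_assoc]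
        exact mul_le_mul_of_nonneg_right (hm k) (by positivity)) (a.summable.mul_left C)
  map_add' a b := by ext k; simp [mul_add]
  map_smul' c a := by ext k; simp [mul_left_comm]

@[simp] theorem coeff_mult (m : (Fin d → ℤ) → ℂ) {C : ℝ} (hm : ∀ k, ‖m k‖ ≤ C) (a : Wiener d r)
    (k : Fin d → ℤ) : (mult m hm a).coeff k = m k * a.coeff k := rfl

theorem norm_mult_le (m : (Fin d → ℤ) → ℂ) {C : ℝ} (hm : ∀ k, ‖m k‖ ≤ C) (a : Wiener d r) :
    ‖mult m hm a‖ ≤ C * ‖a‖ := by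
  rw [norm_def, norm_def, ← tsum_mul_left]
  refine (mult m hm a).summable.tsum_le_tsum (fun k => ?_) (a.summable.mul_left C)
  rw [coeff_mult, norm_mul, mul_assoc]
  exact mul_le_mul_of_nonneg_right (hm k) (by positivity)

/-- The conjugation `a_k ↦ conj a_{-k}`, which conjugates the values at real points. -/
def conj : Wiener d r →+ Wiener d r where
  toFun a := mk (fun k => (starRingEnd ℂ) (a.coeff (-k))) <| by
    refine ((Equiv.neg (Fin d → ℤ)).summable_iff.2 a.summable).congr fun k => ?_
    simp
  map_zero' := by ext k; simp
  map_add' a b := by ext k; simp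

@[simp] theorem coeff_conj (a : Wiener d r) (k : Fin d → ℤ) :
    (conj a).coeff k = (starRingEnd ℂ) (a.coeff (-k)) := rfl

theorem norm_conj (a : Wiener d r) : ‖conj a‖ = ‖a‖ := by
  rw [norm_def, norm_def, ← (Equiv.neg (Fin d → ℤ)).tsum_eq]
  simp

theorem ev_conj (x : Fin d → ℝ) (a : Wiener d r) :
    ev (realPt x) (conj a) = (starRingEnd ℂ) (ev (realPt x) a) := by
  rw [ev, ev, Complex.conj_tsum, ← (Equiv.neg (Fin d → ℤ)).tsum_eq]
  refine tsum_congr fun k => ?_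
  rw [map_mul, conj_chr]
  simp only [Equiv.neg_apply, coeff_conj, neg_neg, realPt, Complex.conj_ofReal]
  rfl

theorem conj_mul (a b : Wiener d r) : conj (a * b) = conj a * conj b := ev_injective fun x => by
  rw [ev_conj, ev_mul (adm_realPt x), ev_mul (adm_realPt x), ev_conj, ev_conj, map_mul]

theorem mult_conj (m : (Fin d → ℤ) → ℂ) {C : ℝ} (hm : ∀ k, ‖m k‖ ≤ C)
    (h : ∀ k, (starRingEnd ℂ) (m (-k)) = m k) (a : Wiener d r) :
    mult m hm (conj a) = conj (mult m hm a) := by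
  ext k
  simp [h]

/-! ### Vector fields as tuples of elements of the algebra -/

/-- The vector field with given components. -/
def toVF (h : Fin d → Wiener d r) : VF d := fun k i => (h i).coeff k

theorem hasSum_toVF (h : Fin d → Wiener d r) :
    HasSum (fun k => l1 (toVF h k) * Real.exp (r * l1 k)) (∑ i, ‖h i‖) := by
  have : (fun k => l1 (toVF h k) * Real.exp (r * l1 k)) =
      fun k => ∑ i, ‖(h i).coeff k‖ * Real.exp (r * l1 k) := by
    funext k; rw [l1, Finset.sum_mul]; rfl
  rw [this]
  refine hasSum_sum fun i _ => ?_
  rw [norm_def]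
  exact (h i).summable.hasSum

theorem toVF_mem (h : Fin d → Wiener d r) : toVF h ∈ spA d r := (hasSum_toVF h).summable

theorem nA_toVF (h : Fin d → Wiener d r) : nA r (toVF h) = ∑ i, ‖h i‖ := (hasSum_toVF h).tsum_eq

theorem eval_toVF (h : Fin d → Wiener d r) {x : Fin d → ℂ} (hx : Adm r x) (i : Fin d) :
    eval (toVF h) x i = ev x (h i) :=
  eval_apply (summable_chr_smul (toVF_mem h) hx) i

theorem summable_component {f : VF d} {t : ℝ} (hf : f ∈ spA d t) (i : Fin d) :
    Summable fun k => ‖f k i‖ * Real.exp (t * l1 k) :=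
  Summable.of_nonneg_of_le (fun k => by positivity)
    (fun k => mul_le_mul_of_nonneg_right (norm_apply_le_l1 _ i) (Real.exp_pos _).le) hf

/-- The components of a vector field. -/
def ofVF {f : VF d} (hf : f ∈ spA d r) (i : Fin d) : Wiener d r :=
  mk (fun k => f k i) (summable_component hf i)

/-! ### Composition with a change of variables -/

/-- The exponent `2 π i k · u`. -/
def expo (u : Fin d → Wiener d r) (k : Fin d → ℤ) : Wiener d r :=
  ∑ i, (2 * Real.pi * Complex.I * (k i : ℂ)) • u i

theorem norm_expo_le {u : Fin d → Wiener d r} {M : ℝ} (hu : ∀ i, ‖u i‖ ≤ M) (k : Fin d → ℤ) :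
    ‖expo u k‖ ≤ 2 * Real.pi * l1 k * M := by
  rw [l1, Finset.mul_sum, Finset.sum_mul]
  refine norm_sum_le_of_le _ fun i _ => ?_
  rw [norm_smul]
  refine mul_le_mul ?_ (hu i) (norm_nonneg _) (by positivity)
  simp [abs_of_pos Real.pi_pos, Int.norm_eq_abs]

theorem expo_sub (u w : Fin d → Wiener d r) (k : Fin d → ℤ) :
    expo u k - expo w k = expo (fun i => u i - w i) k := by
  simp [expo, smul_sub]

/-- The function `exp (2 π i k · (x + u x))`. -/
def wave (u : Fin d → Wiener d r) (k : Fin d → ℤ) : Wiener d r :=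
  mon k * NormedSpace.exp (expo u k)

theorem norm_wave_le {u : Fin d → Wiener d r} {M ν : ℝ} (hu : ∀ i, ‖u i‖ ≤ M)
    (hM : 2 * Real.pi * M ≤ ν) (k : Fin d → ℤ) : ‖wave u k‖ ≤ Real.exp ((r + ν) * l1 k) := by
  refine (norm_mul_le _ _).trans ?_
  rw [norm_mon, add_mul, Real.exp_add]
  gcongr
  refine (norm_exp_le _).trans (Real.exp_le_exp.2 ((norm_expo_le hu k).trans ?_))
  have := mul_le_mul_of_nonneg_right hM (l1_nonneg k)
  linarith

/-- The constant `6 π` is three times that of `norm_wave_le`: the bound `norm_exp_sub_exp_le` has the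
exponent `‖b‖ + ‖a - b‖ ≤ ‖a‖ + 2 ‖b‖`. -/
theorem norm_wave_sub_le {u w : Fin d → Wiener d r} {M D ν : ℝ} (hu : ∀ i, ‖u i‖ ≤ M)
    (hw : ∀ i, ‖w i‖ ≤ M) (hD : ∀ i, ‖u i - w i‖ ≤ D) (hM : 6 * Real.pi * M ≤ ν)
    (k : Fin d → ℤ) :
    ‖wave u k - wave w k‖ ≤ 2 * Real.pi * l1 k * D * Real.exp ((r + ν) * l1 k) := by
  rw [wave, wave, ← mul_sub]
  have hsub : ‖expo u k - expo w k‖ ≤ 2 * Real.pi * l1 k * D := by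
    rw [expo_sub]; exact norm_expo_le hD k
  have hexp : ‖expo w k‖ + ‖expo u k - expo w k‖ ≤ ν * l1 k := by
    have h1 := norm_expo_le hu k
    have h2 := norm_expo_le hw k
    have h3 := norm_sub_le (expo u k) (expo w k)
    have := mul_le_mul_of_nonneg_right hM (l1_nonneg k)
    linarith
  calc _ ≤ ‖mon (r := r) k‖ * ‖NormedSpace.exp (expo u k) - NormedSpace.exp (expo w k)‖ :=
        norm_mul_le _ _
    _ ≤ Real.exp (r * l1 k) * (2 * Real.pi * l1 k * D * Real.exp (ν * l1 k)) := by
        rw [norm_mon]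
        gcongr
        refine (norm_exp_sub_exp_le _ _).trans ?_
        gcongr
        exact (norm_nonneg _).trans hsub
    _ = _ := by rw [add_mul, Real.exp_add]; ring

theorem ev_wave {x : Fin d → ℂ} (hx : Adm r x) (u : Fin d → Wiener d r) (k : Fin d → ℤ) :
    ev x (wave u k) = chr k (x + fun i => ev x (u i)) := by
  rw [wave, ev_mul hx, ev_mon, ev_exp hx, chr_add_right]
  congr 1
  rw [chr, expo, ← evL_apply hx, map_sum, Finset.mul_sum]
  congr 1
  refine Finset.sum_congr rfl fun i _ => ?_
  rw [map_smul, evL_apply, smul_eq_mul, mul_assoc]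

/-- The `i`-th component of the composition `f ∘ (id + u)`. -/
def comp (f : VF d) (u : Fin d → Wiener d r) (i : Fin d) : Wiener d r := ∑' k, f k i • wave u k

variable {f : VF d} {ν : ℝ}

theorem summable_wave (hf : f ∈ spA d (r + ν)) {u : Fin d → Wiener d r} {M : ℝ}
    (hu : ∀ i, ‖u i‖ ≤ M) (hM : 2 * Real.pi * M ≤ ν) (i : Fin d) :
    Summable fun k => f k i • wave u k :=
  Summable.of_norm_bounded (summable_component hf i) fun k => by
    rw [norm_smul]
    exact mul_le_mul_of_nonneg_left (norm_wave_le hu hM k) (norm_nonneg _)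

theorem sum_norm_comp_le (hf : f ∈ spA d (r + ν)) {u : Fin d → Wiener d r} {M : ℝ}
    (hu : ∀ i, ‖u i‖ ≤ M) (hM : 2 * Real.pi * M ≤ ν) :
    ∑ i, ‖comp f u i‖ ≤ nA (r + ν) f := by
  have h1 : HasSum (fun k => l1 (f k) * Real.exp ((r + ν) * l1 k))
      (∑ i, ∑' k, ‖f k i‖ * Real.exp ((r + ν) * l1 k)) := by
    have : (fun k => l1 (f k) * Real.exp ((r + ν) * l1 k)) =
        fun k => ∑ i, ‖f k i‖ * Real.exp ((r + ν) * l1 k) := by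
      funext k; rw [l1, Finset.sum_mul]
    rw [this]
    exact hasSum_sum fun i _ => (summable_component hf i).hasSum
  rw [nA, h1.tsum_eq]
  refine Finset.sum_le_sum fun i _ => ?_
  refine tsum_of_norm_bounded (summable_component hf i).hasSum fun k => ?_
  rw [norm_smul]
  exact mul_le_mul_of_nonneg_left (norm_wave_le hu hM k) (norm_nonneg _)

/-- Composition is Lipschitz in the change of variables, with constant the norm of the derivative
on the wider strip. -/
theorem sum_norm_comp_sub_le (hf : f ∈ spA' d (r + ν)) {u w : Fin d → Wiener d r} {M D : ℝ}
    (hu : ∀ i, ‖u i‖ ≤ M) (hw : ∀ i, ‖w i‖ ≤ M) (hD : ∀ i, ‖u i - w i‖ ≤ D) (hD0 : 0 ≤ D)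
    (hM0 : 0 ≤ M) (hM : 6 * Real.pi * M ≤ ν) :
    ∑ i, ‖comp f u i - comp f w i‖ ≤ D * nA' (r + ν) f := by
  have hf1 := spA'_subset_spA _ hf
  have hM' : 2 * Real.pi * M ≤ ν := by
    have := mul_nonneg Real.pi_pos.le hM0
    linarith
  have h0 : ∀ k i, ‖f k i • (wave u k - wave w k)‖ ≤
      D * ((1 + 2 * Real.pi * l1 k) * ‖f k i‖ * Real.exp ((r + ν) * l1 k)) := fun k i => by
    rw [norm_smul]
    have h2 := l1_nonneg k
    have h3 := Real.pi_pos
    calc _ ≤ ‖f k i‖ * (2 * Real.pi * l1 k * D * Real.exp ((r + ν) * l1 k)) :=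
          mul_le_mul_of_nonneg_left (norm_wave_sub_le hu hw hD hM k) (norm_nonneg _)
      _ = D * (2 * Real.pi * l1 k * ‖f k i‖ * Real.exp ((r + ν) * l1 k)) := by ring
      _ ≤ _ := by gcongr; linarith
  have hs : ∀ i, Summable fun k => (1 + 2 * Real.pi * l1 k) * ‖f k i‖ *
      Real.exp ((r + ν) * l1 k) := fun i => by
    refine Summable.of_nonneg_of_le (fun k => ?_) (fun k => ?_) hf
    · have h2 := l1_nonneg k
      have h3 := Real.pi_pos
      positivity
    · have h2 := l1_nonneg k
      have h3 := Real.pi_pos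
      gcongr
      exact norm_apply_le_l1 _ i
  have h1 : HasSum (fun k => (1 + 2 * Real.pi * l1 k) * l1 (f k) * Real.exp ((r + ν) * l1 k))
      (∑ i, ∑' k, (1 + 2 * Real.pi * l1 k) * ‖f k i‖ * Real.exp ((r + ν) * l1 k)) := by
    have : (fun k => (1 + 2 * Real.pi * l1 k) * l1 (f k) * Real.exp ((r + ν) * l1 k)) =
        fun k => ∑ i, (1 + 2 * Real.pi * l1 k) * ‖f k i‖ * Real.exp ((r + ν) * l1 k) := by
      funext k; rw [show l1 (f k) = ∑ i, ‖f k i‖ from rfl, Finset.mul_sum, Finset.sum_mul]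
    rw [this]
    exact hasSum_sum fun i _ => (hs i).hasSum
  rw [nA', h1.tsum_eq, Finset.mul_sum]
  refine Finset.sum_le_sum fun i _ => ?_
  rw [comp, comp, ← (summable_wave hf1 hu hM' i).tsum_sub (summable_wave hf1 hw hM' i)]
  refine tsum_of_norm_bounded ((hs i).hasSum.mul_left D) fun k => ?_
  rw [← smul_sub]
  exact h0 k i

theorem ev_comp (hf : f ∈ spA d (r + ν)) {u : Fin d → Wiener d r} {M : ℝ}
    (hu : ∀ i, ‖u i‖ ≤ M) (hM : 2 * Real.pi * M ≤ ν) {x : Fin d → ℂ} (hx : Adm r x) (i : Fin d) :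
    ev x (comp f u i) = ∑' k, chr k (x + fun i => ev x (u i)) * f k i := by
  rw [comp, ← evL_apply hx, (evL hx).map_tsum (summable_wave hf hu hM i)]
  refine tsum_congr fun k => ?_
  rw [map_smul, evL_apply, ev_wave hx, smul_eq_mul, mul_comm]

theorem comp_zero (hf : f ∈ spA d (r + ν)) (hν : 0 ≤ ν) (hf0 : f ∈ spA d r) (i : Fin d) :
    comp f (0 : Fin d → Wiener d r) i = ofVF hf0 i := ev_injective fun x => by
  rw [ev_comp hf (M := 0) (by simp) (by simpa using hν) (adm_realPt x)]
  have : (fun i : Fin d => ev (realPt x) ((0 : Fin d → Wiener d r) i)) = 0 := by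
    funext i; simp [ev_zero]
  rw [this, add_zero]
  rfl

/-- The points `x + u x` lie in the wider strip. -/
theorem norm_chr_shift_le {u : Fin d → Wiener d r} {M : ℝ} (hu : ∀ i, ‖u i‖ ≤ M)
    (hM : 2 * Real.pi * M ≤ ν) {x : Fin d → ℂ} (hx : Adm r x) (k : Fin d → ℤ) :
    ‖chr k (x + fun i => ev x (u i))‖ ≤ Real.exp ((r + ν) * l1 k) := by
  rw [← ev_wave hx]
  exact (norm_ev_le hx _).trans (norm_wave_le hu hM k)

theorem conj_comp (hf : f ∈ spA d (r + ν)) (hreal : ∀ k i, f (-k) i = (starRingEnd ℂ) (f k i))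
    {u : Fin d → Wiener d r} {M : ℝ} (hu : ∀ i, ‖u i‖ ≤ M) (hM : 2 * Real.pi * M ≤ ν)
    (i : Fin d) : comp f (fun j => conj (u j)) i = conj (comp f u i) := ev_injective fun x => by
  rw [ev_conj, ev_comp hf hu hM (adm_realPt x),
    ev_comp hf (M := M) (fun i => by rw [norm_conj]; exact hu i) hM (adm_realPt x),
    Complex.conj_tsum, ← (Equiv.neg (Fin d → ℤ)).tsum_eq]
  refine tsum_congr fun k => ?_
  rw [map_mul, conj_chr, Equiv.neg_apply, hreal]
  congr 2
  ext j
  simp [ev_conj, realPt]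

end Wiener

/-! ### Elimination of the far from resonance modes by a fixed point argument -/

section Elimination

open Wiener

variable {d : ℕ} {r : ℝ≥0} {v : Fin d → ℝ} {s : ℝ}

theorem zero_notMem_far : (0 : Fin d → ℤ) ∉ far v s := by simp [far, pair]

theorem pair_neg (k : Fin d → ℤ) (v : Fin d → ℝ) : pair (-k) v = -pair k v := by simp [pair]

theorem neg_mem_far {k : Fin d → ℤ} : -k ∈ far v s ↔ k ∈ far v s := by simp [far, pair_neg]

theorem mul_l1_le_of_mem_far {k : Fin d → ℤ} (hk : k ∈ far v s) : s * l1 k ≤ |pair k v| := hk.le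

theorem one_le_l1_of_mem_far {k : Fin d → ℤ} (hk : k ∈ far v s) : 1 ≤ l1 k :=
  one_le_l1 fun h => zero_notMem_far (h ▸ hk)

theorem pair_ne_zero_of_mem_far (hs : 0 < s) {k : Fin d → ℤ} (hk : k ∈ far v s) :
    pair k v ≠ 0 := by
  have h1 := mul_l1_le_of_mem_far hk
  have h2 := one_le_l1_of_mem_far hk
  have : 0 < |pair k v| := by nlinarith
  exact abs_pos.1 this

/-! ### The multipliers -/

/-- The symbol of the projection onto the far from resonance modes. -/
def farSym (v : Fin d → ℝ) (s : ℝ) : (Fin d → ℤ) → ℂ := (far v s).indicator 1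

/-- The symbol of the projection onto the resonant modes. -/
def resSym (v : Fin d → ℝ) (s : ℝ) : (Fin d → ℤ) → ℂ := (far v s)ᶜ.indicator 1

/-- The symbol of the inverse of the directional derivative `∂_v` on the far modes. -/
def invSym (v : Fin d → ℝ) (s : ℝ) : (Fin d → ℤ) → ℂ :=
  (far v s).indicator fun k => (2 * Real.pi * Complex.I * (pair k v : ℂ))⁻¹

/-- The symbol of `∂_j ∂_v⁻¹` on the far modes. -/
def derSym (v : Fin d → ℝ) (s : ℝ) (j : Fin d) : (Fin d → ℤ) → ℂ :=
  (far v s).indicator fun k => (k j : ℂ) / (pair k v : ℂ)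

theorem norm_farSym_le (k : Fin d → ℤ) : ‖farSym v s k‖ ≤ 1 := by
  by_cases hk : k ∈ far v s <;> simp [farSym, hk]

theorem norm_resSym_le (k : Fin d → ℤ) : ‖resSym v s k‖ ≤ 1 := by
  by_cases hk : k ∈ far v s <;> simp [resSym, hk]

/-- On the far modes `|k · v| > s ‖k‖ ≥ s`, so a divisor costs at most `1 / (2 π s)`. -/
theorem norm_invSym_le (hs : 0 < s) (k : Fin d → ℤ) : ‖invSym v s k‖ ≤ (2 * Real.pi * s)⁻¹ := by
  have := Real.pi_pos
  by_cases hk : k ∈ far v s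
  · have h1 := mul_l1_le_of_mem_far hk
    have h2 := one_le_l1_of_mem_far hk
    simp only [invSym, Set.indicator_of_mem hk, norm_inv, norm_mul, Complex.norm_real,
      Complex.norm_I, Real.norm_eq_abs, abs_of_pos Real.pi_pos, Complex.norm_ofNat, mul_one]
    gcongr
    nlinarith
  · simp only [invSym, Set.indicator_of_notMem hk, norm_zero]
    positivity

theorem norm_derSym_le (hs : 0 < s) (j : Fin d) (k : Fin d → ℤ) : ‖derSym v s j k‖ ≤ s⁻¹ := by
  by_cases hk : k ∈ far v s
  · have h1 := mul_l1_le_of_mem_far hk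
    have h2 := one_le_l1_of_mem_far hk
    have h3 := norm_apply_le_l1 k j
    rw [Int.norm_eq_abs] at h3
    simp only [derSym, Set.indicator_of_mem hk, norm_div, Complex.norm_real, Real.norm_eq_abs,
      Complex.norm_intCast]
    rw [div_le_iff₀ (abs_pos.2 (pair_ne_zero_of_mem_far hs hk)), inv_mul_eq_div, le_div_iff₀ hs]
    nlinarith
  · simp only [derSym, Set.indicator_of_notMem hk, norm_zero]
    positivity

/-- The projection onto the far from resonance modes. -/
def farW (v : Fin d → ℝ) (s : ℝ) : Wiener d r →ₗ[ℂ] Wiener d r :=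
  mult (farSym v s) norm_farSym_le

/-- The projection onto the resonant modes. -/
def resW (v : Fin d → ℝ) (s : ℝ) : Wiener d r →ₗ[ℂ] Wiener d r :=
  mult (resSym v s) norm_resSym_le

/-- The operator `∂_v⁻¹ 𝕀⁻`. -/
def invW (v : Fin d → ℝ) (hs : 0 < s) : Wiener d r →ₗ[ℂ] Wiener d r :=
  mult (invSym v s) (norm_invSym_le hs)

/-- The operator `∂_j ∂_v⁻¹ 𝕀⁻`. -/
def derW (v : Fin d → ℝ) (hs : 0 < s) (j : Fin d) : Wiener d r →ₗ[ℂ] Wiener d r :=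
  mult (derSym v s j) (norm_derSym_le hs j)

theorem norm_farW_le (a : Wiener d r) : ‖farW v s a‖ ≤ ‖a‖ :=
  (norm_mult_le _ _ a).trans (one_mul _).le

theorem norm_resW_le (a : Wiener d r) : ‖resW v s a‖ ≤ ‖a‖ :=
  (norm_mult_le _ _ a).trans (one_mul _).le

theorem norm_invW_le (hs : 0 < s) (a : Wiener d r) : ‖invW v hs a‖ ≤ (2 * Real.pi * s)⁻¹ * ‖a‖ :=
  norm_mult_le _ _ a

theorem norm_derW_le (hs : 0 < s) (j : Fin d) (a : Wiener d r) : ‖derW v hs j a‖ ≤ s⁻¹ * ‖a‖ :=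
  norm_mult_le _ _ a

theorem resW_conj (a : Wiener d r) : resW v s (conj a) = conj (resW v s a) :=
  mult_conj _ _ (fun k => by by_cases hk : k ∈ far v s <;> simp [resSym, neg_mem_far, hk]) a

theorem invW_conj (hs : 0 < s) (a : Wiener d r) : invW v hs (conj a) = conj (invW v hs a) :=
  mult_conj _ _ (fun k => by
    by_cases hk : k ∈ far v s <;> simp [invSym, neg_mem_far, hk, pair_neg, Complex.conj_ofNat]) a

theorem derW_conj (hs : 0 < s) (j : Fin d) (a : Wiener d r) :
    derW v hs j (conj a) = conj (derW v hs j a) :=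
  mult_conj _ _ (fun k => by
    by_cases hk : k ∈ far v s <;> simp [derSym, neg_mem_far, hk, pair_neg]) a

theorem invW_farW (hs : 0 < s) (a : Wiener d r) : invW v hs (farW v s a) = invW v hs a := by
  ext k
  by_cases hk : k ∈ far v s <;> simp [invW, farW, invSym, farSym, hk]

theorem derW_farW (hs : 0 < s) (j : Fin d) (a : Wiener d r) :
    derW v hs j (farW v s a) = derW v hs j a := by
  ext k
  by_cases hk : k ∈ far v s <;> simp [derW, farW, derSym, farSym, hk]

/-- `h = 𝕀⁺ h + ∂_v (∂_v⁻¹ 𝕀⁻ h)`. -/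
theorem resW_add_sum_derW (hs : 0 < s) (a : Wiener d r) :
    resW v s a + ∑ j, (v j : ℂ) • derW v hs j a = a := by
  ext k
  change (resW v s a).coeff k + coeffL k (∑ j, (v j : ℂ) • derW v hs j a) = _
  rw [map_sum]
  by_cases hk : k ∈ far v s
  · have h1 : (pair k v : ℂ) ≠ 0 := by exact_mod_cast pair_ne_zero_of_mem_far hs hk
    have h2 : ∑ j, (v j : ℂ) * (k j / (pair k v : ℂ) * a.coeff k) = a.coeff k := by
      have h3 : ∀ j, (v j : ℂ) * (k j / (pair k v : ℂ) * a.coeff k) =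
          ((k j : ℂ) * v j) * (a.coeff k / pair k v) := fun j => by ring
      simp_rw [h3, ← Finset.sum_mul]
      have h4 : ∑ j, (k j : ℂ) * (v j : ℂ) = (pair k v : ℂ) := by simp [pair]
      rw [h4]
      field_simp
    simpa [resW, derW, resSym, derSym, hk] using h2
  · simp [resW, derW, resSym, derSym, hk]

/-! ### The fixed point equation -/

/-- The space of the unknown, with the `ℓ¹`-norm of the components. -/
abbrev Unk (d : ℕ) (r : ℝ≥0) : Type := PiLp 1 fun _ : Fin d => Wiener d r

/-- The displacement `∂_v⁻¹ 𝕀⁻ h`. -/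
def dispW (v : Fin d → ℝ) (hs : 0 < s) (h : Unk d r) (i : Fin d) : Wiener d r := invW v hs (h i)

/-- The `i`-th component of `D (∂_v⁻¹ 𝕀⁻ h) · 𝕀⁺ g`. -/
def quad (v : Fin d → ℝ) (hs : 0 < s) (h g : Unk d r) (i : Fin d) : Wiener d r :=
  ∑ j, derW v hs j (h i) * resW v s (g j)

/-- The map `h ↦ f ∘ (id + u) - Du · 𝕀⁺ h`, where `u = ∂_v⁻¹ 𝕀⁻ h`. At a fixed point `h` the field
`v + 𝕀⁺ h` is the pullback of `v + f` under `id + u`. -/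
def elimMap (v : Fin d → ℝ) (hs : 0 < s) (f : VF d) (h : Unk d r) : Unk d r :=
  WithLp.toLp 1 fun i => comp f (dispW v hs h) i - quad v hs h h i

theorem norm_apply_le_norm (h : Unk d r) (i : Fin d) : ‖h i‖ ≤ ‖h‖ := by
  rw [PiLp.norm_eq_of_L1]
  exact Finset.single_le_sum (f := fun i => ‖h i‖) (fun _ _ => norm_nonneg _) (Finset.mem_univ i)

theorem norm_dispW_le (hs : 0 < s) {h : Unk d r} {R : ℝ} (hR : ‖h‖ ≤ R) (i : Fin d) :
    ‖dispW v hs h i‖ ≤ (2 * Real.pi * s)⁻¹ * R := by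
  have := Real.pi_pos
  refine (norm_invW_le hs _).trans ?_
  gcongr
  exact (norm_apply_le_norm h i).trans hR

theorem sum_norm_quad_le (hs : 0 < s) (h g : Unk d r) :
    ∑ i, ‖quad v hs h g i‖ ≤ s⁻¹ * (∑ i, ‖farW v s (h i)‖) * ‖g‖ := by
  rw [mul_assoc, Finset.sum_mul, Finset.mul_sum, PiLp.norm_eq_of_L1]
  refine Finset.sum_le_sum fun i _ => ?_
  rw [Finset.mul_sum, Finset.mul_sum]
  refine norm_sum_le_of_le _ fun j _ => (norm_mul_le _ _).trans ?_
  rw [← mul_assoc, ← derW_farW]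
  have := inv_nonneg.2 hs.le
  gcongr
  · exact norm_derW_le hs j _
  · exact norm_resW_le _

theorem sum_norm_farW_le (h : Unk d r) : ∑ i, ‖farW v s (h i)‖ ≤ ‖h‖ := by
  rw [PiLp.norm_eq_of_L1]
  exact Finset.sum_le_sum fun i _ => norm_farW_le _

theorem sum_norm_quad_le' (hs : 0 < s) (h g : Unk d r) :
    ∑ i, ‖quad v hs h g i‖ ≤ s⁻¹ * ‖h‖ * ‖g‖ := by
  refine (sum_norm_quad_le hs h g).trans ?_
  have := inv_nonneg.2 hs.le
  gcongr
  exact sum_norm_farW_le h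

variable {f : VF d} {ν e : ℝ}

theorem six_pi_mul_le (hs : 0 < s) (h1 : 6 * e ≤ s * ν) :
    6 * Real.pi * ((2 * Real.pi * s)⁻¹ * (2 * e)) ≤ ν := by
  have := Real.pi_pos
  have h : 6 * Real.pi * ((2 * Real.pi * s)⁻¹ * (2 * e)) = (6 * e) / s := by
    field_simp
  rw [h, div_le_iff₀ hs]
  linarith

theorem two_pi_mul_le (hs : 0 < s) (he : 0 ≤ e) (h1 : 6 * e ≤ s * ν) :
    2 * Real.pi * ((2 * Real.pi * s)⁻¹ * (2 * e)) ≤ ν := by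
  refine le_trans ?_ (six_pi_mul_le hs h1)
  have := Real.pi_pos
  gcongr
  norm_num

/-- The ball of radius `2 e` is invariant. The first smallness condition keeps the displacement within
the loss `ν` of strip width, the second makes the quadratic term small; both hold with room to spare
for `e ≤ eps v s ν`. -/
theorem norm_elimMap_le (hs : 0 < s) (he : 0 ≤ e) (hf : f ∈ spA' d (r + ν))
    (hfe : nA' (r + ν) f ≤ e) (h1 : 6 * e ≤ s * ν) (h2 : 100 * e ≤ s) {h : Unk d r}
    (hh : ‖h‖ ≤ 2 * e) : ‖elimMap v hs f h‖ ≤ 2 * e := by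
  rw [PiLp.norm_eq_of_L1]
  calc ∑ i, ‖elimMap v hs f h i‖ ≤ ∑ i, (‖comp f (dispW v hs h) i‖ + ‖quad v hs h h i‖) :=
        Finset.sum_le_sum fun i _ => norm_sub_le _ _
    _ = ∑ i, ‖comp f (dispW v hs h) i‖ + ∑ i, ‖quad v hs h h i‖ := Finset.sum_add_distrib
    _ ≤ e + s⁻¹ * (2 * e) * (2 * e) := by
        refine add_le_add ?_ ?_
        · exact (sum_norm_comp_le (spA'_subset_spA _ hf) (norm_dispW_le hs hh)
            (two_pi_mul_le hs he h1)).trans ((nA_le_nA' hf).trans hfe)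
        · refine (sum_norm_quad_le' hs h h).trans ?_
          have := inv_nonneg.2 hs.le
          gcongr
    _ ≤ 2 * e := by
        have : s⁻¹ * (2 * e) ≤ 1 / 2 := by
          rw [inv_mul_eq_div, div_le_iff₀ hs]; linarith
        nlinarith

theorem quad_sub (hs : 0 < s) (h g : Unk d r) (i : Fin d) :
    quad v hs h h i - quad v hs g g i = quad v hs (h - g) h i + quad v hs g (h - g) i := by
  simp only [quad, ← Finset.sum_sub_distrib, ← Finset.sum_add_distrib]
  refine Finset.sum_congr rfl fun j _ => ?_
  simp only [PiLp.sub_apply, map_sub]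
  ring

theorem norm_elimMap_sub_le (hs : 0 < s) (he : 0 ≤ e) (hf : f ∈ spA' d (r + ν))
    (hfe : nA' (r + ν) f ≤ e) (h1 : 6 * e ≤ s * ν) (h2 : 100 * e ≤ s) {h g : Unk d r}
    (hh : ‖h‖ ≤ 2 * e) (hg : ‖g‖ ≤ 2 * e) :
    ‖elimMap v hs f h - elimMap v hs f g‖ ≤ 1 / 2 * ‖h - g‖ := by
  have hpi := Real.pi_gt_three
  rw [PiLp.norm_eq_of_L1]
  have hq : ∑ i, ‖quad v hs h h i - quad v hs g g i‖ ≤ s⁻¹ * (4 * e) * ‖h - g‖ := by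
    calc _ ≤ ∑ i, (‖quad v hs (h - g) h i‖ + ‖quad v hs g (h - g) i‖) :=
          Finset.sum_le_sum fun i _ => by rw [quad_sub]; exact norm_add_le _ _
      _ = ∑ i, ‖quad v hs (h - g) h i‖ + ∑ i, ‖quad v hs g (h - g) i‖ := Finset.sum_add_distrib
      _ ≤ s⁻¹ * ‖h - g‖ * (2 * e) + s⁻¹ * (2 * e) * ‖h - g‖ := by
          have := inv_nonneg.2 hs.le
          refine add_le_add ((sum_norm_quad_le' hs _ _).trans ?_)
            ((sum_norm_quad_le' hs _ _).trans ?_) <;> gcongr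
      _ = _ := by ring
  have hc : ∑ i, ‖comp f (dispW v hs h) i - comp f (dispW v hs g) i‖ ≤
      s⁻¹ * e * ‖h - g‖ := by
    have hD : ∀ i, ‖dispW v hs h i - dispW v hs g i‖ ≤ (2 * Real.pi * s)⁻¹ * ‖h - g‖ := fun i => by
      simp only [dispW]
      rw [← map_sub]
      exact norm_dispW_le hs (h := h - g) le_rfl i
    refine (sum_norm_comp_sub_le hf (norm_dispW_le hs hh) (norm_dispW_le hs hg) hD (by positivity)
      (by positivity) (six_pi_mul_le hs h1)).trans ?_
    have h3 : (2 * Real.pi * s)⁻¹ ≤ s⁻¹ := by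
      gcongr
      nlinarith
    calc _ ≤ s⁻¹ * ‖h - g‖ * e := by
          gcongr
          exact nA'_nonneg _ _
      _ = _ := by ring
  calc ∑ i, ‖(elimMap v hs f h - elimMap v hs f g) i‖
      ≤ ∑ i, (‖comp f (dispW v hs h) i - comp f (dispW v hs g) i‖ +
          ‖quad v hs h h i - quad v hs g g i‖) := Finset.sum_le_sum fun i _ => by
        rw [PiLp.sub_apply]
        simp only [elimMap]
        rw [sub_sub_sub_comm]
        exact norm_sub_le _ _
    _ = _ + _ := Finset.sum_add_distrib
    _ ≤ s⁻¹ * e * ‖h - g‖ + s⁻¹ * (4 * e) * ‖h - g‖ := add_le_add hc hq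
    _ = (s⁻¹ * (5 * e)) * ‖h - g‖ := by ring
    _ ≤ 1 / 2 * ‖h - g‖ := by
        gcongr
        rw [inv_mul_eq_div, div_le_iff₀ hs]; linarith

/-- The fixed point, from the contraction principle on the ball of radius `2 e`. -/
theorem exists_elimMap_eq (v : Fin d → ℝ) (hs : 0 < s) (he : 0 ≤ e) (hf : f ∈ spA' d (r + ν))
    (hfe : nA' (r + ν) f ≤ e) (h1 : 6 * e ≤ s * ν) (h2 : 100 * e ≤ s) :
    ∃ h : Unk d r, ‖h‖ ≤ 2 * e ∧ elimMap v hs f h = h := by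
  have hmaps : Set.MapsTo (elimMap v hs f) (Metric.closedBall (0 : Unk d r) (2 * e))
      (Metric.closedBall 0 (2 * e)) := fun h hh => by
    rw [mem_closedBall_zero_iff] at hh ⊢
    exact norm_elimMap_le hs he hf hfe h1 h2 hh
  have hcontr : ContractingWith (1 / 2) (hmaps.restrict _ _ _) := by
    refine ⟨by rw [← NNReal.coe_lt_coe]; norm_num, LipschitzWith.of_dist_le_mul fun h g => ?_⟩
    rw [Subtype.dist_eq, Subtype.dist_eq, dist_eq_norm, dist_eq_norm]
    have := norm_elimMap_sub_le (v := v) hs he hf hfe h1 h2 (mem_closedBall_zero_iff.1 h.2)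
      (mem_closedBall_zero_iff.1 g.2)
    simpa using this
  obtain ⟨h, hh, hfix, -⟩ := hcontr.exists_fixedPoint' Metric.isClosed_closedBall.isComplete hmaps
    (x := 0) (by simpa using he) (edist_ne_top _ _)
  exact ⟨h, mem_closedBall_zero_iff.1 hh, hfix⟩

/-- Componentwise conjugation. -/
def conjUnk (h : Unk d r) : Unk d r := WithLp.toLp 1 fun i => conj (h i)

theorem norm_conjUnk (h : Unk d r) : ‖conjUnk h‖ = ‖h‖ := by
  rw [PiLp.norm_eq_of_L1, PiLp.norm_eq_of_L1]
  exact Finset.sum_congr rfl fun i _ => norm_conj _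

/-- For a real field the fixed point is invariant under conjugation, by uniqueness. -/
theorem conjUnk_eq_of_elimMap_eq (hs : 0 < s) (he : 0 ≤ e) (hf : f ∈ spA' d (r + ν))
    (hfe : nA' (r + ν) f ≤ e) (h1 : 6 * e ≤ s * ν) (h2 : 100 * e ≤ s) {h : Unk d r}
    (hh : ‖h‖ ≤ 2 * e) (hfix : elimMap v hs f h = h)
    (hreal : ∀ k i, f (-k) i = (starRingEnd ℂ) (f k i)) : conjUnk h = h := by
  have hfix' : elimMap v hs f (conjUnk h) = conjUnk h := by
    conv_rhs => rw [← hfix]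
    ext i : 1
    have hd : dispW v hs (conjUnk h) = fun j => conj (dispW v hs h j) :=
      funext fun j => invW_conj hs _
    have hc := conj_comp (spA'_subset_spA _ hf) hreal (norm_dispW_le (v := v) hs hh)
      (two_pi_mul_le hs he h1) i
    have hq : quad v hs (conjUnk h) (conjUnk h) i = conj (quad v hs h h i) := by
      simp only [quad, conjUnk, map_sum, conj_mul, derW_conj, resW_conj]
    change comp f (dispW v hs (conjUnk h)) i - quad v hs (conjUnk h) (conjUnk h) i =
      conj (comp f (dispW v hs h) i - quad v hs h h i)
    rw [map_sub, hq, hd, hc]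
  have := norm_elimMap_sub_le (v := v) hs he hf hfe h1 h2 ((norm_conjUnk h).trans_le hh) hh
  rw [hfix, hfix'] at this
  have h3 : ‖conjUnk h - h‖ = 0 := le_antisymm (by linarith [norm_nonneg (conjUnk h - h)])
    (norm_nonneg _)
  exact sub_eq_zero.1 (norm_eq_zero.1 h3)

end Elimination

section Elimination

open Wiener

variable {d : ℕ}

/-- The coefficients of a real field are symmetric under conjugation. -/
theorem IsRealVF.coeff_neg {X : VF d} (hX : IsRealVF X) {r : ℝ} (hr : 0 ≤ r) (hXr : X ∈ spA d r)
    (k : Fin d → ℤ) (i : Fin d) : X (-k) i = (starRingEnd ℂ) (X k i) := by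
  have hX0 : X ∈ spA d 0 := spA_mono hr hXr
  have hs : Summable fun k => ‖X k i‖ := by simpa using summable_component hX0 i
  have hs' : Summable fun k => ‖(starRingEnd ℂ) (X (-k) i)‖ := by
    refine ((Equiv.neg (Fin d → ℤ)).summable_iff.2 hs).congr fun k => ?_
    simp
  have hc : ∀ (x : Fin d → ℝ) {a : (Fin d → ℤ) → ℂ}, (Summable fun k => ‖a k‖) →
      Summable fun k => chr k (realPt x) * a k := fun x a ha =>
    Summable.of_norm (ha.congr fun k => by simp)
  have h0 := coeff_eq_zero_of_tsum_chr_eq_zero (a := fun k => (starRingEnd ℂ) (X (-k) i) - X k i)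
    (Summable.of_nonneg_of_le (fun _ => norm_nonneg _) (fun k => norm_sub_le _ _) (hs'.add hs))
    fun x => by
      have he : eval X (realPt x) i = ∑' k, chr k (realPt x) * X k i :=
        eval_apply (summable_chr_smul hX0 fun k => by simp) i
      have hconj : ∑' k, chr k (realPt x) * (starRingEnd ℂ) (X (-k) i) =
          (starRingEnd ℂ) (eval X (realPt x) i) := by
        rw [he, Complex.conj_tsum, ← (Equiv.neg (Fin d → ℤ)).tsum_eq]
        refine tsum_congr fun k => ?_
        rw [map_mul, conj_chr]
        simp only [Equiv.neg_apply, neg_neg, realPt, Complex.conj_ofReal]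
        rfl
      have him : (starRingEnd ℂ) (eval X (realPt x) i) = eval X (realPt x) i :=
        Complex.conj_eq_iff_im.2 (hX x i)
      simp_rw [mul_sub]
      rw [(hc x hs').tsum_sub (hc x hs), hconj, him, ← he, sub_self]
  have := congrFun h0 (-k)
  simp only [neg_neg, Pi.zero_apply, sub_eq_zero] at this
  exact this.symm

theorem constVF_coeff_neg (v : Fin d → ℝ) (k : Fin d → ℤ) (i : Fin d) :
    constVF v (-k) i = (starRingEnd ℂ) (constVF v k i) := by
  by_cases hk : k = 0
  · simp [constVF, hk]
  · simp [constVF, Pi.single_eq_of_ne hk, Pi.single_eq_of_ne (neg_ne_zero.2 hk)]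

theorem eval_constVF (v : Fin d → ℝ) (x : Fin d → ℂ) : eval (constVF v) x = realPt v := by
  change ∑' k, chr k x • constVF v k = _
  rw [tsum_eq_single 0 fun k hk => by simp [constVF, Pi.single_eq_of_ne hk]]
  rw [chr_zero_left, one_smul, constVF, Pi.single_eq_same]
  rfl

theorem eval_add {f g : VF d} {x : Fin d → ℂ} (hf : Summable fun k => chr k x • f k)
    (hg : Summable fun k => chr k x • g k) : eval (f + g) x = eval f x + eval g x := by
  change ∑' k, chr k x • (f k + g k) = _
  simp_rw [smul_add]
  exact hf.tsum_add hg

variable {v : Fin d → ℝ} {s ν e : ℝ}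

theorem eps_pos (hs : 0 < s) (hsv : s < l1 v) (hν : 0 < ν) : 0 < eps v s ν := by
  have := hs.trans hsv
  have := Real.pi_pos
  unfold eps
  positivity

theorem eps_bound_width (hs : 0 < s) (hν : 0 < ν) (he : e ≤ eps v s ν) : 6 * e ≤ s * ν := by
  have h1 : eps v s ν ≤ s / 42 * (ν / (4 * Real.pi)) := by
    unfold eps
    gcongr
    exact min_le_left _ _
  have h2 : ν / (4 * Real.pi) ≤ ν := div_le_self hν.le (by linarith [Real.pi_gt_three])
  have h3 : s / 42 * (ν / (4 * Real.pi)) ≤ s / 42 * ν := by gcongr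
  nlinarith [mul_pos hs hν]

theorem eps_bound_cone (hs : 0 < s) (hsv : s < l1 v) (he : e ≤ eps v s ν) : 3000 * e ≤ s := by
  have hv := hs.trans hsv
  have h1 : eps v s ν ≤ s / 42 * (s / (72 * l1 v)) := by
    unfold eps
    gcongr
    exact min_le_right _ _
  have h2 : s / (72 * l1 v) ≤ 1 / 72 := by
    rw [div_le_div_iff₀ (by positivity) (by norm_num)]; linarith
  have h3 : s / 42 * (s / (72 * l1 v)) ≤ s / 42 * (1 / 72) := by gcongr
  linarith

theorem projFar_sub_constVF (X : VF d) : projFar v s (X - constVF v) = projFar v s X := by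
  funext k
  by_cases hk : k ∈ far v s
  · have : k ≠ 0 := fun h => zero_notMem_far (h ▸ hk)
    simp [projFar, hk, constVF, Pi.single_eq_of_ne this]
  · simp [projFar, hk]

theorem projFar_toVF {r : ℝ≥0} (h : Fin d → Wiener d r) :
    projFar v s (toVF h) = toVF fun i => farW v s (h i) := by
  funext k i
  by_cases hk : k ∈ far v s <;> simp [projFar, hk, toVF, farW, farSym]

/-- The operator `∂_v⁻¹ 𝕀⁻` gains one derivative. -/
theorem nA'_disp_le {r : ℝ≥0} (hs : 0 < s) (h : Unk d r) :
    toVF (dispW v hs h) ∈ spA' d r ∧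
      nA' r (toVF (dispW v hs h)) ≤ 2 / s * ∑ i, ‖farW v s (h i)‖ := by
  have hsum := (hasSum_toVF fun i => farW v s (h i)).mul_left (2 / s)
  have hle : ∀ k, (1 + 2 * Real.pi * l1 k) * l1 (toVF (dispW v hs h) k) * Real.exp (r * l1 k) ≤
      2 / s * (l1 (toVF (fun i => farW v s (h i)) k) * Real.exp (r * l1 k)) := fun k => by
    rw [← mul_assoc]
    refine mul_le_mul_of_nonneg_right ?_ (Real.exp_pos _).le
    have h0 : toVF (dispW v hs h) k = invSym v s k • toVF (fun i => farW v s (h i)) k := by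
      ext i
      by_cases hk : k ∈ far v s <;> simp [toVF, dispW, invW, farW, invSym, farSym, hk]
    rw [h0, l1_smul, ← mul_assoc]
    refine mul_le_mul_of_nonneg_right ?_ (l1_nonneg _)
    by_cases hk : k ∈ far v s
    · have h1 := mul_l1_le_of_mem_far hk
      have h2 := one_le_l1_of_mem_far hk
      have hpi := Real.pi_gt_three
      have hp : 0 < |pair k v| := abs_pos.2 (pair_ne_zero_of_mem_far hs hk)
      simp only [invSym, Set.indicator_of_mem hk, norm_inv, norm_mul, Complex.norm_real,
        Complex.norm_I, Real.norm_eq_abs, abs_of_pos Real.pi_pos, Complex.norm_ofNat, mul_one]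
      rw [← div_eq_mul_inv, div_le_div_iff₀ (by positivity) hs]
      have h3 : (1 + 2 * Real.pi * l1 k) ≤ 2 * (2 * Real.pi) * l1 k := by nlinarith
      calc (1 + 2 * Real.pi * l1 k) * s ≤ 2 * (2 * Real.pi) * l1 k * s := by gcongr
        _ = 2 * (2 * Real.pi) * (s * l1 k) := by ring
        _ ≤ 2 * (2 * Real.pi) * |pair k v| := by gcongr
        _ = _ := by ring
    · simp only [invSym, Set.indicator_of_notMem hk, norm_zero, mul_zero]
      positivity
  have hmem : toVF (dispW v hs h) ∈ spA' d r := by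
    refine Summable.of_nonneg_of_le (fun k => ?_) hle hsum.summable
    have h1 := l1_nonneg (toVF (dispW v hs h) k)
    have h2 := l1_nonneg k
    have h3 := Real.pi_pos
    positivity
  exact ⟨hmem, (Summable.tsum_le_tsum hle hmem hsum.summable).trans_eq hsum.tsum_eq⟩

/-- The derivative of the displacement, in terms of the multipliers `∂_j ∂_v⁻¹ 𝕀⁻`. -/
theorem jac_disp {r : ℝ≥0} (hs : 0 < s) (h : Unk d r) {x : Fin d → ℂ} (hx : x ∈ strip d r)
    (w : Fin d → ℂ) (i : Fin d) :
    jac (toVF (dispW v hs h)) x w i = ∑ j, w j * ev x (derW v hs j (h i)) := by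
  have hadm : Adm r x := norm_chr_le_of_mem_strip hx
  rw [jac_apply (nA'_disp_le hs h).1 hx]
  have h1 : ∑ j, w j * ev x (derW v hs j (h i)) = ev x (∑ j, w j • derW v hs j (h i)) := by
    rw [← evL_apply hadm, map_sum]
    simp
  rw [h1, ev]
  refine tsum_congr fun k => ?_
  congr 1
  change _ = coeffL k (∑ j, w j • derW v hs j (h i))
  rw [map_sum, dpair_apply]
  by_cases hk : k ∈ far v s
  · have h2 : (pair k v : ℂ) ≠ 0 := by exact_mod_cast pair_ne_zero_of_mem_far hs hk
    have hpi : (Real.pi : ℂ) ≠ 0 := by exact_mod_cast Real.pi_ne_zero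
    simp only [toVF, dispW, invW, coeff_mult, invSym, Set.indicator_of_mem hk, map_smul,
      coeffL_apply, derW, derSym, smul_eq_mul]
    rw [Finset.mul_sum, Finset.sum_mul]
    refine Finset.sum_congr rfl fun j _ => ?_
    field_simp
  · simp [toVF, dispW, invW, invSym, derW, derSym, hk]

/-- The far part of the fixed point is controlled by the far part of the perturbation. -/
theorem sum_norm_farW_fixed_le {r : ℝ≥0} {f : VF d} (hs : 0 < s) (he : 0 ≤ e) (hν : 0 ≤ ν)
    (hf : f ∈ spA' d (r + ν)) (hfe : nA' (r + ν) f ≤ e) (h1 : 6 * e ≤ s * ν) (h2 : 100 * e ≤ s)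
    {h : Unk d r} (hh : ‖h‖ ≤ 2 * e) (hfix : elimMap v hs f h = h) :
    ∑ i, ‖farW v s (h i)‖ ≤ 2 * nA r (projFar v s f) := by
  have hpi := Real.pi_gt_three
  have hf0 : f ∈ spA d r := spA_mono (by linarith) (spA'_subset_spA _ hf)
  set Z := ∑ i, ‖farW v s (h i)‖ with hZ
  have hZ0 : 0 ≤ Z := Finset.sum_nonneg fun _ _ => norm_nonneg _
  have hproj : ∑ i, ‖farW v s (ofVF hf0 i)‖ = nA r (projFar v s f) := by
    rw [← nA_toVF, ← projFar_toVF]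
    rfl
  have hD : ∀ i, ‖dispW v hs h i - (0 : Fin d → Wiener d r) i‖ ≤ (2 * Real.pi * s)⁻¹ * Z :=
    fun i => by
      rw [Pi.zero_apply, sub_zero, dispW, ← invW_farW]
      refine (norm_invW_le hs _).trans ?_
      gcongr
      exact Finset.single_le_sum (f := fun i => ‖farW v s (h i)‖) (fun _ _ => norm_nonneg _)
        (Finset.mem_univ i)
  have hc : ∑ i, ‖comp f (dispW v hs h) i - ofVF hf0 i‖ ≤ s⁻¹ * e * Z := by
    have h3 := sum_norm_comp_sub_le hf (norm_dispW_le (v := v) hs hh)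
      (w := 0) (fun i => by rw [Pi.zero_apply, norm_zero]; positivity) hD (by positivity)
      (by positivity) (six_pi_mul_le hs h1)
    simp only [comp_zero (spA'_subset_spA _ hf) hν hf0] at h3
    refine h3.trans ?_
    have h4 : (2 * Real.pi * s)⁻¹ ≤ s⁻¹ := by
      gcongr
      nlinarith
    calc _ ≤ s⁻¹ * Z * e := by
          gcongr
          exact nA'_nonneg _ _
      _ = _ := by ring
  have hq : ∑ i, ‖quad v hs h h i‖ ≤ s⁻¹ * Z * (2 * e) := by
    refine (sum_norm_quad_le hs h h).trans ?_
    gcongr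
  have hmain : Z ≤ nA r (projFar v s f) + s⁻¹ * e * Z + s⁻¹ * Z * (2 * e) := by
    have h3 : ∀ i, ‖farW v s (h i)‖ ≤ ‖farW v s (ofVF hf0 i)‖ +
        ‖comp f (dispW v hs h) i - ofVF hf0 i‖ + ‖quad v hs h h i‖ := fun i => by
      have h4 : h i = ofVF hf0 i + (comp f (dispW v hs h) i - ofVF hf0 i) - quad v hs h h i := by
        rw [add_sub_cancel]
        conv_lhs => rw [← hfix]
        rfl
      have h5 : farW v s (h i) = farW v s (ofVF hf0 i) +
          farW v s (comp f (dispW v hs h) i - ofVF hf0 i) - farW v s (quad v hs h h i) := by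
        conv_lhs => rw [h4]
        rw [map_sub, map_add]
      rw [h5]
      refine (norm_sub_le _ _).trans (add_le_add ((norm_add_le _ _).trans ?_) (norm_farW_le _))
      exact add_le_add le_rfl (norm_farW_le _)
    calc Z ≤ _ := Finset.sum_le_sum fun i _ => h3 i
      _ = ∑ i, ‖farW v s (ofVF hf0 i)‖ + ∑ i, ‖comp f (dispW v hs h) i - ofVF hf0 i‖ +
          ∑ i, ‖quad v hs h h i‖ := by rw [Finset.sum_add_distrib, Finset.sum_add_distrib]
      _ ≤ _ := by rw [hproj]; gcongr
  have h5 : s⁻¹ * e ≤ 1 / 100 := by rw [inv_mul_eq_div, div_le_iff₀ hs]; linarith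
  nlinarith

/-- Full elimination of the far from resonance modes. -/
theorem exists_elimination (hs : 0 < s) (hsv : s < l1 v) (hν : 0 < ν) {r : ℝ} (hr : 0 < r)
    {X : VF d} (hX : X ∈ ball' (r + ν) v (eps v s ν)) :
    ∃ u Y : VF d, u ∈ spA' d r ∧ Y ∈ spA d r ∧ IsPullback r u X Y ∧ projFar v s Y = 0 ∧
      nA' r u ≤ 42 / s * nA r (projFar v s X) ∧
      nA r (Y - constVF v) ≤ 2 * nA' (r + ν) (X - constVF v) ∧ (IsRealVF X → IsRealVF u) := by
  lift r to ℝ≥0 using hr.le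
  obtain ⟨hXmem, hXe⟩ := hX
  set f : VF d := X - constVF v with hfdef
  set e := nA' (r + ν) f with hedef
  have hf : f ∈ spA' d (r + ν) := by
    rw [hfdef, sub_eq_add_neg]
    exact spA'_add hXmem (spA'_neg (constVF_mem_spA' _ v))
  have hf1 := spA'_subset_spA _ hf
  have he : 0 ≤ e := nA'_nonneg _ _
  have h1 : 6 * e ≤ s * ν := eps_bound_width hs hν hXe.le
  have h2' : 3000 * e ≤ s := eps_bound_cone hs hsv hXe.le
  have h2 : 100 * e ≤ s := by linarith
  obtain ⟨h, hh, hfix⟩ := exists_elimMap_eq v hs he hf le_rfl h1 h2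
  have hu := norm_dispW_le (v := v) hs hh
  have hM := two_pi_mul_le (ν := ν) hs he h1
  obtain ⟨humem, hule⟩ := nA'_disp_le (v := v) hs h
  have hfar := sum_norm_farW_fixed_le hs he hν.le hf le_rfl h1 h2 hh hfix
  have hu1 : nA' r (toVF (dispW v hs h)) < 1 := by
    refine hule.trans_lt ?_
    have h3 := (sum_norm_farW_le (v := v) (s := s) h).trans hh
    calc 2 / s * ∑ i, ‖farW v s (h i)‖ ≤ 2 / s * (2 * e) := by gcongr
      _ < 1 := by rw [div_mul_eq_mul_div, div_lt_one hs]; linarith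
  refine ⟨toVF (dispW v hs h), constVF v + toVF fun i => resW v s (h i), humem,
    spA_add (constVF_mem_spA _ v) (toVF_mem _), ?_, ?_, ?_, ?_, fun hreal => ?_⟩
  · rw [isPullback_iff humem hu1]
    intro x hx
    have hadm : Adm r x := norm_chr_le_of_mem_strip hx
    have hY : ∀ i, eval (constVF v + toVF fun i => resW v s (h i)) x i =
        v i + ev x (resW v s (h i)) := fun i => by
      rw [eval_add (summable_chr_smul (constVF_mem_spA _ v) hadm)
        (summable_chr_smul (toVF_mem _) hadm), eval_constVF, Pi.add_apply, eval_toVF _ hadm]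
      rfl
    have hU : eval (toVF (dispW v hs h)) x = fun i => ev x (dispW v hs h i) :=
      funext fun i => eval_toVF _ hadm i
    have hXf : X = constVF v + f := by rw [hfdef]; abel
    have hshift := norm_chr_shift_le hu hM hadm
    ext i
    have hX' : eval X (x + eval (toVF (dispW v hs h)) x) i =
        v i + ev x (comp f (dispW v hs h) i) := by
      rw [hU, hXf, eval_add (summable_chr_smul (constVF_mem_spA _ v) hshift)
        (summable_chr_smul hf1 hshift), eval_constVF, Pi.add_apply,
        eval_apply (summable_chr_smul hf1 hshift), ev_comp hf1 hu hM hadm]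
      rfl
    have hfix_i : ev x (h i) = ev x (comp f (dispW v hs h) i) -
        ∑ j, ev x (derW v hs j (h i)) * ev x (resW v s (h j)) := by
      conv_lhs => rw [← hfix]
      change ev x (comp f (dispW v hs h) i - quad v hs h h i) = _
      rw [quad, ← evL_apply hadm, map_sub, map_sum]
      simp only [evL_apply, ev_mul hadm]
    have hdec : ev x (h i) = ev x (resW v s (h i)) +
        ∑ j, (v j : ℂ) * ev x (derW v hs j (h i)) := by
      conv_lhs => rw [← resW_add_sum_derW (v := v) hs (h i)]
      rw [← evL_apply hadm, map_add, map_sum]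
      simp only [map_smul, evL_apply, smul_eq_mul]
    rw [Pi.add_apply, hX', jac_disp hs h hx]
    simp only [hY, add_mul, Finset.sum_add_distrib]
    have hcomm : ∑ j, ev x (derW v hs j (h i)) * ev x (resW v s (h j)) =
        ∑ j, ev x (resW v s (h j)) * ev x (derW v hs j (h i)) :=
      Finset.sum_congr rfl fun j _ => mul_comm _ _
    rw [hcomm] at hfix_i
    linear_combination hfix_i - hdec
  · funext k
    by_cases hk : k ∈ far v s
    · have hk0 : k ≠ 0 := fun h => zero_notMem_far (h ▸ hk)
      ext i
      simp [projFar, hk, constVF, Pi.single_eq_of_ne hk0, toVF, resW, resSym]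
    · simp [projFar, hk]
  · rw [← projFar_sub_constVF]
    calc _ ≤ 2 / s * (2 * nA r (projFar v s f)) := hule.trans (by gcongr)
      _ = 4 / s * nA r (projFar v s f) := by ring
      _ ≤ _ := by
        have := nA_nonneg r (projFar v s f)
        gcongr
        norm_num
  · rw [add_sub_cancel_left, nA_toVF]
    refine le_trans ?_ hh
    rw [PiLp.norm_eq_of_L1]
    exact Finset.sum_le_sum fun i _ => norm_resW_le _
  · have hX0 : X ∈ spA d (r + ν) := spA'_subset_spA _ hXmem
    have hsym : ∀ k i, f (-k) i = (starRingEnd ℂ) (f k i) := fun k i => by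
      rw [hfdef, Pi.sub_apply, Pi.sub_apply, Pi.sub_apply, Pi.sub_apply,
        hreal.coeff_neg (by positivity) hX0, constVF_coeff_neg, map_sub]
    have hconj := conjUnk_eq_of_elimMap_eq hs he hf le_rfl h1 h2 hh hfix hsym
    intro x i
    have hev := ev_conj x (dispW v hs h i)
    have hd : conj (dispW v hs h i) = dispW v hs h i := by
      conv_rhs => rw [← hconj]
      exact (invW_conj hs _).symm
    rw [hd] at hev
    change (eval (toVF (dispW v hs h)) (realPt x) i).im = 0
    rw [eval_toVF _ (adm_realPt x)]
    exact Complex.conj_eq_iff_im.1 hev.symm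

theorem exists_isUniformization (hs : 0 < s) (hsv : s < l1 v) (hν : 0 < ν) {r : ℝ} (hr : 0 < r) :
    ∃ disp elim : VF d → VF d, IsUniformization v s r ν disp elim := by
  have h : ∀ X : VF d, ∃ u Y : VF d, X ∈ ball' (r + ν) v (eps v s ν) →
      u ∈ spA' d r ∧ Y ∈ spA d r ∧ IsPullback r u X Y ∧ projFar v s Y = 0 ∧
      nA' r u ≤ 42 / s * nA r (projFar v s X) ∧
      nA r (Y - constVF v) ≤ 2 * nA' (r + ν) (X - constVF v) ∧ (IsRealVF X → IsRealVF u) := by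
    intro X
    by_cases hX : X ∈ ball' (r + ν) v (eps v s ν)
    · obtain ⟨u, Y, h⟩ := exists_elimination hs hsv hν hr hX
      exact ⟨u, Y, fun _ => h⟩
    · exact ⟨0, 0, fun h => absurd h hX⟩
  choose disp elim h using h
  exact ⟨disp, elim, fun X hX => (h X hX).1, fun X hX => (h X hX).2.1,
    fun X hX => (h X hX).2.2.1, fun X hX => (h X hX).2.2.2.1, fun X hX => (h X hX).2.2.2.2.1,
    fun X hX => (h X hX).2.2.2.2.2.1, fun X hX => (h X hX).2.2.2.2.2.2⟩

end Elimination

/-! ### Rotation vectors along the renormalization -/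

section Rotation

variable {d : ℕ}

/-- `w` is a limit of mean velocities of longer and longer orbit segments of `V` (a point of the
rotation set). Unlike `HasRot` this is invariant under time reversal, and so it is preserved by
the rescaling of time by a factor of either sign. -/
def HasApproxRot (V : (Fin d → ℝ) → (Fin d → ℝ)) (w : Fin d → ℝ) : Prop :=
  ∀ ε > 0, ∀ N : ℝ, ∃ T, N < T ∧ 0 < T ∧ ∃ γ : ℝ → Fin d → ℝ,
    (∀ t, HasDerivAt γ (V (γ t)) t) ∧ ‖T⁻¹ • (γ T - γ 0) - w‖ ≤ ε

theorem HasRot.hasApproxRot {V : (Fin d → ℝ) → (Fin d → ℝ)} {w : Fin d → ℝ} (h : HasRot V w) :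
    HasApproxRot V w := by
  obtain ⟨Φ, hΦ, hlim⟩ := h
  intro ε hε N
  have h1 := (Metric.tendsto_atTop'.1 (hlim 0)) ε hε
  obtain ⟨T₀, hT₀⟩ := h1
  refine ⟨max N (max T₀ 0) + 1, ?_, ?_, fun t => Φ t 0, fun t => hΦ 0 t, ?_⟩
  · linarith [le_max_left N (max T₀ 0)]
  · linarith [le_max_right N (max T₀ 0), le_max_right T₀ 0]
  · have := hT₀ (max N (max T₀ 0) + 1)
      (by linarith [le_max_right N (max T₀ 0), le_max_left T₀ 0])
    rw [dist_eq_norm] at this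
    beta_reduce
    rw [Flow.map_zero_apply]
    exact this.le

/-- Mean velocities are averages of the field. -/
theorem HasApproxRot.abs_sub_le {V : (Fin d → ℝ) → (Fin d → ℝ)} {w c : Fin d → ℝ}
    (h : HasApproxRot V w) {M : ℝ} (i : Fin d) (hM : ∀ x, |V x i - c i| ≤ M) :
    |w i - c i| ≤ M := by
  refine le_of_forall_pos_le_add fun ε hε => ?_
  obtain ⟨T, -, hT, γ, hγ, hle⟩ := h ε hε 0
  have h1 : ∀ t, HasDerivAt (fun t => γ t i - c i * t) (V (γ t) i - c i) t := fun t => by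
    have := (hasDerivAt_pi.1 (hγ t) i).fun_sub ((hasDerivAt_id t).const_mul (c i))
    simpa using this
  have h2 := (convex_univ (𝕜 := ℝ) (E := ℝ)).norm_image_sub_le_of_norm_hasDerivWithin_le
    (fun t _ => (h1 t).hasDerivWithinAt) (fun t _ => hM (γ t)) (Set.mem_univ 0) (Set.mem_univ T)
  have h3 := (norm_le_pi_norm _ i).trans hle
  simp only [Pi.sub_apply, Pi.smul_apply, smul_eq_mul, Real.norm_eq_abs, sub_zero, mul_zero,
    abs_of_pos hT] at h2 h3
  have h4 : |T⁻¹ * (γ T i - γ 0 i) - c i| ≤ M := by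
    have : T⁻¹ * (γ T i - γ 0 i) - c i = T⁻¹ * (γ T i - c i * T - γ 0 i) := by
      field_simp
      ring
    rw [this, abs_mul, abs_of_pos (inv_pos.2 hT), inv_mul_le_iff₀ hT]
    linarith
  rw [abs_le] at h3 h4 ⊢
  constructor <;> linarith [h3.1, h3.2, h4.1, h4.2]

theorem HasApproxRot.linear {V V' : (Fin d → ℝ) → (Fin d → ℝ)} {w : Fin d → ℝ}
    (h : HasApproxRot V w) {η : ℝ} (hη : η ≠ 0) (M : (Fin d → ℝ) →L[ℝ] (Fin d → ℝ))
    (hV : ∀ x, V' (M x) = η • M (V x)) : HasApproxRot V' (η • M w) := by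
  intro ε hε N
  have hη' := abs_pos.2 hη
  obtain ⟨T, hNT, hT, γ, hγ, hle⟩ := h (ε / (|η| * (‖M‖ + 1))) (by positivity) (N * |η|)
  have hcurve : ∀ a t, HasDerivAt (fun t => M (γ (η * t + a))) (V' (M (γ (η * t + a)))) t :=
    fun a t => by
      have h1 : HasDerivAt (fun t => η * t + a) η t := by
        simpa using ((hasDerivAt_id t).const_mul η).add_const a
      have h2 := M.hasFDerivAt.comp_hasDerivAt t ((hγ (η * t + a)).scomp t h1)
      rw [hV, ← map_smul]
      exact h2
  have hfinal : ‖η • M (T⁻¹ • (γ T - γ 0)) - η • M w‖ ≤ ε := by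
    rw [← smul_sub, ← map_sub, norm_smul, Real.norm_eq_abs]
    calc |η| * ‖M (T⁻¹ • (γ T - γ 0) - w)‖ ≤
          |η| * ((‖M‖ + 1) * (ε / (|η| * (‖M‖ + 1)))) := by
          gcongr
          refine (M.le_opNorm _).trans ?_
          gcongr
          linarith
      _ = ε := by field_simp
  refine ⟨T / |η|, (lt_div_iff₀ hη').2 hNT, by positivity, ?_⟩
  rcases lt_or_gt_of_ne hη with hneg | hpos
  · -- For a negative factor the orbit segment is run backwards.
    refine ⟨fun t => M (γ (η * t + T)), hcurve T, ?_⟩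
    have h1 : η * (T / |η|) + T = 0 := by rw [abs_of_neg hneg]; field_simp; ring
    have h2 : (T / |η|)⁻¹ • (M (γ 0) - M (γ T)) = η • M (T⁻¹ • (γ T - γ 0)) := by
      rw [map_smul, map_sub, smul_smul, ← neg_sub (M (γ T)), smul_neg, ← neg_smul,
        abs_of_neg hneg, inv_div]
      congr 1
      ring
    simp only [h1, mul_zero, zero_add, h2]
    exact hfinal
  · refine ⟨fun t => M (γ (η * t + 0)), hcurve 0, ?_⟩
    have h1 : η * (T / |η|) + 0 = T := by rw [abs_of_pos hpos]; field_simp; ring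
    have h2 : (T / |η|)⁻¹ • (M (γ T) - M (γ 0)) = η • M (T⁻¹ • (γ T - γ 0)) := by
      rw [map_smul, map_sub, smul_smul, abs_of_pos hpos, inv_div]
      congr 1
    beta_reduce
    rw [h1, mul_zero, add_zero, h2]
    exact hfinal

theorem norm_eval_realPt_le {r : ℝ} (hr : 0 ≤ r) {f : VF d} (hf : f ∈ spA d r) (x : Fin d → ℝ) :
    ‖eval f (realPt x)‖ ≤ nA r f := by
  refine tsum_of_norm_bounded (Summable.hasSum hf) fun k => ?_
  change ‖chr k (realPt x) • f k‖ ≤ _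
  rw [norm_smul, norm_chr_realPt, one_mul]
  refine (norm_le_l1 _).trans (le_mul_of_one_le_right (l1_nonneg _) (Real.one_le_exp ?_))
  exact mul_nonneg hr (l1_nonneg k)

theorem norm_onReal_le {r : ℝ} (hr : 0 ≤ r) {f : VF d} (hf : f ∈ spA d r) (x : Fin d → ℝ) :
    ‖onReal f x‖ ≤ nA r f :=
  (norm_rePtL_le _).trans (norm_eval_realPt_le hr hf x)

theorem realPt_injective : Function.Injective (realPt (d := d)) := fun x y h => by
  rw [← rePtL_realPt x, h, rePtL_realPt]

theorem realPt_add (x y : Fin d → ℝ) : realPt (x + y) = realPt x + realPt y :=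
  map_add (realPtL d) x y

section Pullback

variable {r : ℝ} {u X Y : VF d}

theorem realPt_realShift (hreal : IsRealVF u) (x : Fin d → ℝ) :
    realPt (realShift u x) = realPt x + eval u (realPt x) := by
  rw [realShift, realPt_add, hreal.realPt_onReal]

/-- The derivative of `id + u` is invertible at real points. -/
theorem exists_equiv_id_add_realJac (hr : 0 < r) (hu : u ∈ spA' d r) (h1 : nA' r u < 1)
    (x : Fin d → ℝ) : ∃ A : (Fin d → ℝ) ≃L[ℝ] (Fin d → ℝ),
      (A : (Fin d → ℝ) →L[ℝ] (Fin d → ℝ)) = ContinuousLinearMap.id ℝ _ + realJac u x :=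
  isInvertible_id_add ((norm_realJac_le hr hu x).trans_lt h1)

/-- The pullback of a real field under a real change of variables is real. -/
theorem IsPullback.isRealVF (hr : 0 < r) (hu : u ∈ spA' d r) (h1 : nA' r u < 1)
    (hureal : IsRealVF u) (hX : IsRealVF X) (h : IsPullback r u X Y) : IsRealVF Y := by
  intro x
  have hp := (isPullback_iff hu h1).1 h (realPt x) (realPt_mem_strip hr x)
  rw [← realPt_realShift hureal, ← hX.realPt_onReal] at hp
  set y := eval Y (realPt x) with hy
  let a : Fin d → ℝ := fun i => (y i).re
  let b : Fin d → ℝ := fun i => (y i).im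
  have hdec : y = realPt a + Complex.I • realPt b := by
    ext i
    simp only [Pi.add_apply, Pi.smul_apply, realPt, smul_eq_mul, a, b]
    rw [mul_comm, Complex.re_add_im]
  rw [hdec, map_add, map_smul, ← realPt_realJac hr hu hureal, ← realPt_realJac hr hu hureal] at hp
  have hb : b + realJac u x b = 0 := by
    ext i
    have := congrArg Complex.im (congrFun hp i)
    simpa [realPt] using this
  obtain ⟨A, hA⟩ := exists_equiv_id_add_realJac hr hu h1 x
  have hAb : A b = 0 := by
    have : (A : (Fin d → ℝ) →L[ℝ] (Fin d → ℝ)) b = 0 := by rw [hA]; exact hb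
    exact this
  have hb0 : b = 0 := by simpa using hAb
  intro i
  exact congrFun hb0 i

theorem IsPullback.onReal_eq (hr : 0 < r) (hu : u ∈ spA' d r) (h1 : nA' r u < 1)
    (hureal : IsRealVF u) (hX : IsRealVF X) (h : IsPullback r u X Y) (x : Fin d → ℝ) :
    onReal Y x + realJac u x (onReal Y x) = onReal X (realShift u x) := by
  have hY := h.isRealVF hr hu h1 hureal hX
  have hp := (isPullback_iff hu h1).1 h (realPt x) (realPt_mem_strip hr x)
  rw [← realPt_realShift hureal, ← hX.realPt_onReal, ← hY.realPt_onReal,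
    ← realPt_realJac hr hu hureal, ← realPt_add] at hp
  exact realPt_injective hp

/-- Conjugation by a bounded displacement does not change mean velocities. -/
theorem IsPullback.hasApproxRot (hr : 0 < r) (hu : u ∈ spA' d r) (h1 : nA' r u < 1)
    (hureal : IsRealVF u) (hX : IsRealVF X) (h : IsPullback r u X Y) {w : Fin d → ℝ}
    (hrot : HasApproxRot (onReal X) w) : HasApproxRot (onReal Y) w := by
  obtain ⟨e, he⟩ := exists_homeomorph_realShift hr hu h1
  intro ε hε N
  obtain ⟨T, hNT, hT, γ, hγ, hle⟩ := hrot (ε / 2) (half_pos hε) (max N (4 / ε))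
  refine ⟨T, (le_max_left _ _).trans_lt hNT, hT, fun t => e.symm (γ t), fun t => ?_, ?_⟩
  · set x := e.symm (γ t) with hx
    have hex : realShift u x = γ t := by rw [← he, hx, e.apply_symm_apply]
    obtain ⟨A, hA⟩ := exists_equiv_id_add_realJac hr hu h1 x
    have hd : HasFDerivAt e (A : (Fin d → ℝ) →L[ℝ] (Fin d → ℝ)) (e.symm (γ t)) := by
      rw [hA, he]
      exact (hasFDerivAt_id x).add (hasFDerivAt_onReal hr hu x)
    have hsymm := HasFDerivAt.of_local_left_inverse (g := e.symm) e.symm.continuous.continuousAt hd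
      (Eventually.of_forall e.apply_symm_apply)
    have hcomp := hsymm.comp_hasDerivAt t (hγ t)
    have hval : A (onReal Y x) = onReal X (γ t) := by
      rw [← hex, ← h.onReal_eq hr hu h1 hureal hX x]
      change (A : (Fin d → ℝ) →L[ℝ] (Fin d → ℝ)) (onReal Y x) = _
      rw [hA]
      rfl
    rw [← hval] at hcomp
    simpa [Function.comp_def] using hcomp
  · have hbound : ∀ x, ‖onReal u x‖ ≤ 1 := fun x =>
      (norm_onReal_le hr.le (spA'_subset_spA r hu) x).trans ((nA_le_nA' hu).trans h1.le)
    have hγe : ∀ t, γ t = e.symm (γ t) + onReal u (e.symm (γ t)) := fun t => by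
      conv_lhs => rw [← e.apply_symm_apply (γ t), he]
      rfl
    have hsplit : T⁻¹ • (e.symm (γ T) - e.symm (γ 0)) - w = (T⁻¹ • (γ T - γ 0) - w) -
        T⁻¹ • (onReal u (e.symm (γ T)) - onReal u (e.symm (γ 0))) := by
      have h5 : γ T - γ 0 = (e.symm (γ T) - e.symm (γ 0)) +
          (onReal u (e.symm (γ T)) - onReal u (e.symm (γ 0))) := by
        rw [← add_sub_add_comm, ← hγe T, ← hγe 0]
      rw [h5, smul_add]
      abel
    have h4 : T⁻¹ * 2 ≤ ε / 2 := by
      have : 4 / ε < T := (le_max_right _ _).trans_lt hNT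
      rw [div_lt_iff₀ hε] at this
      rw [inv_mul_le_iff₀ hT]
      linarith
    rw [hsplit]
    refine (norm_sub_le _ _).trans ?_
    rw [norm_smul, norm_inv, Real.norm_of_nonneg hT.le]
    have h5 : ‖onReal u (e.symm (γ T)) - onReal u (e.symm (γ 0))‖ ≤ 2 :=
      (norm_sub_le _ _).trans (by linarith [hbound (e.symm (γ T)), hbound (e.symm (γ 0))])
    have h6 : T⁻¹ * ‖onReal u (e.symm (γ T)) - onReal u (e.symm (γ 0))‖ ≤ T⁻¹ * 2 := by gcongr
    linarith

end Pullback

/-! ### Rescaling -/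

/-- Multiplication by an integer matrix on `ℝᵈ`. -/
def realMat (T : SL(d, ℤ)) : (Fin d → ℝ) →L[ℝ] (Fin d → ℝ) :=
  LinearMap.toContinuousLinearMap
    (Matrix.toLin' ((T : Matrix (Fin d) (Fin d) ℤ).map (Int.cast : ℤ → ℝ)))

theorem realMat_apply (T : SL(d, ℤ)) (x : Fin d → ℝ) (i : Fin d) :
    realMat T x i = ∑ j, ((T : Matrix (Fin d) (Fin d) ℤ) i j : ℝ) * x j := by
  simp [realMat, Matrix.mulVec, dotProduct]

theorem realMat_mul (S T : SL(d, ℤ)) (x : Fin d → ℝ) :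
    realMat (S * T) x = realMat S (realMat T x) := by
  have h : ((S * T : SL(d, ℤ)) : Matrix (Fin d) (Fin d) ℤ).map (Int.cast : ℤ → ℝ) =
      (S : Matrix (Fin d) (Fin d) ℤ).map (Int.cast : ℤ → ℝ) *
        (T : Matrix (Fin d) (Fin d) ℤ).map (Int.cast : ℤ → ℝ) := by
    rw [Matrix.SpecialLinearGroup.coe_mul]
    exact Matrix.map_mul (f := Int.castRingHom ℝ)
  simp only [realMat, LinearMap.coe_toContinuousLinearMap', Matrix.toLin'_apply, h,
    Matrix.mulVec_mulVec]

theorem realMat_one (x : Fin d → ℝ) : realMat (1 : SL(d, ℤ)) x = x := by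
  simp [realMat]

theorem eval_rescale_realPt {r : ℝ} (hr : 0 ≤ r) {Y : VF d} (hY : Y ∈ spA d r)
    (hreal : IsRealVF Y) (η : ℝ) (T : SL(d, ℤ)) (x : Fin d → ℝ) :
    eval (rescale η T Y) (realPt (realMat T x)) = realPt (η • realMat T (onReal Y x)) := by
  have hcast : ∀ z : Fin d → ℝ, realPt (realMat T z) =
      (T : Matrix (Fin d) (Fin d) ℤ).map (Int.cast : ℤ → ℂ) *ᵥ realPt z := fun z => by
    ext i
    simp [realPt, realMat_apply, Matrix.mulVec, dotProduct]
  have hs : Summable fun k => chr k (realPt x) • Y k :=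
    summable_chr_smul (spA_mono hr hY) fun k => by simp
  rw [hcast, eval_rescale η T Y (realPt x) hs, ← hreal.realPt_onReal, ← hcast]
  ext i
  simp [realPt]

theorem isRealVF_rescale {r : ℝ} (hr : 0 ≤ r) {Y : VF d} (hY : Y ∈ spA d r)
    (hreal : IsRealVF Y) (η : ℝ) (T : SL(d, ℤ)) : IsRealVF (rescale η T Y) := by
  intro x i
  have h := eval_rescale_realPt hr hY hreal η T (realMat T⁻¹ x)
  rw [← realMat_mul, mul_inv_cancel, realMat_one] at h
  change (eval (rescale η T Y) (realPt x) i).im = 0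
  rw [h]
  simp [realPt]

theorem hasApproxRot_rescale {r : ℝ} (hr : 0 ≤ r) {Y : VF d} (hY : Y ∈ spA d r)
    (hreal : IsRealVF Y) {η : ℝ} (hη : η ≠ 0) (T : SL(d, ℤ)) {w : Fin d → ℝ}
    (hrot : HasApproxRot (onReal Y) w) :
    HasApproxRot (onReal (rescale η T Y)) (η • realMat T w) := by
  refine hrot.linear hη (realMat T) fun x => realPt_injective ?_
  rw [(isRealVF_rescale hr hY hreal η T).realPt_onReal, eval_rescale_realPt hr hY hreal]

/-! ### The mean value of a field with given rotation vector -/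

theorem nonConst_mem_spA' {r : ℝ} {X : VF d} (hX : X ∈ spA' d r) : nonConst X ∈ spA' d r := by
  refine Summable.of_nonneg_of_le (fun k => ?_) (fun k => ?_) hX
  · have h1 := l1_nonneg (nonConst X k)
    have h2 := l1_nonneg k
    have h3 := Real.pi_pos
    positivity
  · have h1 := l1_nonneg (X k)
    have h2 := l1_nonneg k
    have h3 := Real.pi_pos
    by_cases hk : k = 0
    · subst hk
      simp [nonConst, h1]
    · simp [nonConst, hk]

theorem nonConst_mem_spA {r : ℝ} {X : VF d} (hX : X ∈ spA d r) : nonConst X ∈ spA d r := by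
  refine Summable.of_nonneg_of_le (fun k => mul_nonneg (l1_nonneg _) (Real.exp_pos _).le)
    (fun k => ?_) hX
  by_cases hk : k = 0
  · subst hk
    simp [nonConst, l1_nonneg]
  · simp [nonConst, hk]

/-- A real field with rotation vector `w` has mean value close to `w`, so its distance to `w` is
controlled by its non-constant part. -/
theorem nA'_sub_constVF_le {r : ℝ} (hr : 0 ≤ r) {X : VF d} (hX : X ∈ spA' d r)
    (hreal : IsRealVF X) {w : Fin d → ℝ} (hrot : HasApproxRot (onReal X) w) :
    nA' r (X - constVF w) ≤ ((d : ℝ) + 1) * nA' r (nonConst X) := by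
  have hXs := spA'_subset_spA r hX
  have hn := nonConst_mem_spA' hX
  have hns := spA'_subset_spA r hn
  have hre : ∀ i, X 0 i = ((X 0 i).re : ℂ) := fun i => by
    have := hreal.coeff_neg hr hXs 0 i
    rw [neg_zero] at this
    exact (Complex.conj_eq_iff_re.1 this.symm).symm
  have hdec : X = constVF (fun i => (X 0 i).re) + nonConst X := by
    funext k
    by_cases hk : k = 0
    · subst hk
      ext i
      simp [constVF, nonConst, ← hre]
    · simp [constVF, nonConst, hk]
  have hmean : ∀ i, |w i - (X 0 i).re| ≤ nA' r (nonConst X) := fun i => by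
    refine hrot.abs_sub_le (c := fun i => (X 0 i).re) i fun x => ?_
    have h1 : onReal X x i - (X 0 i).re = onReal (nonConst X) x i := by
      have hc : ∀ k, ‖chr k (realPt x)‖ ≤ Real.exp (r * l1 k) := fun k => by
        rw [norm_chr_realPt]
        exact Real.one_le_exp (mul_nonneg hr (l1_nonneg k))
      have h2 := eval_add (summable_chr_smul (constVF_mem_spA r fun i => (X 0 i).re) hc)
        (summable_chr_smul hns hc)
      rw [← hdec, eval_constVF] at h2
      have h3 := congrArg Complex.re (congrFun h2 i)
      simp only [Pi.add_apply, Complex.add_re] at h3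
      change (eval X (realPt x) i).re - _ = (eval (nonConst X) (realPt x) i).re
      rw [h3]
      simp [realPt]
    rw [h1]
    exact (norm_le_pi_norm (onReal (nonConst X) x) i).trans
      ((norm_onReal_le hr hns x).trans (nA_le_nA' hn))
  have hl1 : l1 (X 0 - fun i => (w i : ℂ)) ≤ d * nA' r (nonConst X) := by
    have : ∀ i, ‖(X 0 - fun i => (w i : ℂ)) i‖ ≤ nA' r (nonConst X) := fun i => by
      rw [Pi.sub_apply, hre i, ← Complex.ofReal_sub, Complex.norm_real, Real.norm_eq_abs,
        abs_sub_comm]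
      exact hmean i
    calc _ ≤ ∑ _i : Fin d, nA' r (nonConst X) := Finset.sum_le_sum fun i _ => this i
      _ = _ := by simp
  have hsum : HasSum (fun k => (1 + 2 * Real.pi * l1 k) * l1 ((X - constVF w) k) *
      Real.exp (r * l1 k)) (l1 (X 0 - fun i => (w i : ℂ)) + nA' r (nonConst X)) := by
    have h1 := (hasSum_ite_eq (0 : Fin d → ℤ) (l1 (X 0 - fun i => (w i : ℂ)))).add
      (Summable.hasSum hn)
    refine h1.congr_fun ?_
    intro k
    by_cases hk : k = 0
    · subst hk
      simp [nonConst, constVF]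
    · simp [nonConst, constVF, hk]
  refine hsum.tsum_eq.trans_le ?_
  linarith

end Rotation

/-! ### Norm estimates for the rescaling operators -/

section Rescaling

variable {d : ℕ}

/-- The action `j ↦ ᵗT j` on the modes. -/
def modeEquiv (T : SL(d, ℤ)) : (Fin d → ℤ) ≃ (Fin d → ℤ) where
  toFun j := (T : Matrix (Fin d) (Fin d) ℤ)ᵀ *ᵥ j
  invFun j := ((T⁻¹ : SL(d, ℤ)) : Matrix (Fin d) (Fin d) ℤ)ᵀ *ᵥ j
  left_inv j := by
    simp only [Matrix.mulVec_mulVec, ← Matrix.transpose_mul, ← Matrix.SpecialLinearGroup.coe_mul]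
    simp
  right_inv j := by
    simp only [Matrix.mulVec_mulVec, ← Matrix.transpose_mul, ← Matrix.SpecialLinearGroup.coe_mul]
    simp

theorem modeEquiv_zero (T : SL(d, ℤ)) : modeEquiv T 0 = 0 :=
  Matrix.mulVec_zero (T : Matrix (Fin d) (Fin d) ℤ)ᵀ

theorem modeEquiv_eq_zero {T : SL(d, ℤ)} {j : Fin d → ℤ} : modeEquiv T j = 0 ↔ j = 0 := by
  rw [← (modeEquiv T).apply_eq_iff_eq (x := j), modeEquiv_zero]

theorem rescale_apply (η : ℝ) (T : SL(d, ℤ)) (X : VF d) (j : Fin d → ℤ) :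
    rescale η T X j = (η : ℂ) • ((T : Matrix (Fin d) (Fin d) ℤ).map (Int.cast : ℤ → ℂ) *ᵥ
      X (modeEquiv T j)) := rfl

theorem rescale_smul (η : ℝ) (T : SL(d, ℤ)) (c : ℂ) (X : VF d) :
    rescale η T (c • X) = c • rescale η T X := by
  funext j
  rw [Pi.smul_apply, rescale_apply, rescale_apply, Pi.smul_apply, Matrix.mulVec_smul, smul_comm]

theorem nonConst_rescale (η : ℝ) (T : SL(d, ℤ)) (X : VF d) :
    nonConst (rescale η T X) = rescale η T (nonConst X) := by
  funext j
  by_cases hj : j = 0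
  · subst hj
    simp [nonConst, rescale_apply, modeEquiv_zero]
  · have h : modeEquiv T j ≠ 0 := fun h => hj (modeEquiv_eq_zero.1 h)
    simp [nonConst, rescale_apply, hj, h]

/-- A matrix is a bounded operator for the `ℓ¹`-norm. -/
theorem l1_mulVec_le {K : Type*} [NormedCommRing K] (M : Matrix (Fin d) (Fin d) K)
    (x : Fin d → K) : l1 (M *ᵥ x) ≤ (∑ i, ∑ j, ‖M i j‖) * l1 x := by
  rw [l1, Finset.sum_mul]
  refine Finset.sum_le_sum fun i _ => ?_
  rw [Finset.sum_mul]
  change ‖∑ j, M i j * x j‖ ≤ _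
  refine norm_sum_le_of_le _ fun j _ => (norm_mul_le _ _).trans ?_
  gcongr
  exact norm_apply_le_l1 x j

theorem l1_rescale_le (η : ℝ) (T : SL(d, ℤ)) : ∃ C, 0 ≤ C ∧ ∀ (X : VF d) (j : Fin d → ℤ),
    l1 (rescale η T X j) ≤ C * l1 (X (modeEquiv T j)) := by
  refine ⟨|η| * ∑ i, ∑ j, ‖(T : Matrix (Fin d) (Fin d) ℤ).map (Int.cast : ℤ → ℂ) i j‖,
    by positivity, fun X j => ?_⟩
  rw [rescale_apply, l1_smul, Complex.norm_real, Real.norm_eq_abs, mul_assoc]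
  exact mul_le_mul_of_nonneg_left (l1_mulVec_le _ _) (abs_nonneg η)

theorem mul_exp_neg_le {δ : ℝ} (hδ : 0 < δ) {t : ℝ} (ht : 0 ≤ t) :
    (1 + 2 * Real.pi * t) * Real.exp (-δ * t) ≤ 1 + 2 * Real.pi / δ := by
  have hpi := Real.pi_pos
  have h1 : Real.exp (-δ * t) ≤ 1 := Real.exp_le_one_iff.2 (by nlinarith)
  have h2 : δ * t * Real.exp (-δ * t) ≤ 1 := by
    rw [neg_mul, Real.exp_neg, ← div_eq_mul_inv, div_le_one (Real.exp_pos _)]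
    linarith [Real.add_one_le_exp (δ * t)]
  calc (1 + 2 * Real.pi * t) * Real.exp (-δ * t) =
        Real.exp (-δ * t) + 2 * Real.pi / δ * (δ * t * Real.exp (-δ * t)) := by field_simp
    _ ≤ 1 + 2 * Real.pi / δ * 1 := by gcongr
    _ = _ := by ring

variable {v : Fin d → ℝ} {s r δ a η : ℝ} {T : SL(d, ℤ)}

theorem mem_res_of_ne_zero {f : VF d} (hf : projFar v s f = 0) {k : Fin d → ℤ} (hk : f k ≠ 0) :
    k ∈ res v s := by
  by_contra h
  have hfar : k ∈ far v s := not_le.1 (show ¬ |pair k v| ≤ s * l1 k from h)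
  exact hk (by simpa [projFar, hfar] using congrFun hf k)

/-- The rescaling is bounded from the resonant modes into a space of more regular fields, since it
contracts the resonant modes by the factor `a` up to the loss `δ` of strip width. -/
theorem rescale_bounded (hr : 0 ≤ r) (hδ : 0 < δ) (ha : 0 < a)
    (hcone : ∀ k ∈ res v s, l1 ((modeEquiv T).symm k) ≤ a * l1 k) :
    ∃ C, 0 ≤ C ∧ ∀ f : VF d, f ∈ spA d r → projFar v s f = 0 →
      rescale η T f ∈ spA' d (r / a - δ) ∧ nA' (r / a - δ) (rescale η T f) ≤ C * nA r f := by
  obtain ⟨C, hC, hCle⟩ := l1_rescale_le η T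
  have hpi := Real.pi_pos
  refine ⟨C * (1 + 2 * Real.pi / δ), by positivity, fun f hf hfar => ?_⟩
  have hterm : ∀ j, (1 + 2 * Real.pi * l1 j) * l1 (rescale η T f j) *
      Real.exp ((r / a - δ) * l1 j) ≤ C * (1 + 2 * Real.pi / δ) *
        (l1 (f (modeEquiv T j)) * Real.exp (r * l1 (modeEquiv T j))) := fun j => by
    set k := modeEquiv T j with hk
    have hjn := l1_nonneg j
    by_cases hfk : f k = 0
    · have h0 : rescale η T f j = 0 := by rw [rescale_apply, ← hk, hfk]; simp
      simp [h0, hfk]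
    · have h1 := hcone k (mem_res_of_ne_zero hfar hfk)
      rw [hk, Equiv.symm_apply_apply] at h1
      have h2 : Real.exp ((r / a - δ) * l1 j) ≤ Real.exp (-δ * l1 j) * Real.exp (r * l1 k) := by
        rw [← Real.exp_add]
        apply Real.exp_le_exp.2
        have : r / a * l1 j ≤ r / a * (a * l1 k) := by gcongr
        have h3 : r / a * (a * l1 k) = r * l1 k := by field_simp
        linarith
      have hfn := l1_nonneg (f k)
      calc _ ≤ (1 + 2 * Real.pi * l1 j) * (C * l1 (f k)) *
            (Real.exp (-δ * l1 j) * Real.exp (r * l1 k)) := by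
            gcongr
            exact hCle f j
        _ = C * ((1 + 2 * Real.pi * l1 j) * Real.exp (-δ * l1 j)) *
            (l1 (f k) * Real.exp (r * l1 k)) := by ring
        _ ≤ _ := by
            gcongr
            exact mul_exp_neg_le hδ hjn
  have hsum : HasSum (fun j => C * (1 + 2 * Real.pi / δ) *
      (l1 (f (modeEquiv T j)) * Real.exp (r * l1 (modeEquiv T j))))
      (C * (1 + 2 * Real.pi / δ) * nA r f) :=
    ((modeEquiv T).hasSum_iff.2 (Summable.hasSum hf)).mul_left _
  have hmem : rescale η T f ∈ spA' d (r / a - δ) :=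
    Summable.of_nonneg_of_le (fun j => by
      have h1 := l1_nonneg (rescale η T f j)
      have h2 := l1_nonneg j
      positivity) hterm hsum.summable
  exact ⟨hmem, (Summable.tsum_le_tsum hterm hmem hsum.summable).trans_eq hsum.tsum_eq⟩

theorem nA_smul (r : ℝ) (c : ℂ) (f : VF d) : nA r (c • f) = ‖c‖ * nA r f := by
  rw [nA, nA, ← tsum_mul_left]
  exact tsum_congr fun k => by rw [Pi.smul_apply, l1_smul, mul_assoc]

theorem nA'_smul (r : ℝ) (c : ℂ) (f : VF d) : nA' r (c • f) = ‖c‖ * nA' r f := by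
  rw [nA', nA', ← tsum_mul_left]
  exact tsum_congr fun k => by rw [Pi.smul_apply, l1_smul]; ring

theorem spA_smul {r : ℝ} (c : ℂ) {f : VF d} (hf : f ∈ spA d r) : c • f ∈ spA d r := by
  refine (Summable.mul_left ‖c‖ hf).congr fun k => ?_
  rw [Pi.smul_apply, l1_smul, mul_assoc]

theorem opNorm_nonneg (v : Fin d → ℝ) (s r r' η : ℝ) (T : SL(d, ℤ)) :
    0 ≤ opNorm v s r r' η T :=
  Real.sSup_nonneg fun _ ⟨_, _, _, hy⟩ => hy ▸ nA'_nonneg _ _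

theorem nA'_rescale_le_opNorm (hr : 0 ≤ r) (hδ : 0 < δ) (ha : 0 < a)
    (hcone : ∀ k ∈ res v s, l1 ((modeEquiv T).symm k) ≤ a * l1 k) {f : VF d}
    (hf : f ∈ resNonConst v s r) :
    nA' (r / a - δ) (rescale η T f) ≤ opNorm v s r (r / a - δ) η T * nA r f := by
  obtain ⟨C, hC, hb⟩ := rescale_bounded (η := η) hr hδ ha hcone
  have hbdd : BddAbove {y | ∃ f ∈ resNonConst v s r, nA r f ≤ 1 ∧
      y = nA' (r / a - δ) (rescale η T f)} := by
    refine ⟨C, ?_⟩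
    rintro y ⟨g, hg, hg1, rfl⟩
    exact ((hb g hg.1 hg.2.1).2).trans (mul_le_of_le_one_right hC hg1)
  obtain ⟨hfA, hfar, hf0⟩ := hf
  rcases (nA_nonneg r f).eq_or_lt with h0 | hpos
  · have := (hb f hfA hfar).2
    rw [← h0, mul_zero] at this ⊢
    exact this
  · have hn : ‖(((nA r f)⁻¹ : ℝ) : ℂ)‖ = (nA r f)⁻¹ := by
      rw [Complex.norm_real, Real.norm_of_nonneg (inv_nonneg.2 hpos.le)]
    have hmem : (((nA r f)⁻¹ : ℝ) : ℂ) • f ∈ resNonConst v s r := by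
      refine ⟨spA_smul _ hfA, ?_, by simp [hf0]⟩
      have h1 : projFar v s ((((nA r f)⁻¹ : ℝ) : ℂ) • f) =
          (((nA r f)⁻¹ : ℝ) : ℂ) • projFar v s f :=
        Set.indicator_const_smul (far v s) (((nA r f)⁻¹ : ℝ) : ℂ) f
      rw [h1, hfar, smul_zero]
    have h1 := le_csSup hbdd ⟨_, hmem, by rw [nA_smul, hn, inv_mul_cancel₀ hpos.ne'], rfl⟩
    rw [rescale_smul, nA'_smul, hn, inv_mul_le_iff₀ hpos] at h1
    rw [mul_comm]
    exact h1

/-- Narrowing the strip by `log φ` divides the norm of the non-constant part by `φ`. -/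
theorem nA'_cutoff {r φ : ℝ} (hφ : 1 ≤ φ) {g : VF d} (hg : g ∈ spA' d r) (hg0 : g 0 = 0) :
    g ∈ spA' d (r - Real.log φ) ∧ nA' (r - Real.log φ) g ≤ φ⁻¹ * nA' r g := by
  have hφ0 : 0 < φ := zero_lt_one.trans_le hφ
  have hpi := Real.pi_pos
  have hterm : ∀ k, (1 + 2 * Real.pi * l1 k) * l1 (g k) *
      Real.exp ((r - Real.log φ) * l1 k) ≤
      φ⁻¹ * ((1 + 2 * Real.pi * l1 k) * l1 (g k) * Real.exp (r * l1 k)) := fun k => by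
    have h1 := l1_nonneg k
    have h2 := l1_nonneg (g k)
    by_cases hk : k = 0
    · subst hk
      simp [hg0]
    · have h3 : Real.exp ((r - Real.log φ) * l1 k) ≤ φ⁻¹ * Real.exp (r * l1 k) := by
        rw [← Real.exp_log (inv_pos.2 hφ0), ← Real.exp_add, Real.log_inv]
        apply Real.exp_le_exp.2
        have := mul_le_mul_of_nonneg_left (one_le_l1 hk) (Real.log_nonneg hφ)
        linarith
      calc _ ≤ (1 + 2 * Real.pi * l1 k) * l1 (g k) * (φ⁻¹ * Real.exp (r * l1 k)) := by gcongr
        _ = _ := by ring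
  have hs : Summable fun k => φ⁻¹ * ((1 + 2 * Real.pi * l1 k) * l1 (g k) * Real.exp (r * l1 k)) :=
    Summable.mul_left _ hg
  have hmem : g ∈ spA' d (r - Real.log φ) := Summable.of_nonneg_of_le (fun k => by
    have h1 := l1_nonneg k
    have h2 := l1_nonneg (g k)
    positivity) hterm hs
  exact ⟨hmem, (Summable.tsum_le_tsum hterm hmem hs).trans_eq tsum_mul_left⟩

theorem nA_nonConst_le {r : ℝ} {Y : VF d} (hY : Y ∈ spA d r) (v : Fin d → ℝ) :
    nA r (nonConst Y) ≤ nA r (Y - constVF v) := by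
  have h1 : Y - constVF v ∈ spA d r := by
    rw [sub_eq_add_neg]
    exact spA_add hY (spA_neg (constVF_mem_spA r v))
  refine (nonConst_mem_spA hY).tsum_le_tsum (fun k => ?_) h1
  by_cases hk : k = 0
  · subst hk
    simp [nonConst, l1_nonneg]
  · simp [nonConst, constVF, hk]

theorem mem_spA'_of_nonConst {r : ℝ} {X : VF d} (h : nonConst X ∈ spA' d r) : X ∈ spA' d r := by
  refine (h.add (summable_of_eq_zero_of_ne (f := fun k : Fin d → ℤ =>
    if k = 0 then l1 (X 0) else 0) 0 fun k hk => if_neg hk)).congr fun k => ?_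
  by_cases hk : k = 0
  · subst hk
    simp [nonConst]
  · simp [nonConst, hk]

/-- Uniformization followed by rescaling and by narrowing of the strip maps real fields in the ball of
radius `ε` about `v`, with rotation vector `v`, to real fields in the ball of radius `ε'` about
`η T v`, with rotation vector `η T v`. The width `r` is the one left by the uniformization. -/
theorem renormalization_step (hs : 0 < s) (hsv : s < l1 v) {ν : ℝ} (hν : 0 < ν) (hr : 0 < r)
    {disp elim : VF d → VF d} (hU : IsUniformization v s r ν disp elim) (hδ : 0 < δ) (ha : 0 < a)
    (hcone : ∀ k ∈ res v s, l1 ((modeEquiv T).symm k) ≤ a * l1 k) (hη : η ≠ 0) {φ ε' : ℝ}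
    (hφ : φ = max 1 (2 * ((d : ℝ) + 1) * opNorm v s r (r / a - δ) η T * (eps v s ν / ε')))
    (hε' : 0 < ε') (hρ' : 0 ≤ r / a - δ - Real.log φ)
    {X : VF d} (hX : X ∈ ball' (r + ν) v (eps v s ν)) (hreal : IsRealVF X)
    (hrot : HasApproxRot (onReal X) v) :
    rescale η T (elim X) ∈ spA' d (r / a - δ - Real.log φ) ∧
      IsRealVF (rescale η T (elim X)) ∧
      HasApproxRot (onReal (rescale η T (elim X))) (η • realMat T v) ∧
      nA' (r / a - δ - Real.log φ)
        (rescale η T (elim X) - constVF (η • realMat T v)) < ε' := by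
  have hε := eps_pos hs hsv hν
  have hdisp := hU.disp_mem X hX
  have hY := hU.elim_mem X hX
  have hpb := hU.pullback X hX
  have hfar := hU.eliminates X hX
  have hdreal := hU.real X hX hreal
  set Y := elim X with hYdef
  have hX1 : X - constVF v ∈ spA' d (r + ν) := by
    rw [sub_eq_add_neg]
    exact spA'_add hX.1 (spA'_neg (constVF_mem_spA' _ v))
  have hu1 : nA' r (disp X) < 1 := by
    refine (hU.disp_le X hX).trans_lt ?_
    have h1 : nA r (projFar v s X) ≤ nA' (r + ν) (X - constVF v) := by
      rw [← projFar_sub_constVF]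
      have h2 := spA'_subset_spA _ hX1
      have h3 : nA r (projFar v s (X - constVF v)) ≤ nA r (X - constVF v) := by
        have h4 := spA_mono (by linarith) h2 (r := r)
        have h5 : ∀ k, l1 (projFar v s (X - constVF v) k) * Real.exp (r * l1 k) ≤
            l1 ((X - constVF v) k) * Real.exp (r * l1 k) := fun k => by
          by_cases hk : k ∈ far v s
          · simp [projFar, hk]
          · simp [projFar, hk, l1_nonneg, mul_nonneg, (Real.exp_pos _).le]
        exact (Summable.of_nonneg_of_le
          (fun k => mul_nonneg (l1_nonneg _) (Real.exp_pos _).le) h5 h4).tsum_le_tsum h5 h4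
      exact h3.trans ((nA_mono (by linarith) h2).trans (nA_le_nA' hX1))
    have h2 := eps_bound_cone hs hsv hX.2.le
    have h3 := nA'_nonneg (r + ν) (X - constVF v)
    calc 42 / s * nA r (projFar v s X) ≤ 42 / s * nA' (r + ν) (X - constVF v) := by gcongr
      _ < 1 := by rw [div_mul_eq_mul_div, div_lt_one hs]; linarith
  have hYreal := hpb.isRealVF hr hdisp hu1 hdreal hreal
  have hYrot := hpb.hasApproxRot hr hdisp hu1 hdreal hreal hrot
  have hreal' := isRealVF_rescale hr.le hY hYreal η T
  have hrot' := hasApproxRot_rescale hr.le hY hYreal hη T hYrot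
  have hres : nonConst Y ∈ resNonConst v s r := by
    refine ⟨nonConst_mem_spA hY, ?_, by simp [nonConst]⟩
    funext k
    by_cases hk : k ∈ far v s
    · have hk0 : k ≠ 0 := fun h => zero_notMem_far (h ▸ hk)
      have := congrFun hfar k
      simpa [projFar, hk, nonConst, hk0] using this
    · simp [projFar, hk]
  obtain ⟨C, -, hb⟩ := rescale_bounded (η := η) hr.le hδ ha hcone
  have hmem1 := (hb _ hres.1 hres.2.1).1
  have hop := nA'_rescale_le_opNorm (η := η) hr.le hδ ha hcone hres
  rw [← nonConst_rescale] at hmem1 hop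
  have hφ1 : 1 ≤ φ := by rw [hφ]; exact le_max_left _ _
  have hφ0 : 0 < φ := zero_lt_one.trans_le hφ1
  obtain ⟨hmem2, hcut⟩ := nA'_cutoff hφ1 hmem1 (by simp [nonConst])
  have hmem := mem_spA'_of_nonConst hmem2
  refine ⟨hmem, hreal', hrot', (nA'_sub_constVF_le hρ' hmem hreal' hrot').trans_lt ?_⟩
  set L := opNorm v s r (r / a - δ) η T with hL
  have hL0 : 0 ≤ L := opNorm_nonneg _ _ _ _ _ _
  have hn : nA r (nonConst Y) ≤ 2 * nA' (r + ν) (X - constVF v) :=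
    (nA_nonConst_le hY v).trans (hU.elim_le X hX)
  have hd : (0 : ℝ) < (d : ℝ) + 1 := by positivity
  have hlt := hX.2
  have h1 : ((d : ℝ) + 1) * nA' (r / a - δ - Real.log φ) (nonConst (rescale η T Y)) ≤
      φ⁻¹ * (2 * ((d : ℝ) + 1) * L * nA' (r + ν) (X - constVF v)) := by
    calc _ ≤ ((d : ℝ) + 1) * (φ⁻¹ * (L * (2 * nA' (r + ν) (X - constVF v)))) := by
          gcongr
          exact hcut.trans (by gcongr; exact hop.trans (by gcongr))
      _ = _ := by ring
  refine h1.trans_lt ?_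
  rw [inv_mul_lt_iff₀ hφ0]
  rcases hL0.eq_or_lt with h0 | hpos
  · rw [← h0]
    simpa using mul_pos hφ0 hε'
  · have h2 : 2 * ((d : ℝ) + 1) * L * (eps v s ν / ε') ≤ φ := by rw [hφ]; exact le_max_right _ _
    calc 2 * ((d : ℝ) + 1) * L * nA' (r + ν) (X - constVF v) <
          2 * ((d : ℝ) + 1) * L * eps v s ν := by gcongr
      _ = 2 * ((d : ℝ) + 1) * L * (eps v s ν / ε') * ε' := by field_simp
      _ ≤ φ * ε' := by gcongr

end Rescaling

/-! ### The continued fraction and the strip widths -/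

/-- In dimension at least two every resonance cone contains a non-zero integer vector. -/
theorem exists_mem_res {m : ℕ} (hm : 1 ≤ m) (v : Fin (m + 1) → ℝ) {s : ℝ} (hs : 0 < s) :
    ∃ k ∈ res v s, k ≠ 0 := by
  let i : Fin (m + 1) := 0
  let j : Fin (m + 1) := Fin.last m
  have hij : i ≠ j := fun h => by
    have := congrArg Fin.val h
    simp [i, j] at this
    omega
  by_cases hj : v j = 0
  · refine ⟨Pi.single j 1, ?_, by simp⟩
    have : pair (Pi.single j 1) v = 0 := by
      simp [pair, Pi.single_apply, hj]
    change |pair (Pi.single j 1) v| ≤ s * l1 (Pi.single j (1 : ℤ))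
    rw [this, abs_zero]
    exact mul_nonneg hs.le (l1_nonneg _)
  · -- The second coordinate is the integer closest to the one annihilating the pairing.
    obtain ⟨N, hN⟩ := exists_nat_gt (|v j| / s)
    let q : ℤ := round (-(N * v i / v j))
    have hN0 : (0 : ℝ) < N := lt_of_le_of_lt (by positivity) hN
    let k : Fin (m + 1) → ℤ := Pi.single i (N : ℤ) + Pi.single j q
    have hki : k i = N := by simp [k, hij]
    have hpair : pair k v = N * v i + q * v j := by
      simp [pair, k, add_mul, Finset.sum_add_distrib, Pi.single_apply]
    refine ⟨k, ?_, fun h => ?_⟩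
    · have h1 : |pair k v| ≤ |v j| := by
        have h2 := abs_sub_round (-(N * v i / v j))
        have h3 : N * v i + q * v j = -((-(N * v i / v j) - q) * v j) := by
          field_simp
          ring
        rw [hpair, h3, abs_neg, abs_mul]
        exact mul_le_of_le_one_left (abs_nonneg _) (h2.trans (by norm_num))
      have h4 : (N : ℝ) ≤ l1 k := by
        have := norm_apply_le_l1 k i
        rw [hki] at this
        simpa using this
      change |pair k v| ≤ s * l1 k
      rw [div_lt_iff₀ hs] at hN
      nlinarith
    · have := congrFun h i
      rw [hki, Pi.zero_apply] at this
      have h0 : (N : ℝ) = 0 := by exact_mod_cast this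
      exact hN0.ne' h0

namespace ContFrac

variable {m : ℕ} {α : Fin m → ℝ} (c : ContFrac α)

theorem P_zero : c.P 0 = 1 := by
  refine ((c.isFund (matOmega α * matE m (c.time 0))).choose_spec.2 1 ?_).symm
  have h1 : matE m 0 = 1 := by
    ext i j
    simp [matE, Matrix.one_apply]
  have h2 : toSLR (1 : SL(m + 1, ℤ)) = 1 := map_one _
  beta_reduce
  rw [c.time_zero, h1, h2, one_mul, mul_one]
  exact c.base_mem

theorem Pom_eq (n : ℕ) : c.Pom n = realMat (c.P n) (omegaVec α) := by
  ext i
  rw [realMat_apply]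
  rfl

theorem Pom_last_ne_zero (hω : ∀ k : Fin (m + 1) → ℤ, k ≠ 0 → pair k (omegaVec α) ≠ 0) (n : ℕ) :
    c.Pom n (Fin.last m) ≠ 0 := by
  rw [Pom_eq, realMat_apply]
  refine hω (fun j => (c.P n : Matrix (Fin (m + 1)) (Fin (m + 1)) ℤ) (Fin.last m) j) fun h => ?_
  have := Matrix.det_eq_zero_of_row_eq_zero (A := (c.P n : Matrix (Fin (m + 1)) (Fin (m + 1)) ℤ))
    (Fin.last m) fun j => congrFun h j
  rw [(c.P n).det_coe] at this
  exact one_ne_zero this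

theorem lam_ne_zero (hω : ∀ k : Fin (m + 1) → ℤ, k ≠ 0 → pair k (omegaVec α) ≠ 0) (n : ℕ) :
    c.lam n ≠ 0 :=
  div_ne_zero (Real.exp_pos _).ne' (mul_ne_zero (Real.exp_pos _).ne' (c.Pom_last_ne_zero hω n))

theorem eta_ne_zero (hω : ∀ k : Fin (m + 1) → ℤ, k ≠ 0 → pair k (omegaVec α) ≠ 0) (n : ℕ) :
    c.eta n ≠ 0 :=
  div_ne_zero (c.lam_ne_zero hω _) (c.lam_ne_zero hω _)

theorem om_zero : c.om 0 = omegaVec α := by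
  have h : c.Pom 0 = omegaVec α := by rw [Pom_eq, P_zero, realMat_one]
  have h1 : c.lam 0 = 1 := by
    rw [lam, gam, h]
    simp [omegaVec]
  rw [om, h, h1, one_smul]

theorem om_succ (hω : ∀ k : Fin (m + 1) → ℤ, k ≠ 0 → pair k (omegaVec α) ≠ 0) (n : ℕ) :
    c.om (n + 1) = c.eta n • realMat (c.T (n + 1)) (c.om n) := by
  have h1 : c.T (n + 1) = c.P (n + 1) * (c.P n)⁻¹ := rfl
  rw [om, om, Pom_eq, Pom_eq, map_smul, h1, ← realMat_mul, inv_mul_cancel_right, smul_smul, eta,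
    div_mul_cancel₀ _ (c.lam_ne_zero hω n)]

variable {σ : ℕ → ℝ}

theorem bddAbove_A (σ : ℕ → ℝ) (n : ℕ) : BddAbove {y | ∃ k ∈ res (c.om n) (σ n), k ≠ 0 ∧
    y = l1 ((((c.T (n + 1))⁻¹ : SL(m + 1, ℤ)) : Matrix (Fin (m + 1)) (Fin (m + 1)) ℤ)ᵀ *ᵥ k)
      / l1 k} := by
  refine ⟨∑ i, ∑ j, ‖(((c.T (n + 1))⁻¹ : SL(m + 1, ℤ)) :
    Matrix (Fin (m + 1)) (Fin (m + 1)) ℤ)ᵀ i j‖, ?_⟩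
  rintro y ⟨k, -, hk, rfl⟩
  rw [div_le_iff₀ (l1_pos hk)]
  exact l1_mulVec_le _ _

/-- `A_n` bounds the expansion of the resonance cone. -/
theorem cone_le (σ : ℕ → ℝ) (n : ℕ) (k : Fin (m + 1) → ℤ) (hk : k ∈ res (c.om n) (σ n)) :
    l1 ((modeEquiv (c.T (n + 1))).symm k) ≤ c.A σ n * l1 k := by
  by_cases h0 : k = 0
  · subst h0
    rw [← modeEquiv_zero (c.T (n + 1)), Equiv.symm_apply_apply]
    simp [modeEquiv_zero]
  · rw [← div_le_iff₀ (l1_pos h0)]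
    exact le_csSup (c.bddAbove_A σ n) ⟨k, hk, h0, rfl⟩

theorem A_pos (hm : 1 ≤ m) (hσ : ∀ n, 0 < σ n) (n : ℕ) : 0 < c.A σ n := by
  obtain ⟨k, hk, hk0⟩ := exists_mem_res hm (c.om n) (hσ n)
  have h1 := c.cone_le σ n k hk
  have h2 : (modeEquiv (c.T (n + 1))).symm k ≠ 0 := fun h => hk0 <| by
    rw [Equiv.symm_apply_eq, modeEquiv_zero] at h
    exact h
  have h3 := (l1_pos h2).trans_le h1
  exact pos_of_mul_pos_left h3 (l1_nonneg k)

variable {δ ν ρ : ℝ}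

theorem log_phi (n : ℕ) (r : ℝ) : Real.log (Real.exp (δ + ν / c.A σ n) * c.phi σ δ ν n r) =
    δ + ν / c.A σ n + Real.log (c.phi σ δ ν n r) := by
  have : 0 < c.phi σ δ ν n r := zero_lt_one.trans_le (le_max_left _ _)
  rw [Real.log_mul (Real.exp_pos _).ne' this.ne', Real.log_exp]

theorem log_phi_nonneg (n : ℕ) (r : ℝ) : 0 ≤ Real.log (c.phi σ δ ν n r) :=
  Real.log_nonneg (le_max_left _ _)

theorem width_zero : c.width σ δ ν ρ 0 = ρ := by simp [width, Bsum]

theorem Bsum_succ (n : ℕ) : c.Bsum σ δ ν ρ (n + 1) = c.Bsum σ δ ν ρ n +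
    (∏ i ∈ Finset.range (n + 1), c.A σ i) *
      (δ + ν / c.A σ n + Real.log (c.phi σ δ ν n (c.width σ δ ν ρ n))) := by
  rw [← log_phi]
  rfl

theorem width_succ (hA : ∀ n, 0 < c.A σ n) (n : ℕ) : c.width σ δ ν ρ (n + 1) =
    (c.width σ δ ν ρ n - ν) / c.A σ n - δ -
      Real.log (c.phi σ δ ν n (c.width σ δ ν ρ n)) := by
  have hp : 0 < ∏ i ∈ Finset.range n, c.A σ i := Finset.prod_pos fun i _ => hA i
  have hn := hA n
  have h : c.width σ δ ν ρ (n + 1) = (ρ - c.Bsum σ δ ν ρ (n + 1)) /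
    ∏ i ∈ Finset.range (n + 1), c.A σ i := rfl
  rw [h, Bsum_succ]
  set l := Real.log (c.phi σ δ ν n (c.width σ δ ν ρ n))
  rw [width, Finset.prod_range_succ]
  field_simp
  ring

/-- Each increment of `ℬ_n` pays for the width `ν` that the next uniformization consumes. -/
theorem lt_width (hA : ∀ n, 0 < c.A σ n) (hδ : 0 < δ) (hν : 0 < ν) {B : ℝ}
    (hB : Tendsto (c.Bsum σ δ ν ρ) atTop (𝓝 B)) (hρ : B < ρ) (n : ℕ) :
    ν < c.width σ δ ν ρ n := by
  have hp : ∀ n, 0 < ∏ i ∈ Finset.range n, c.A σ i := fun n => Finset.prod_pos fun i _ => hA i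
  have hmono : Monotone (c.Bsum σ δ ν ρ) := monotone_nat_of_le_succ fun n => by
    rw [Bsum_succ, le_add_iff_nonneg_right]
    have h1 := (hp (n + 1)).le
    have h2 := c.log_phi_nonneg (σ := σ) (δ := δ) (ν := ν) n (c.width σ δ ν ρ n)
    have h3 := div_pos hν (hA n)
    exact mul_nonneg h1 (by linarith)
  have h1 : c.Bsum σ δ ν ρ (n + 1) < ρ := (hmono.ge_of_tendsto hB (n + 1)).trans_lt hρ
  have h2 : 0 < c.width σ δ ν ρ (n + 1) := by
    rw [width]
    exact div_pos (sub_pos.2 h1) (hp (n + 1))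
  have h3 := c.log_phi_nonneg (σ := σ) (δ := δ) (ν := ν) n (c.width σ δ ν ρ n)
  rw [c.width_succ hA n] at h2
  have h4 : 0 < (c.width σ δ ν ρ n - ν) / c.A σ n := by linarith
  exact sub_pos.1 ((div_pos_iff_of_pos_right (hA n)).1 h4)

theorem epsN_pos (hσ : ∀ n, 0 < σ n ∧ σ n < l1 (c.om n)) (hν : 0 < ν) (n : ℕ) :
    0 < c.epsN σ ν n :=
  eps_pos (hσ n).1 (hσ n).2 hν

theorem exists_isScheme (hm : 1 ≤ m) (hσ : ∀ n, 0 < σ n ∧ σ n < l1 (c.om n)) (hδ : 0 < δ)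
    (hν : 0 < ν) {B : ℝ} (hB : Tendsto (c.Bsum σ δ ν ρ) atTop (𝓝 B)) (hρ : B < ρ) :
    ∃ disp elim : ℕ → VF (m + 1) → VF (m + 1), c.IsScheme σ δ ν ρ disp elim := by
  have hw : ∀ n, 0 < c.width σ δ ν ρ n - ν := fun n =>
    sub_pos.2 (c.lt_width (c.A_pos hm fun n => (hσ n).1) hδ hν hB hρ n)
  choose disp elim h using fun n =>
    exists_isUniformization (hσ n).1 (hσ n).2 hν (hw n)
  exact ⟨disp, elim, fun n => ⟨hw n, h n⟩⟩

/-- The invariant carried through the renormalization: `X_n` is a real field with rotation vector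
`ω_n` within distance `ε_n` of the constant field `ω_n`. -/
theorem renorm_invariant (hm : 1 ≤ m)
    (hω : ∀ k : Fin (m + 1) → ℤ, k ≠ 0 → pair k (omegaVec α) ≠ 0)
    (hσ : ∀ n, 0 < σ n ∧ σ n < l1 (c.om n)) (hδ : 0 < δ) (hν : 0 < ν)
    {disp elim : ℕ → VF (m + 1) → VF (m + 1)} (hsch : c.IsScheme σ δ ν ρ disp elim)
    {X : VF (m + 1)} (hX : X ∈ spA' (m + 1) ρ) (hreal : IsRealVF X)
    (hrot : HasApproxRot (onReal X) (omegaVec α))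
    (hsmall : nA' ρ (nonConst X) < c.epsN σ ν 0 / (((m + 1 : ℕ) : ℝ) + 1)) (n : ℕ) :
    c.renorm elim X n ∈ ball' (c.width σ δ ν ρ n) (c.om n) (c.epsN σ ν n) ∧
      IsRealVF (c.renorm elim X n) ∧ HasApproxRot (onReal (c.renorm elim X n)) (c.om n) := by
  have hA := c.A_pos hm fun n => (hσ n).1
  have hw : ∀ n, 0 < c.width σ δ ν ρ n - ν := fun n => (hsch n).1
  induction n with
  | zero =>
    have hr : 0 ≤ ρ := by
      have := hw 0
      rw [width_zero] at this
      linarith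
    rw [om_zero, width_zero]
    refine ⟨⟨hX, (nA'_sub_constVF_le hr hX hreal hrot).trans_lt ?_⟩, hreal, hrot⟩
    rw [lt_div_iff₀ (by positivity)] at hsmall
    linarith
  | succ n ih =>
    obtain ⟨hball, hre, hro⟩ := ih
    have hcone := c.cone_le σ n
    have hwn : c.width σ δ ν ρ n = c.width σ δ ν ρ n - ν + ν := (sub_add_cancel _ _).symm
    rw [hwn] at hball
    have hpos : 0 ≤ c.width σ δ ν ρ (n + 1) := by linarith [hw (n + 1)]
    rw [c.width_succ hA n] at hpos
    have hstep := renormalization_step (hσ n).1 (hσ n).2 hν (hw n) (hsch n).2 hδ (hA n) hcone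
      (c.eta_ne_zero hω n) (φ := c.phi σ δ ν n (c.width σ δ ν ρ n)) rfl
      (c.epsN_pos hσ hν (n + 1)) hpos hball hre hro
    rw [← c.width_succ hA n, ← c.om_succ hω n] at hstep
    exact ⟨⟨hstep.1, hstep.2.2.2⟩, hstep.2.1, hstep.2.2.1⟩

end ContFrac

end TorusRenorm

end

theorem mainTheorem4 {m : ℕ} (hm : 1 ≤ m) (α : Fin m → ℝ)
    (hω : ∀ k : Fin (m + 1) → ℤ, k ≠ 0 → TorusRenorm.pair k (TorusRenorm.omegaVec α) ≠ 0)
    (c : TorusRenorm.ContFrac α) (σ : ℕ → ℝ)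
    (hσ : ∀ n, 0 < σ n ∧ σ n < TorusRenorm.l1 (c.om n))
    (δ ν ρ : ℝ) (hδ : 0 < δ) (hν : 0 < ν)
    (B : ℝ) (hB : Tendsto (c.Bsum σ δ ν ρ) atTop (𝓝 B)) (hρ : B < ρ) :
    (∃ disp elim : ℕ → TorusRenorm.VF (m + 1) → TorusRenorm.VF (m + 1),
      c.IsScheme σ δ ν ρ disp elim) ∧
    ∀ disp elim : ℕ → TorusRenorm.VF (m + 1) → TorusRenorm.VF (m + 1),
      c.IsScheme σ δ ν ρ disp elim →
      ∀ X ∈ TorusRenorm.spA' (m + 1) ρ, TorusRenorm.IsRealVF X →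
        TorusRenorm.HasRot (TorusRenorm.onReal X) (TorusRenorm.omegaVec α) →
        TorusRenorm.nA' ρ (TorusRenorm.nonConst X) <
          c.epsN σ ν 0 / (((m + 1 : ℕ) : ℝ) + 1) →
        c.InfinitelyRenormalizable σ δ ν ρ elim X ∧
          ∀ n, TorusRenorm.nA' (c.width σ δ ν ρ n)
            (c.renorm elim X n - TorusRenorm.constVF (c.om n)) < c.epsN σ ν n := by
  refine ⟨c.exists_isScheme hm hσ hδ hν hB hρ, fun disp elim hsch X hX hreal hrot hsmall => ?_⟩
  have h := c.renorm_invariant hm hω hσ hδ hν hsch hX hreal hrot.hasApproxRot hsmall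
  refine ⟨fun n => ?_, fun n => (h n).1.2⟩
  induction n with
  | zero => exact hX
  | succ n ih => exact ⟨ih, (h n).1, by linarith [(hsch (n + 1)).1], (h (n + 1)).1.1⟩
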